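/- Let $\mathsf{A}$ be an abelian category with a torsion pair $(\mathcal{T},\mathcal{F})$ (strictly full subcategories with $\operatorname{Hom}(\mathcal T,\mathcal F)=0$ such that every object $X$ sits in a short exact sequence $0\to T\to X\to F\to 0$ with $T\in\mathcal T$, $F\in\mathcal F$). Let $\mathsf{B}=\mathsf{B}(\mathsf{A};\mathcal{T},\mathcal{F})$ be its tilt: the objects are the complexes $[X^{-1}\xrightarrow{d}X^0]$ in $\mathsf A$ with $\ker d\in\mathcal F$ and $\operatorname{coker} d\in\mathcal T$; a morphism $X\to Y$ is an isomorphism class of butterflies, i.e. of objects $E$ with maps $\kappa:X^{-1}\to E$, $\iota:Y^{-1}\to E$, $\sigma:E\to X^0$, $\rho:E\to Y^0$ such that $\sigma\kappa=d_X$, $\rho\iota=d_Y$, $\rho\kappa=0$ and $0\to Y^{-1}\xrightarrow{\iota}E\xrightarrow{\sigma}X^0\to0$ is short exact; the composite of $E:X\to Y$ and $E':Y\to Z$ is $\operatorname{coker}\big((\iota,\kappa'):Y^{-1}\to E\times_{Y^0}E'\big)$. A morphism of complexes $(f^{-1},f^0):X\to Y$ defines the (strict) morphism of $\mathsf B$ with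 $E=X^0\oplus Y^{-1}$, $\kappa=(d_X,-f^{-1})$, $\rho=f^0+d_Y$, and $\iota$, $\sigma$ the canonical inclusion and projection. Then $\mathsf B$ is an abelian category, and $(\mathcal T',\mathcal F')$ is a torsion pair in it, where $\mathcal T'=\mathcal F[1]$ consists of the objects isomorphic to some $[F\to0]$ with $F\in\mathcal F$, and $\mathcal F'=\mathcal T$ of the objects isomorphic to some $[0\to T]$ with $T\in\mathcal T$. Let $\mathsf{C}=\mathsf{B}(\mathsf{B};\mathcal T',\mathcal F')$ be the iterated tilt; it is again an abelian category. Let $\mathsf{C}^{st}$ be the additive category of 4-tuples $[K_1\subseteq K_2\subseteq E\supseteq M]$, with $E$ an object of $\mathsf{A}$ and $K_1,K_2,M$ subobjects such that $K_2\cap M\in\mathcal{F}$ and $E/(K_1+M)\in\mathcal{T}$; a morphism is a morphism $E\to E'$ in $\mathsf A$ respecting the three subobjects. Such a 4-tuple defines a morphism $[K_1\to E/M]\to[M\to E/K_2]$ of $\mathsf{B}$ (the butterfly with central object $E$), and this two-term complex in $\mathsf B$ is an object of $\mathsf C$; a morphism of 4-tuples induces strict morphisms on the two terms, hence a morphism of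 complexes in $\mathsf B$, hence a strict morphism in $\mathsf C$. This defines the inclusion $i:\mathsf{C}^{st}\to\mathsf{C}$. Let $\mathcal S_{qis}$ be the class of morphisms of $\mathsf C^{st}$ that are quasi-isomorphisms of two-term complexes in $\mathsf{B}$, i.e. that induce isomorphisms in $\mathsf B$ on kernels and on cokernels. Then $i$ is additive, it sends $\mathcal S_{qis}$ to isomorphisms, and the induced functor $\mathcal S_{qis}^{-1}\mathsf{C}^{st}\to\mathsf{C}$ is an additive equivalence of abelian categories, where $\mathcal S_{qis}^{-1}\mathsf C^{st}$ has an abelian structure for which the localization functor $\mathsf C^{st}\to\mathcal S_{qis}^{-1}\mathsf C^{st}$ is additive. Furthermore, the functor $H:\mathsf{C}^{st}\to\mathsf{A}$, $[K_1\subseteq K_2\subseteq E\supseteq M]\mapsto K_2/K_1$, factors through $i$ up to natural isomorphism: there is a functor $H':\mathsf C\to\mathsf A$ with $H'\circ i\cong H$. Finally, $\mathcal S_{qis}$ is exactly the class of morphisms $f$ of $\mathsf{C}^{st}$ such that $H(f)$ is an isomorphism. -/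

import Mathlib

open CategoryTheory CategoryTheory.Limits

universe v u

noncomputable section

/-! ### Torsion pairs -/

/-- `(T, F)` is a torsion pair of (strictly full) subcategories of `A`.  Closure of `T` and `F` under
finite direct sums is automatic. -/
structure IsTorsionPair {A : Type u} [Category.{v} A] [Abelian A] (T F : ObjectProperty A) :
    Prop where
  isoT : T.IsClosedUnderIsomorphisms
  isoF : F.IsClosedUnderIsomorphisms
  hom_eq_zero : ∀ ⦃X Y : A⦄, T X → F Y → ∀ f : X ⟶ Y, f = 0
  exists_shortExact : ∀ X : A, ∃ (P Q : A) (i : P ⟶ X) (p : X ⟶ Q) (w : i ≫ p = 0),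
    (ShortComplex.mk i p w).ShortExact ∧ T P ∧ F Q

namespace IsTorsionPair

variable {A : Type u} [Category.{v} A] [Abelian A] {T F : ObjectProperty A}

lemma F_of_mono (h : IsTorsionPair T F) {X Y : A} (f : X ⟶ Y) [Mono f] (hY : F Y) : F X := by
  obtain ⟨P, Q, i, p, w, hs, hP, hQ⟩ := h.exists_shortExact X
  have h1 : i = 0 := by
    have := h.hom_eq_zero hP hY (i ≫ f)
    exact zero_of_comp_mono f this
  have : Epi p := hs.epi_g
  have : Mono p := hs.exact.mono_g h1
  have : IsIso p := isIso_of_mono_of_epi p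
  have := h.isoF
  exact F.prop_of_iso (asIso p).symm hQ

lemma T_of_epi (h : IsTorsionPair T F) {X Y : A} (f : X ⟶ Y) [Epi f] (hX : T X) : T Y := by
  obtain ⟨P, Q, i, p, w, hs, hP, hQ⟩ := h.exists_shortExact Y
  have h1 : p = 0 := by
    have := h.hom_eq_zero hX hQ (f ≫ p)
    exact zero_of_epi_comp f this
  have : Mono i := hs.mono_f
  have : Epi i := hs.exact.epi_f h1
  have : IsIso i := isIso_of_mono_of_epi i
  have := h.isoT
  exact T.prop_of_iso (asIso i) hP

end IsTorsionPair

/-! ### Two-term complexes and butterflies -/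

/-- A two-term complex `[X⁻¹ ⟶ X⁰]` in `A`, with terms `neg` and `zer`. -/
structure TwoTerm (A : Type u) [Category.{v} A] where
  neg : A
  zer : A
  d : neg ⟶ zer

/-- A butterfly from `X` to `Y`: a commutative diagram whose two diagonals are complexes and whose
NE-SW diagonal `Y⁻¹ ⟶ E ⟶ X⁰` is short exact. -/
structure Butterfly {A : Type u} [Category.{v} A] [Abelian A] (X Y : TwoTerm A) where
  E : A
  κ : X.neg ⟶ E
  ι : Y.neg ⟶ E
  σ : E ⟶ X.zer
  ρ : E ⟶ Y.zer
  κσ : κ ≫ σ = X.d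
  ιρ : ι ≫ ρ = Y.d
  κρ : κ ≫ ρ = 0
  ισ : ι ≫ σ = 0
  exact : (ShortComplex.mk ι σ ισ).ShortExact

namespace Butterfly

variable {A : Type u} [Category.{v} A] [Abelian A]

attribute [simp] κσ ιρ κρ ισ

attribute [local simp] pullback.lift_fst pullback.lift_snd pullback.lift_fst_assoc
  pullback.lift_snd_assoc

section

variable {X Y Z U : TwoTerm A}

@[simp] lemma κσ_assoc (P : Butterfly X Y) {V : A} (h : X.zer ⟶ V) :
    P.κ ≫ P.σ ≫ h = X.d ≫ h := by rw [← Category.assoc, P.κσ]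

@[simp] lemma ιρ_assoc (P : Butterfly X Y) {V : A} (h : Y.zer ⟶ V) :
    P.ι ≫ P.ρ ≫ h = Y.d ≫ h := by rw [← Category.assoc, P.ιρ]

@[simp] lemma κρ_assoc (P : Butterfly X Y) {V : A} (h : Y.zer ⟶ V) :
    P.κ ≫ P.ρ ≫ h = 0 := by rw [← Category.assoc, P.κρ, zero_comp]

@[simp] lemma ισ_assoc (P : Butterfly X Y) {V : A} (h : X.zer ⟶ V) :
    P.ι ≫ P.σ ≫ h = 0 := by rw [← Category.assoc, P.ισ, zero_comp]

instance (P : Butterfly X Y) : Mono P.ι := P.exact.mono_f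
instance (P : Butterfly X Y) : Epi P.σ := P.exact.epi_g

/-- Two butterflies are isomorphic if there is an isomorphism of their central objects that commutes
with all four arrows. -/
def Isomorphic (P Q : Butterfly X Y) : Prop :=
  ∃ e : P.E ≅ Q.E, P.κ ≫ e.hom = Q.κ ∧ P.ι ≫ e.hom = Q.ι ∧ e.hom ≫ Q.σ = P.σ ∧ e.hom ≫ Q.ρ = P.ρ

/-- Isomorphism of butterflies as an equivalence relation. -/
def setoid (X Y : TwoTerm A) : Setoid (Butterfly X Y) where
  r := Isomorphic
  iseqv :=
    { refl := fun P => ⟨Iso.refl _, by simp⟩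
      symm := by
        rintro P Q ⟨e, h1, h2, h3, h4⟩
        refine ⟨e.symm, ?_, ?_, ?_, ?_⟩
        · simp [← h1]
        · simp [← h2]
        · simp [← h3]
        · simp [← h4]
      trans := by
        rintro P Q R ⟨e, h1, h2, h3, h4⟩ ⟨e', h1', h2', h3', h4'⟩
        exact ⟨e ≪≫ e', by simp [reassoc_of% h1, h1'], by simp [reassoc_of% h2, h2'],
          by simp [h3, h3'], by simp [h4, h4']⟩ }

lemma isomorphic_of_hom {P Q : Butterfly X Y} (f : P.E ⟶ Q.E) (h1 : P.κ ≫ f = Q.κ)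
    (h2 : P.ι ≫ f = Q.ι) (h3 : f ≫ Q.σ = P.σ) (h4 : f ≫ Q.ρ = P.ρ) : Isomorphic P Q := by
  let φ : ShortComplex.mk P.ι P.σ P.ισ ⟶ ShortComplex.mk Q.ι Q.σ Q.ισ :=
    { τ₁ := 𝟙 _, τ₂ := f, τ₃ := 𝟙 _, comm₁₂ := by simp [h2], comm₂₃ := by simp [h3] }
  have : IsIso φ.τ₁ := by dsimp [φ]; infer_instance
  have : IsIso φ.τ₃ := by dsimp [φ]; infer_instance
  have : IsIso f := ShortComplex.isIso₂_of_shortExact_of_isIso₁₃ φ P.exact Q.exact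
  exact ⟨asIso f, h1, h2, h3, h4⟩

/-- A morphism of complexes, regarded as a butterfly. -/
def strict (f : X.neg ⟶ Y.neg) (g : X.zer ⟶ Y.zer) (w : f ≫ Y.d = X.d ≫ g) : Butterfly X Y where
  E := X.zer ⊞ Y.neg
  κ := biprod.lift X.d (-f)
  ι := biprod.inr
  σ := biprod.fst
  ρ := biprod.desc g Y.d
  κσ := by simp
  ιρ := by simp
  κρ := by simp [biprod.lift_desc, w]
  ισ := by simp
  exact := (ShortComplex.Splitting.mk (S := ShortComplex.mk (biprod.inr : Y.neg ⟶ X.zer ⊞ Y.neg)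
    biprod.fst (by simp)) biprod.snd biprod.inl (by simp) (by simp)
      (by rw [add_comm]; exact biprod.total)).shortExact

section strict

variable (f : X.neg ⟶ Y.neg) (g : X.zer ⟶ Y.zer) (w : f ≫ Y.d = X.d ≫ g)

/-- The projection `X⁰ ⊕ Y⁻¹ ⟶ Y⁻¹`. -/
def strictSnd : (strict f g w).E ⟶ Y.neg := (biprod.snd : X.zer ⊞ Y.neg ⟶ _)

/-- The inclusion `X⁰ ⟶ X⁰ ⊕ Y⁻¹`. -/
def strictInl : X.zer ⟶ (strict f g w).E := (biprod.inl : _ ⟶ X.zer ⊞ Y.neg)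

@[simp] lemma strictInl_σ : strictInl f g w ≫ (strict f g w).σ = 𝟙 _ := biprod.inl_fst
@[simp] lemma strictInl_snd : strictInl f g w ≫ strictSnd f g w = 0 := biprod.inl_snd
@[simp] lemma strictInl_ρ : strictInl f g w ≫ (strict f g w).ρ = g := biprod.inl_desc _ _
@[simp] lemma strict_ι_snd : (strict f g w).ι ≫ strictSnd f g w = 𝟙 _ := biprod.inr_snd
@[simp] lemma strict_κ_snd : (strict f g w).κ ≫ strictSnd f g w = -f := biprod.lift_snd _ _

@[simp] lemma strict_ι_snd_assoc {V : A} (h : Y.neg ⟶ V) :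
    (strict f g w).ι ≫ strictSnd f g w ≫ h = h := by
  rw [← Category.assoc, strict_ι_snd, Category.id_comp]
@[simp] lemma strict_κ_snd_assoc {V : A} (h : Y.neg ⟶ V) :
    (strict f g w).κ ≫ strictSnd f g w ≫ h = -f ≫ h := by
  rw [← Category.assoc, strict_κ_snd, Preadditive.neg_comp]

lemma strict_hom_ext {V : A} {a b : V ⟶ (strict f g w).E}
    (h1 : a ≫ (strict f g w).σ = b ≫ (strict f g w).σ)
    (h2 : a ≫ strictSnd f g w = b ≫ strictSnd f g w) : a = b := biprod.hom_ext _ _ h1 h2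

lemma strict_κ : (strict f g w).κ = X.d ≫ strictInl f g w - f ≫ (strict f g w).ι := by
  apply strict_hom_ext <;> simp

lemma comp_strict_ρ {V : A} (a : V ⟶ (strict f g w).E) :
    a ≫ (strict f g w).ρ = a ≫ (strict f g w).σ ≫ g + a ≫ strictSnd f g w ≫ Y.d := by
  have h : (strict f g w).ρ = (strict f g w).σ ≫ g + strictSnd f g w ≫ Y.d := biprod.desc_eq
  rw [← Preadditive.comp_add, ← h]

end strict

/-- The fibre product `E ×_{Y⁰} E'` of the central objects of two butterflies. -/
abbrev fibre (P : Butterfly X Y) (Q : Butterfly Y Z) : A := pullback P.ρ Q.σ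

/-- The map `(ι, κ') : Y⁻¹ ⟶ E ×_{Y⁰} E'`. -/
def diag (P : Butterfly X Y) (Q : Butterfly Y Z) : Y.neg ⟶ fibre P Q :=
  pullback.lift P.ι Q.κ (by simp)

@[simp] lemma diag_fst (P : Butterfly X Y) (Q : Butterfly Y Z) :
    diag P Q ≫ pullback.fst P.ρ Q.σ = P.ι := pullback.lift_fst _ _ _

@[simp] lemma diag_snd (P : Butterfly X Y) (Q : Butterfly Y Z) :
    diag P Q ≫ pullback.snd P.ρ Q.σ = Q.κ := pullback.lift_snd _ _ _

@[simp] lemma diag_fst_assoc (P : Butterfly X Y) (Q : Butterfly Y Z) {V : A} (h : P.E ⟶ V) :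
    diag P Q ≫ pullback.fst P.ρ Q.σ ≫ h = P.ι ≫ h := pullback.lift_fst_assoc _ _ _ _

@[simp] lemma diag_snd_assoc (P : Butterfly X Y) (Q : Butterfly Y Z) {V : A} (h : Q.E ⟶ V) :
    diag P Q ≫ pullback.snd P.ρ Q.σ ≫ h = Q.κ ≫ h := pullback.lift_snd_assoc _ _ _ _

lemma comp_exact (P : Butterfly X Y) (Q : Butterfly Y Z)
    (w : (pullback.lift 0 Q.ι (by simp) ≫ cokernel.π (diag P Q)) ≫
      cokernel.desc (diag P Q) (pullback.fst _ _ ≫ P.σ) (by simp) = 0) :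
    (ShortComplex.mk (pullback.lift 0 Q.ι (by simp) ≫ cokernel.π (diag P Q))
      (cokernel.desc (diag P Q) (pullback.fst _ _ ≫ P.σ) (by simp)) w).ShortExact := by
  have hex : (ShortComplex.mk (diag P Q) (cokernel.π (diag P Q)) (by simp)).Exact :=
    ShortComplex.exact_cokernel _
  refine ShortComplex.ShortExact.mk' ?_ ?_ ?_
  · rw [ShortComplex.exact_iff_exact_up_to_refinements]
    intro W a ha
    dsimp at a ha
    obtain ⟨W', π, hπ, l, hl⟩ := surjective_up_to_refinements_of_epi (cokernel.π (diag P Q)) a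
    have h0 : (l ≫ pullback.fst _ _) ≫ P.σ = 0 := by
      have : π ≫ a ≫ cokernel.desc (diag P Q) (pullback.fst _ _ ≫ P.σ) (by simp) = 0 := by
        rw [ha, comp_zero]
      rw [reassoc_of% hl] at this
      simpa using this
    obtain ⟨W'', π', hπ', b, hb⟩ := P.exact.exact.exact_up_to_refinements _ h0
    dsimp at b hb
    have h1 : (π' ≫ l ≫ pullback.snd _ _ - b ≫ Q.κ) ≫ Q.σ = 0 := by
      have : π' ≫ l ≫ pullback.fst P.ρ Q.σ ≫ P.ρ = b ≫ Y.d := by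
        rw [reassoc_of% hb]; simp
      rw [pullback.condition] at this
      simp [this]
    obtain ⟨W₃, π₃, hπ₃, c, hc⟩ := Q.exact.exact.exact_up_to_refinements _ h1
    dsimp at c hc
    refine ⟨W₃, π₃ ≫ π' ≫ π, inferInstance, c, ?_⟩
    have h2 : π₃ ≫ π' ≫ l = (π₃ ≫ b) ≫ diag P Q + c ≫ pullback.lift 0 Q.ι (by simp) := by
      apply pullback.hom_ext
      · simp [hb]
      · simp [← hc]
    dsimp
    have h3 : π₃ ≫ π' ≫ π ≫ a = (π₃ ≫ π' ≫ l) ≫ cokernel.π (diag P Q) := by simp [hl]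
    simp only [Category.assoc]
    rw [h3, h2]
    simp
  · rw [Preadditive.mono_iff_cancel_zero]
    intro W z hz
    dsimp at z hz
    rw [← Category.assoc] at hz
    obtain ⟨W', π, hπ, b, hb⟩ := hex.exact_up_to_refinements _ hz
    dsimp at b hb
    have h1 : b ≫ P.ι = 0 := by
      have := congr($hb ≫ pullback.fst _ _)
      simpa using this.symm
    have h2 : b = 0 := zero_of_comp_mono _ h1
    have h3 : π ≫ z ≫ Q.ι = 0 := by
      have := congr($hb ≫ pullback.snd _ _)
      simpa [h2] using this
    exact zero_of_comp_mono Q.ι (zero_of_epi_comp π h3)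
  · have : Epi (cokernel.π (diag P Q) ≫
        cokernel.desc (diag P Q) (pullback.fst _ _ ≫ P.σ) (by simp)) := by
      rw [cokernel.π_desc]; infer_instance
    exact epi_of_epi (cokernel.π (diag P Q)) _

/-- Composition of butterflies: the central object is the cokernel of
`(ι, κ') : Y⁻¹ ⟶ E ×_{Y⁰} E'`. -/
def comp (P : Butterfly X Y) (Q : Butterfly Y Z) : Butterfly X Z where
  E := cokernel (diag P Q)
  κ := pullback.lift P.κ 0 (by simp) ≫ cokernel.π (diag P Q)
  ι := pullback.lift 0 Q.ι (by simp) ≫ cokernel.π (diag P Q)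
  σ := cokernel.desc (diag P Q) (pullback.fst _ _ ≫ P.σ) (by simp)
  ρ := cokernel.desc (diag P Q) (pullback.snd _ _ ≫ Q.ρ) (by simp)
  κσ := by simp
  ιρ := by simp
  κρ := by simp
  ισ := by simp
  exact := comp_exact P Q (by simp)

/-- The projection from the fibre product onto the central object of the composite. -/
def compπ (P : Butterfly X Y) (Q : Butterfly Y Z) : fibre P Q ⟶ (comp P Q).E :=
  cokernel.π (diag P Q)

section compπ

variable (P : Butterfly X Y) (Q : Butterfly Y Z)

instance : Epi (compπ P Q) := inferInstanceAs (Epi (cokernel.π (diag P Q)))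

@[simp] lemma diag_compπ : diag P Q ≫ compπ P Q = 0 := cokernel.condition _
@[simp] lemma compπ_σ : compπ P Q ≫ (comp P Q).σ = pullback.fst P.ρ Q.σ ≫ P.σ :=
  cokernel.π_desc _ _ _
@[simp] lemma compπ_ρ : compπ P Q ≫ (comp P Q).ρ = pullback.snd P.ρ Q.σ ≫ Q.ρ :=
  cokernel.π_desc _ _ _

lemma comp_κ : (comp P Q).κ = pullback.lift P.κ 0 (by simp) ≫ compπ P Q := rfl
lemma comp_ι : (comp P Q).ι = pullback.lift 0 Q.ι (by simp) ≫ compπ P Q := rfl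

lemma compπ_exact : (ShortComplex.mk (diag P Q) (compπ P Q) (by simp)).Exact :=
  ShortComplex.exact_cokernel _

end compπ

/-- A criterion for a butterfly to be isomorphic to a composite. -/
lemma comp_isomorphic (P : Butterfly X Y) (Q : Butterfly Y Z) (R : Butterfly X Z)
    (φ : fibre P Q ⟶ R.E) (h0 : diag P Q ≫ φ = 0)
    (hκ : pullback.lift P.κ 0 (by simp) ≫ φ = R.κ)
    (hι : pullback.lift 0 Q.ι (by simp) ≫ φ = R.ι)
    (hσ : φ ≫ R.σ = pullback.fst _ _ ≫ P.σ)
    (hρ : φ ≫ R.ρ = pullback.snd _ _ ≫ Q.ρ) : Isomorphic (comp P Q) R := by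
  obtain ⟨ψ, hψ⟩ : ∃ ψ : (comp P Q).E ⟶ R.E, compπ P Q ≫ ψ = φ :=
    ⟨cokernel.desc _ φ h0, cokernel.π_desc _ _ _⟩
  refine isomorphic_of_hom ψ ?_ ?_ ?_ ?_
  · rw [comp_κ, Category.assoc, hψ, hκ]
  · rw [comp_ι, Category.assoc, hψ, hι]
  · rw [← cancel_epi (compπ P Q), reassoc_of% hψ, hσ, compπ_σ]
  · rw [← cancel_epi (compπ P Q), reassoc_of% hψ, hρ, compπ_ρ]

lemma comp_congr {P P' : Butterfly X Y} {Q Q' : Butterfly Y Z} (h : Isomorphic P P')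
    (h' : Isomorphic Q Q') : Isomorphic (comp P Q) (comp P' Q') := by
  obtain ⟨e, h1, h2, h3, h4⟩ := h
  obtain ⟨e', h1', h2', h3', h4'⟩ := h'
  have w : (pullback.fst P.ρ Q.σ ≫ e.hom) ≫ P'.ρ = (pullback.snd P.ρ Q.σ ≫ e'.hom) ≫ Q'.σ := by
    simp [h4, h3', pullback.condition]
  refine comp_isomorphic _ _ _ (pullback.lift _ _ w ≫ compπ P' Q') ?_ ?_ ?_ ?_ ?_
  · have : diag P Q ≫ pullback.lift _ _ w = diag P' Q' := by
      apply pullback.hom_ext <;> simp [h2, h1']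
    rw [reassoc_of% this, diag_compπ]
  · rw [comp_κ, ← Category.assoc]
    congr 1
    apply pullback.hom_ext <;> simp [h1]
  · rw [comp_ι, ← Category.assoc]
    congr 1
    apply pullback.hom_ext <;> simp [h2']
  · simp [h3]
  · simp [h4']

lemma strict_comp (f : X.neg ⟶ Y.neg) (g : X.zer ⟶ Y.zer) (w : f ≫ Y.d = X.d ≫ g)
    (f' : Y.neg ⟶ Z.neg) (g' : Y.zer ⟶ Z.zer) (w' : f' ≫ Z.d = Y.d ≫ g') :
    Isomorphic (comp (strict f g w) (strict f' g' w'))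
      (strict (f ≫ f') (g ≫ g') (by simp [w', reassoc_of% w])) := by
  have hc := pullback.condition (f := (strict f g w).ρ) (g := (strict f' g' w').σ)
  have w'' : (f ≫ f') ≫ Z.d = X.d ≫ g ≫ g' := by simp [w', reassoc_of% w]
  refine comp_isomorphic _ _ _ ((pullback.fst _ _ ≫ (strict f g w).σ) ≫ strictInl _ _ w'' +
    (pullback.snd _ _ ≫ strictSnd f' g' w' + pullback.fst _ _ ≫ strictSnd f g w ≫ f') ≫
      (strict _ _ w'').ι) ?_ ?_ ?_ ?_ ?_
  · apply strict_hom_ext <;> simp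
  · apply strict_hom_ext <;> simp
  · apply strict_hom_ext <;> simp
  · simp
  · rw [comp_strict_ρ f' g' w' (pullback.snd _ _), ← reassoc_of% hc]
    have h1 := comp_strict_ρ f g w (pullback.fst (strict f g w).ρ (strict f' g' w').σ)
    rw [reassoc_of% h1]
    simp [w']
    abel

lemma id_comp (P : Butterfly X Y) :
    Isomorphic (comp (strict (𝟙 X.neg) (𝟙 X.zer) (by simp)) P) P := by
  have hc := pullback.condition (f := (strict (𝟙 X.neg) (𝟙 X.zer) (by simp)).ρ) (g := P.σ)
  refine comp_isomorphic _ _ _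
    (pullback.snd _ _ - pullback.fst _ _ ≫ strictSnd _ _ _ ≫ P.κ) ?_ ?_ ?_ ?_ ?_
  · simp
  · simp
  · simp
  · rw [Preadditive.sub_comp, ← hc, comp_strict_ρ _ _ _ (pullback.fst _ _)]
    simp
  · simp

lemma comp_id (P : Butterfly X Y) :
    Isomorphic (comp P (strict (𝟙 Y.neg) (𝟙 Y.zer) (by simp))) P := by
  have hc := pullback.condition (f := P.ρ) (g := (strict (𝟙 Y.neg) (𝟙 Y.zer) (by simp)).σ)
  refine comp_isomorphic _ _ _
    (pullback.fst _ _ + pullback.snd _ _ ≫ strictSnd _ _ _ ≫ P.ι) ?_ ?_ ?_ ?_ ?_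
  · simp
  · simp
  · simp
  · simp
  · rw [Preadditive.add_comp, hc, comp_strict_ρ _ _ _ (pullback.snd _ _)]
    simp

lemma assoc (P : Butterfly X Y) (Q : Butterfly Y Z) (R : Butterfly Z U) :
    Isomorphic (comp (comp P Q) R) (comp P (comp Q R)) := by
  -- `W` is the triple fibre product, and `p`, `q` are its projections towards both composites
  have hW := pullback.condition (f := pullback.snd P.ρ Q.σ ≫ Q.ρ) (g := R.σ)
  have hc1 := pullback.condition (f := P.ρ) (g := Q.σ)
  generalize hs : pullback.fst (pullback.snd P.ρ Q.σ ≫ Q.ρ) R.σ = s at hW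
  generalize ht : pullback.snd (pullback.snd P.ρ Q.σ ≫ Q.ρ) R.σ = t at hW
  have hp0 : (s ≫ compπ P Q) ≫ (comp P Q).ρ = t ≫ R.σ := by simpa using hW
  obtain ⟨p, hp1, hp2⟩ : ∃ p : _ ⟶ fibre (comp P Q) R, p ≫ pullback.fst _ _ = s ≫ compπ P Q ∧
      p ≫ pullback.snd _ _ = t := ⟨pullback.lift _ _ hp0, by simp, by simp⟩
  obtain ⟨m, hm1, hm2⟩ : ∃ m : _ ⟶ fibre Q R, m ≫ pullback.fst _ _ = s ≫ pullback.snd _ _ ∧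
      m ≫ pullback.snd _ _ = t := ⟨pullback.lift (s ≫ pullback.snd _ _) t (by simpa using hW),
        by simp, by simp⟩
  obtain ⟨n, hn1, hn2⟩ : ∃ n : _ ⟶ fibre P (comp Q R), n ≫ pullback.fst _ _ =
      s ≫ pullback.fst _ _ ∧ n ≫ pullback.snd _ _ = m ≫ compπ Q R :=
    ⟨pullback.lift (s ≫ pullback.fst _ _) (m ≫ compπ Q R) (by simp [hc1, reassoc_of% hm1]),
      by simp, by simp⟩
  have hWl : ∀ {V : A} (a : V ⟶ fibre P Q) (b : V ⟶ R.E) (_ : a ≫ pullback.snd _ _ ≫ Q.ρ = b ≫ R.σ),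
      ∃ c, c ≫ s = a ∧ c ≫ t = b := fun a b h => ⟨pullback.lift a b h, by simp [← hs],
        by simp [← ht]⟩
  have hp : Epi p := by
    rw [epi_iff_surjective_up_to_refinements]
    intro V a
    obtain ⟨V', π, hπ, l, hl⟩ := surjective_up_to_refinements_of_epi (compπ P Q)
      (a ≫ pullback.fst _ _)
    obtain ⟨c, hcs, hct⟩ := hWl l (π ≫ a ≫ pullback.snd _ _) (by
      have h1 : (l ≫ compπ P Q) ≫ (comp P Q).ρ = π ≫ a ≫ pullback.snd _ _ ≫ R.σ := by
        rw [← hl, ← pullback.condition]; simp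
      simpa using h1)
    refine ⟨V', π, hπ, c, ?_⟩
    apply pullback.hom_ext
    · simp [hp1, reassoc_of% hcs, hl]
    · simp [hp2, hct]
  have hpq : kernel.ι p ≫ n ≫ compπ P (comp Q R) = 0 := by
    have hk : kernel.ι p ≫ p = 0 := kernel.condition p
    have hk1 : (kernel.ι p ≫ s) ≫ compπ P Q = 0 := by
      rw [Category.assoc, ← hp1, reassoc_of% hk, zero_comp]
    have hk2 : kernel.ι p ≫ t = 0 := by
      rw [← hp2, reassoc_of% hk, zero_comp]
    obtain ⟨V, π, hπ, b, hb⟩ := (compπ_exact P Q).exact_up_to_refinements _ hk1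
    dsimp at b hb
    refine zero_of_epi_comp π ?_
    have h1 : π ≫ kernel.ι p ≫ m = b ≫ pullback.lift Q.κ 0 (by simp) := by
      apply pullback.hom_ext
      · simp [hm1, reassoc_of% hb]
      · simp [hm2, hk2]
    have h2 : π ≫ kernel.ι p ≫ n = b ≫ diag P (comp Q R) := by
      apply pullback.hom_ext
      · simp [hn1, reassoc_of% hb]
      · simp [hn2, reassoc_of% h1, comp_κ]
    rw [reassoc_of% h2, diag_compπ, comp_zero]
  obtain ⟨φ, hφ⟩ : ∃ φ : fibre (comp P Q) R ⟶ (comp P (comp Q R)).E,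
      p ≫ φ = n ≫ compπ P (comp Q R) :=
    ⟨Abelian.epiDesc p _ hpq, Abelian.comp_epiDesc _ _ _⟩
  refine comp_isomorphic _ _ _ φ ?_ ?_ ?_ ?_ ?_
  · obtain ⟨c, hcs, hct⟩ := hWl (pullback.lift 0 Q.ι (by simp)) R.κ (by simp)
    have h1 : c ≫ p = diag (comp P Q) R := by
      apply pullback.hom_ext
      · simp [hp1, reassoc_of% hcs, comp_ι]
      · simp [hp2, hct]
    have h2 : c ≫ m = diag Q R := by
      apply pullback.hom_ext
      · simp [hm1, reassoc_of% hcs]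
      · simp [hm2, hct]
    have h3 : c ≫ n = 0 := by
      apply pullback.hom_ext
      · simp [hn1, reassoc_of% hcs]
      · simp [hn2, reassoc_of% h2]
    rw [← h1, Category.assoc, hφ, reassoc_of% h3, zero_comp]
  · obtain ⟨c, hcs, hct⟩ := hWl (pullback.lift P.κ 0 (by simp)) (0 : X.neg ⟶ _) (by simp)
    have h1 : c ≫ p = pullback.lift (comp P Q).κ 0 (by simp) := by
      apply pullback.hom_ext
      · simp [hp1, reassoc_of% hcs, comp_κ]
      · simp [hp2, hct]
    have h2 : c ≫ m = 0 := by
      apply pullback.hom_ext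
      · simp [hm1, reassoc_of% hcs]
      · simp [hm2, hct]
    have h3 : c ≫ n = pullback.lift P.κ 0 (by simp) := by
      apply pullback.hom_ext
      · simp [hn1, reassoc_of% hcs]
      · simp [hn2, reassoc_of% h2]
    rw [← h1, Category.assoc, hφ, reassoc_of% h3]
    rfl
  · obtain ⟨c, hcs, hct⟩ := hWl (0 : U.neg ⟶ _) R.ι (by simp)
    have h1 : c ≫ p = pullback.lift 0 R.ι (by simp) := by
      apply pullback.hom_ext
      · simp [hp1, reassoc_of% hcs]
      · simp [hp2, hct]
    have h2 : c ≫ m = pullback.lift 0 R.ι (by simp) := by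
      apply pullback.hom_ext
      · simp [hm1, reassoc_of% hcs]
      · simp [hm2, hct]
    have h3 : c ≫ n = pullback.lift 0 (comp Q R).ι (by simp) := by
      apply pullback.hom_ext
      · simp [hn1, reassoc_of% hcs]
      · simp [hn2, reassoc_of% h2, comp_ι]
    rw [← h1, Category.assoc, hφ, reassoc_of% h3]
    rfl
  · rw [← cancel_epi p, reassoc_of% hφ, compπ_σ, reassoc_of% hn1, reassoc_of% hp1, compπ_σ]
  · rw [← cancel_epi p, reassoc_of% hφ, compπ_ρ, reassoc_of% hn2, reassoc_of% hp2, compπ_ρ,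
      reassoc_of% hm2]

end

end Butterfly

namespace TwoTerm

variable {A : Type u} [Category.{v} A] [Abelian A]

/-- Two-term complexes with isomorphism classes of butterflies as morphisms. -/
instance : Category.{max u v} (TwoTerm A) where
  Hom X Y := Quotient (Butterfly.setoid X Y)
  id X := Quotient.mk _ (Butterfly.strict (𝟙 X.neg) (𝟙 X.zer) (by simp))
  comp f g := Quotient.map₂ Butterfly.comp (fun _ _ h _ _ h' => Butterfly.comp_congr h h') f g
  id_comp := by
    rintro X Y ⟨P⟩
    exact Quotient.sound (Butterfly.id_comp P)
  comp_id := by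
    rintro X Y ⟨P⟩
    exact Quotient.sound (Butterfly.comp_id P)
  assoc := by
    rintro X Y Z U ⟨P⟩ ⟨Q⟩ ⟨R⟩
    exact Quotient.sound (Butterfly.assoc P Q R)

/-- The morphism of `TwoTerm A` given by a butterfly. -/
def ofButterfly {X Y : TwoTerm A} (P : Butterfly X Y) : X ⟶ Y := Quotient.mk _ P

variable (A) in
/-- The functor from the category of two-term complexes and morphisms of complexes (the arrow
category), sending a morphism of complexes to the corresponding strict morphism. -/
def strictFunctor : Arrow A ⥤ TwoTerm A where
  obj X := ⟨X.left, X.right, X.hom⟩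
  map {X Y} f := ofButterfly (Butterfly.strict (X := ⟨X.left, X.right, X.hom⟩)
    (Y := ⟨Y.left, Y.right, Y.hom⟩) f.left f.right f.w)
  map_id _ := rfl
  map_comp f g := Quotient.sound
    ((Butterfly.setoid _ _).symm (Butterfly.strict_comp _ _ f.w _ _ g.w))

/-- The condition `ker d ∈ F`, `coker d ∈ T` on `[X⁻¹ ⟶ X⁰]`. -/
def tiltProperty (T F : ObjectProperty A) : ObjectProperty (TwoTerm A) :=
  fun X => F (kernel X.d) ∧ T (cokernel X.d)

end TwoTerm

/-- The tilt of the abelian category `A` with respect to `(T, F)`: complexes `[X⁻¹ ⟶ X⁰]` with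
`ker d ∈ F` and `coker d ∈ T`, and isomorphism classes of butterflies. -/
abbrev HRSTilt {A : Type u} [Category.{v} A] [Abelian A] (T F : ObjectProperty A) :=
  (TwoTerm.tiltProperty T F).FullSubcategory

section

open scoped ZeroObject

variable {A : Type u} [Category.{v} A] [Abelian A]

/-- The subcategory `F[1]` of the tilt: objects isomorphic to some `[Y ⟶ 0]` with `Y ∈ F`. -/
def tiltTorsion (T F : ObjectProperty A) : ObjectProperty (HRSTilt T F) :=
  fun X => ∃ Y : A, F Y ∧ Nonempty (X.obj ≅ (⟨Y, 0, 0⟩ : TwoTerm A))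

/-- The subcategory `T` of the tilt: objects isomorphic to some `[0 ⟶ Y]` with `Y ∈ T`. -/
def tiltFree (T F : ObjectProperty A) : ObjectProperty (HRSTilt T F) :=
  fun X => ∃ Y : A, T Y ∧ Nonempty (X.obj ≅ (⟨0, Y, 0⟩ : TwoTerm A))

/-- The tilt of `HRSTilt T F` (endowed with an abelian structure) with respect to the pair
`(F[1], T)`. -/
abbrev IteratedTilt (T F : ObjectProperty A) [Abelian (HRSTilt T F)] :=
  HRSTilt (tiltTorsion T F) (tiltFree T F)

end

/-! ### The strict category of 4-tuples -/

/-- A 4-tuple `[K₁ ⊆ K₂ ⊆ E ⊇ M]` with `K₂ ∩ M ∈ F` and `E / (K₁ + M) ∈ T`. -/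
structure FourTuple {A : Type u} [Category.{v} A] [Abelian A] (T F : ObjectProperty A) where
  E : A
  K₁ : Subobject E
  K₂ : Subobject E
  M : Subobject E
  le : K₁ ≤ K₂
  free : F ((K₂ ⊓ M : Subobject E) : A)
  torsion : T (cokernel (K₁ ⊔ M).arrow)

namespace FourTuple

variable {A : Type u} [Category.{v} A] [Abelian A] {T F : ObjectProperty A}

attribute [local simp] pullback.lift_fst pullback.lift_snd pullback.lift_fst_assoc
  pullback.lift_snd_assoc

/-- A strict morphism: a morphism of the ambient objects respecting the three subobjects. -/
@[ext]
structure Hom (Q R : FourTuple T F) where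
  f : Q.E ⟶ R.E
  K₁ : R.K₁.Factors (Q.K₁.arrow ≫ f)
  K₂ : R.K₂.Factors (Q.K₂.arrow ≫ f)
  M : R.M.Factors (Q.M.arrow ≫ f)

lemma factors_comp {X Y Z : A} {U : Subobject X} {V : Subobject Y} {W : Subobject Z} {f : X ⟶ Y}
    {g : Y ⟶ Z} (hf : V.Factors (U.arrow ≫ f)) (hg : W.Factors (V.arrow ≫ g)) :
    W.Factors (U.arrow ≫ f ≫ g) := by
  have := Subobject.factors_of_factors_right (V.factorThru _ hf) hg
  simpa using this

instance : Category.{v} (FourTuple T F) where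
  Hom := Hom
  id Q := ⟨𝟙 _, by simp [Subobject.factors_self], by simp [Subobject.factors_self],
    by simp [Subobject.factors_self]⟩
  comp a b := ⟨a.f ≫ b.f, factors_comp a.K₁ b.K₁, factors_comp a.K₂ b.K₂, factors_comp a.M b.M⟩
  id_comp _ := by apply Hom.ext; simp
  comp_id _ := by apply Hom.ext; simp
  assoc _ _ _ := by apply Hom.ext; simp

@[ext]
lemma hom_ext {Q R : FourTuple T F} {a b : Q ⟶ R} (h : a.f = b.f) : a = b := Hom.ext h

@[simp] lemma id_f (Q : FourTuple T F) : Hom.f (𝟙 Q) = 𝟙 Q.E := rfl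
@[simp] lemma comp_f {Q R S : FourTuple T F} (a : Q ⟶ R) (b : R ⟶ S) :
    (a ≫ b).f = a.f ≫ b.f := rfl

section Preadditive

variable (Q R : FourTuple T F)

instance : Zero (Q ⟶ R) := ⟨⟨0, by simp [Subobject.factors_zero], by simp [Subobject.factors_zero],
  by simp [Subobject.factors_zero]⟩⟩

instance : Add (Q ⟶ R) := ⟨fun a b => ⟨a.f + b.f,
  by rw [Preadditive.comp_add]; exact Subobject.factors_add _ _ a.K₁ b.K₁,
  by rw [Preadditive.comp_add]; exact Subobject.factors_add _ _ a.K₂ b.K₂,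
  by rw [Preadditive.comp_add]; exact Subobject.factors_add _ _ a.M b.M⟩⟩

lemma factors_neg {X Y : A} {V : Subobject Y} {f : X ⟶ Y} (hf : V.Factors f) : V.Factors (-f) := by
  have := Subobject.factors_of_factors_right (-𝟙 X) hf
  simpa using this

instance : Neg (Q ⟶ R) := ⟨fun a => ⟨-a.f,
  by rw [Preadditive.comp_neg]; exact factors_neg a.K₁,
  by rw [Preadditive.comp_neg]; exact factors_neg a.K₂,
  by rw [Preadditive.comp_neg]; exact factors_neg a.M⟩⟩

variable {Q R}

@[simp] lemma zero_f : Hom.f (0 : Q ⟶ R) = 0 := rfl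
@[simp] lemma add_f (a b : Q ⟶ R) : (a + b).f = a.f + b.f := rfl
@[simp] lemma neg_f (a : Q ⟶ R) : (-a).f = -a.f := rfl

variable (Q R) in
instance : AddCommGroup (Q ⟶ R) where
  add_assoc a b c := by ext; simp [add_assoc]
  zero_add a := by ext; simp
  add_zero a := by ext; simp
  nsmul := nsmulRec
  zsmul := zsmulRec
  neg_add_cancel a := by ext; simp
  add_comm a b := by ext; simp [add_comm]

instance : Preadditive (FourTuple T F) where
  add_comp _ _ _ _ _ _ := by ext; simp
  comp_add _ _ _ _ _ _ := by ext; simp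

end Preadditive

/-- The map induced between subobjects by a morphism respecting them. -/
abbrev subMap {X Y : A} {U : Subobject X} {V : Subobject Y} (f : X ⟶ Y)
    (h : V.Factors (U.arrow ≫ f)) : (U : A) ⟶ (V : A) :=
  V.factorThru (U.arrow ≫ f) h

/-- The map induced between quotients by a morphism respecting subobjects. -/
abbrev quotMap {X Y : A} {U : Subobject X} {V : Subobject Y} (f : X ⟶ Y)
    (h : V.Factors (U.arrow ≫ f)) : cokernel U.arrow ⟶ cokernel V.arrow :=
  cokernel.map _ _ (subMap f h) f (by simp)

/-- The functor `[K₁ ⊆ K₂ ⊆ E ⊇ M] ↦ K₂ / K₁`. -/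
def H (T F : ObjectProperty A) : FourTuple T F ⥤ A where
  obj Q := cokernel (Subobject.ofLE Q.K₁ Q.K₂ Q.le)
  map {Q R} a := cokernel.map _ _ (subMap a.f a.K₁) (subMap a.f a.K₂)
    (by rw [← cancel_mono R.K₂.arrow]; simp)
  map_id Q := by
    apply coequalizer.hom_ext
    have : subMap (Hom.f (𝟙 Q)) (Hom.K₂ (𝟙 Q)) = 𝟙 _ := by
      rw [← cancel_mono Q.K₂.arrow]; simp
    simp [-id_f, this]
  map_comp {Q R S} a b := by
    apply coequalizer.hom_ext
    have : subMap (Hom.f (a ≫ b)) (Hom.K₂ (a ≫ b)) = subMap a.f a.K₂ ≫ subMap b.f b.K₂ := by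
      rw [← cancel_mono S.K₂.arrow]; simp
    simp [-comp_f, this]

/-- The functor `[K₁ ⊆ K₂ ⊆ E ⊇ M] ↦ [K₁ ⟶ E / M]` to two-term complexes in `A`. -/
def srcArrow (T F : ObjectProperty A) : FourTuple T F ⥤ Arrow A where
  obj Q := Arrow.mk (Q.K₁.arrow ≫ cokernel.π Q.M.arrow)
  map {Q R} a := Arrow.homMk (subMap a.f a.K₁) (quotMap a.f a.M) (by simp)
  map_id Q := by
    ext
    · rw [← cancel_mono Q.K₁.arrow]; simp
    · apply coequalizer.hom_ext; simp
  map_comp {Q R S} a b := by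
    ext
    · rw [← cancel_mono S.K₁.arrow]; simp
    · apply coequalizer.hom_ext; simp

/-- The functor `[K₁ ⊆ K₂ ⊆ E ⊇ M] ↦ [M ⟶ E / K₂]` to two-term complexes in `A`. -/
def tgtArrow (T F : ObjectProperty A) : FourTuple T F ⥤ Arrow A where
  obj Q := Arrow.mk (Q.M.arrow ≫ cokernel.π Q.K₂.arrow)
  map {Q R} a := Arrow.homMk (subMap a.f a.M) (quotMap a.f a.K₂) (by simp)
  map_id Q := by
    ext
    · rw [← cancel_mono Q.M.arrow]; simp
    · apply coequalizer.hom_ext; simp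
  map_comp {Q R S} a b := by
    ext
    · rw [← cancel_mono S.M.arrow]; simp
    · apply coequalizer.hom_ext; simp

lemma kernel_mem (h : IsTorsionPair T F) {E : A} {U V U' V' : Subobject E} (hU : U ≤ U')
    (hV : V ≤ V') (hF : F ((U' ⊓ V' : Subobject E) : A)) :
    F (kernel (U.arrow ≫ cokernel.π V.arrow)) := by
  have hfac : (U' ⊓ V').Factors
      (kernel.ι (U.arrow ≫ cokernel.π V.arrow) ≫ U.arrow) := by
    rw [Subobject.inf_factors]
    refine ⟨Subobject.factors_of_le _ hU (Subobject.factors_comp_arrow _),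
      Subobject.factors_of_le _ hV ?_⟩
    have h0 : (kernel.ι (U.arrow ≫ cokernel.π V.arrow) ≫ U.arrow) ≫ cokernel.π V.arrow = 0 := by
      rw [Category.assoc, kernel.condition]
    have := Subobject.factors_comp_arrow (P := V) (Abelian.monoLift V.arrow _ h0)
    rwa [Abelian.monoLift_comp] at this
  have : Mono ((U' ⊓ V').factorThru _ hfac) := by
    have : Mono ((U' ⊓ V').factorThru _ hfac ≫ (U' ⊓ V').arrow) := by
      rw [Subobject.factorThru_arrow]; infer_instance
    exact mono_of_mono _ (U' ⊓ V').arrow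
  exact h.F_of_mono ((U' ⊓ V').factorThru _ hfac) hF

lemma cokernel_mem (h : IsTorsionPair T F) {E : A} {U V U' V' : Subobject E} (hU : U' ≤ U)
    (hV : V' ≤ V) (hT : T (cokernel (U' ⊔ V').arrow)) :
    T (cokernel (U.arrow ≫ cokernel.π V.arrow)) := by
  let g : E ⟶ cokernel (U.arrow ≫ cokernel.π V.arrow) :=
    cokernel.π V.arrow ≫ cokernel.π (U.arrow ≫ cokernel.π V.arrow)
  have h1 : U ≤ kernelSubobject g := le_kernelSubobject _ _ (by
    simp only [g]
    rw [← Category.assoc, cokernel.condition])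
  have h2 : V ≤ kernelSubobject g := le_kernelSubobject _ _ (by simp [g])
  have h3 : (U' ⊔ V').arrow ≫ g = 0 := by
    have h4 : U' ⊔ V' ≤ kernelSubobject g := sup_le (hU.trans h1) (hV.trans h2)
    rw [← Subobject.ofLE_arrow h4, Category.assoc, kernelSubobject_arrow_comp, comp_zero]
  have : Epi (cokernel.desc _ g h3) := by
    have : Epi (cokernel.π (U' ⊔ V').arrow ≫ cokernel.desc _ g h3) := by
      rw [cokernel.π_desc]; infer_instance
    exact epi_of_epi (cokernel.π (U' ⊔ V').arrow) _
  exact h.T_of_epi (cokernel.desc _ g h3) hT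

/-- `[K₁ ⊆ K₂ ⊆ E ⊇ M] ↦ [K₁ ⟶ E / M]` as a functor to the tilt. -/
def src (h : IsTorsionPair T F) : FourTuple T F ⥤ HRSTilt T F :=
  (TwoTerm.tiltProperty T F).lift (srcArrow T F ⋙ TwoTerm.strictFunctor A)
    (fun Q => ⟨kernel_mem h Q.le le_rfl Q.free, cokernel_mem h le_rfl le_rfl Q.torsion⟩)

/-- `[K₁ ⊆ K₂ ⊆ E ⊇ M] ↦ [M ⟶ E / K₂]` as a functor to the tilt. -/
def tgt (h : IsTorsionPair T F) : FourTuple T F ⥤ HRSTilt T F :=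
  (TwoTerm.tiltProperty T F).lift (tgtArrow T F ⋙ TwoTerm.strictFunctor A)
    (fun Q => ⟨kernel_mem h (U' := Q.M) (V' := Q.K₂) le_rfl le_rfl (by rw [inf_comm]; exact Q.free),
      cokernel_mem h (U' := Q.M) (V' := Q.K₁) le_rfl Q.le (by
        have := Q.torsion
        rwa [sup_comm] at this)⟩)

/-- The butterfly from `[K₁ ⟶ E / M]` to `[M ⟶ E / K₂]` with central object `E`. -/
def butterfly (Q : FourTuple T F) :
    Butterfly (⟨_, _, Q.K₁.arrow ≫ cokernel.π Q.M.arrow⟩ : TwoTerm A)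
      ⟨_, _, Q.M.arrow ≫ cokernel.π Q.K₂.arrow⟩ where
  E := Q.E
  κ := Q.K₁.arrow
  ι := Q.M.arrow
  σ := cokernel.π Q.M.arrow
  ρ := cokernel.π Q.K₂.arrow
  κσ := rfl
  ιρ := rfl
  κρ := by
    have h : Q.K₁.arrow ≫ cokernel.π Q.K₂.arrow = 0 := by
      rw [← Subobject.ofLE_arrow Q.le, Category.assoc, cokernel.condition Q.K₂.arrow, comp_zero]
    exact h
  ισ := by simp
  exact := ShortComplex.ShortExact.mk' (ShortComplex.exact_cokernel _)
    (by dsimp; infer_instance) (by dsimp; infer_instance)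

/-- The morphism of the tilt given by a 4-tuple. -/
def toTiltHom (h : IsTorsionPair T F) (Q : FourTuple T F) : (src h).obj Q ⟶ (tgt h).obj Q :=
  ObjectProperty.homMk (TwoTerm.ofButterfly Q.butterfly)

/-- The ambient object is the central object of the butterfly. -/
def toE (Q : FourTuple T F) : Q.butterfly.E ⟶ Q.E := 𝟙 Q.E

/-- The ambient object is the central object of the butterfly. -/
def fromE (Q : FourTuple T F) : Q.E ⟶ Q.butterfly.E := 𝟙 Q.E

section

variable (Q : FourTuple T F)

lemma butterfly_κ : Q.butterfly.κ = Q.K₁.arrow ≫ Q.fromE := (Category.comp_id _).symm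
lemma butterfly_ι : Q.butterfly.ι = Q.M.arrow ≫ Q.fromE := (Category.comp_id _).symm
lemma butterfly_σ : Q.butterfly.σ = Q.toE ≫ cokernel.π Q.M.arrow := (Category.id_comp _).symm
lemma butterfly_ρ : Q.butterfly.ρ = Q.toE ≫ cokernel.π Q.K₂.arrow := (Category.id_comp _).symm
@[simp] lemma fromE_toE : Q.fromE ≫ Q.toE = 𝟙 _ := Category.id_comp _
@[simp] lemma fromE_toE_assoc {V : A} (h : Q.E ⟶ V) : Q.fromE ≫ Q.toE ≫ h = h := by
  rw [← Category.assoc, fromE_toE, Category.id_comp]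

end

lemma butterfly_naturality {Q R : FourTuple T F} (a : Q ⟶ R)
    (w : subMap a.f a.K₁ ≫ R.K₁.arrow ≫ cokernel.π R.M.arrow =
      (Q.K₁.arrow ≫ cokernel.π Q.M.arrow) ≫ quotMap a.f a.M)
    (w' : subMap a.f a.M ≫ R.M.arrow ≫ cokernel.π R.K₂.arrow =
      (Q.M.arrow ≫ cokernel.π Q.K₂.arrow) ≫ quotMap a.f a.K₂) :
    Butterfly.Isomorphic
      (Butterfly.comp Q.butterfly (Butterfly.strict (subMap a.f a.M) (quotMap a.f a.K₂) w'))
      (Butterfly.comp (Butterfly.strict (subMap a.f a.K₁) (quotMap a.f a.M) w) R.butterfly) := by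
  have hκQ : Q.butterfly.κ ≫ Q.toE = Q.K₁.arrow := by simp [butterfly_κ]
  have hιQ : Q.butterfly.ι ≫ Q.toE = Q.M.arrow := by simp [butterfly_ι]
  have hσR : R.fromE ≫ R.butterfly.σ = cokernel.π R.M.arrow := by simp [butterfly_σ]
  have hρR : R.fromE ≫ R.butterfly.ρ = cokernel.π R.K₂.arrow := by simp [butterfly_ρ]
  -- the two strict morphisms, and the projections of the two fibre products
  let S := Butterfly.strict (X := (⟨_, _, Q.K₁.arrow ≫ cokernel.π Q.M.arrow⟩ : TwoTerm A))
    (Y := (⟨_, _, R.K₁.arrow ≫ cokernel.π R.M.arrow⟩ : TwoTerm A))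
    (subMap a.f a.K₁) (quotMap a.f a.M) w
  let S' := Butterfly.strict (X := (⟨_, _, Q.M.arrow ≫ cokernel.π Q.K₂.arrow⟩ : TwoTerm A))
    (Y := (⟨_, _, R.M.arrow ≫ cokernel.π R.K₂.arrow⟩ : TwoTerm A))
    (subMap a.f a.M) (quotMap a.f a.K₂) w'
  let r : S'.E ⟶ (R.M : A) := Butterfly.strictSnd _ _ w'
  let i : cokernel Q.M.arrow ⟶ S.E := Butterfly.strictInl
    (X := (⟨_, _, Q.K₁.arrow ≫ cokernel.π Q.M.arrow⟩ : TwoTerm A))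
    (Y := (⟨_, _, R.K₁.arrow ≫ cokernel.π R.M.arrow⟩ : TwoTerm A))
    (subMap a.f a.K₁) (quotMap a.f a.M) w
  have hc : pullback.fst Q.butterfly.ρ S'.σ ≫ Q.butterfly.ρ =
    pullback.snd Q.butterfly.ρ S'.σ ≫ S'.σ := pullback.condition
  have hr1 : S'.κ ≫ r = -subMap a.f a.M := Butterfly.strict_κ_snd _ _ w'
  have hr2 : S'.ι ≫ r = 𝟙 _ := Butterfly.strict_ι_snd _ _ w'
  have hi1 : i ≫ S.ρ = quotMap a.f a.M := Butterfly.strictInl_ρ _ _ w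
  have hi2 : i ≫ S.σ = 𝟙 _ := Butterfly.strictInl_σ _ _ w
  have hκS : S.κ = (Q.K₁.arrow ≫ cokernel.π Q.M.arrow) ≫ i - subMap a.f a.K₁ ≫ S.ι :=
    Butterfly.strict_κ _ _ w
  have hρQ : Q.butterfly.ρ ≫ quotMap a.f a.K₂ = Q.toE ≫ a.f ≫ cokernel.π R.K₂.arrow := by
    simp [butterfly_ρ]
  have hρS' : pullback.snd Q.butterfly.ρ S'.σ ≫ S'.ρ = pullback.fst Q.butterfly.ρ S'.σ ≫
      Q.butterfly.ρ ≫ quotMap a.f a.K₂ + pullback.snd Q.butterfly.ρ S'.σ ≫ r ≫ R.M.arrow ≫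
        cokernel.π R.K₂.arrow := by
    rw [reassoc_of% hc]
    exact Butterfly.comp_strict_ρ _ _ w' _
  obtain ⟨ψ, hψ1, hψ2⟩ : ∃ ψ : Butterfly.fibre Q.butterfly S' ⟶ Butterfly.fibre S R.butterfly,
      ψ ≫ pullback.fst _ _ = pullback.fst _ _ ≫ Q.butterfly.σ ≫ i ∧
      ψ ≫ pullback.snd _ _ = (pullback.fst _ _ ≫ Q.toE ≫ a.f + pullback.snd _ _ ≫ r ≫ R.M.arrow) ≫
        R.fromE := by
    refine ⟨pullback.lift _ _ ?_, pullback.lift_fst _ _ _, pullback.lift_snd _ _ _⟩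
    simp only [Category.assoc, hi1, butterfly_σ]
    simp
  change Butterfly.Isomorphic (Butterfly.comp Q.butterfly S') (Butterfly.comp S R.butterfly)
  refine Butterfly.comp_isomorphic _ _ _ (ψ ≫ Butterfly.compπ S R.butterfly) ?_ ?_ ?_ ?_ ?_
  · have : Butterfly.diag Q.butterfly S' ≫ ψ = 0 := by
      apply pullback.hom_ext
      · simp [hψ1]
      · rw [Category.assoc, hψ2, ← Category.assoc, Preadditive.comp_add,
          Butterfly.diag_fst_assoc, Butterfly.diag_snd_assoc, reassoc_of% hιQ, reassoc_of% hr1]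
        simp
    rw [reassoc_of% this, zero_comp]
  · have : pullback.lift Q.butterfly.κ 0 (by simp) ≫ ψ =
        pullback.lift S.κ 0 (by simp) + subMap a.f a.K₁ ≫ Butterfly.diag S R.butterfly := by
      apply pullback.hom_ext
      · rw [Category.assoc, hψ1, Preadditive.add_comp, Category.assoc, Butterfly.diag_fst,
          pullback.lift_fst, pullback.lift_fst_assoc, hκS, Butterfly.κσ_assoc]
        simp
      · rw [Category.assoc, hψ2, ← Category.assoc, Preadditive.comp_add, Preadditive.add_comp,
          pullback.lift_fst_assoc, pullback.lift_snd_assoc, reassoc_of% hκQ, Preadditive.add_comp,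
          pullback.lift_snd, Category.assoc (subMap a.f a.K₁), Butterfly.diag_snd, butterfly_κ]
        simp
    rw [reassoc_of% this, Preadditive.add_comp, Category.assoc, Butterfly.diag_compπ, comp_zero,
      add_zero]
    rfl
  · have : pullback.lift 0 S'.ι (by simp) ≫ ψ = pullback.lift 0 R.butterfly.ι (by simp) := by
      apply pullback.hom_ext
      · rw [Category.assoc, hψ1, pullback.lift_fst_assoc, pullback.lift_fst, zero_comp]
      · rw [Category.assoc, hψ2, ← Category.assoc, Preadditive.comp_add,
          pullback.lift_fst_assoc, pullback.lift_snd_assoc, pullback.lift_snd, reassoc_of% hr2,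
          butterfly_ι]
        simp
    rw [reassoc_of% this]
    rfl
  · rw [Category.assoc, Butterfly.compπ_σ, reassoc_of% hψ1, hi2, Category.comp_id]
  · rw [Category.assoc, Butterfly.compπ_ρ, reassoc_of% hψ2, hρR, hρS', hρQ]
    simp

lemma toTiltHom_naturality (h : IsTorsionPair T F) {Q R : FourTuple T F} (a : Q ⟶ R) :
    (src h).map a ≫ toTiltHom h R = toTiltHom h Q ≫ (tgt h).map a := by
  apply ObjectProperty.hom_ext
  exact Quotient.sound ((Butterfly.setoid _ _).symm (butterfly_naturality a _ _))

/-- A 4-tuple as a two-term complex `[K₁ ⟶ E / M] ⟶ [M ⟶ E / K₂]` in the tilt; morphisms of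
4-tuples go to morphisms of complexes that are strict in each degree. -/
def toArrow (h : IsTorsionPair T F) : FourTuple T F ⥤ Arrow (HRSTilt T F) where
  obj Q := Arrow.mk (toTiltHom h Q)
  map a := Arrow.homMk ((src h).map a) ((tgt h).map a) (toTiltHom_naturality h a)
  map_id Q := by ext <;> simp
  map_comp a b := by ext <;> simp

/-- Quasi-isomorphisms of two-term complexes in an abelian category: morphisms inducing
isomorphisms on the kernels and on the cokernels of the differentials. -/
def arrowQuasiIso (B : Type u) [Category.{v} B] [Abelian B] : MorphismProperty (Arrow B) :=
  fun X Y f => IsIso (kernel.map X.hom Y.hom f.left f.right f.w.symm) ∧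
    IsIso (cokernel.map X.hom Y.hom f.left f.right f.w.symm)

/-- The class of strict morphisms of 4-tuples that are quasi-isomorphisms of complexes in the
tilt. -/
def quasiIso (h : IsTorsionPair T F) [Abelian (HRSTilt T F)] : MorphismProperty (FourTuple T F) :=
  (arrowQuasiIso (HRSTilt T F)).inverseImage (toArrow h)

/-- The inclusion of the strict category into the iterated tilt, once the two-term complexes in the
tilt defined by 4-tuples are known to be objects of the iterated tilt. -/
def inclusion (h : IsTorsionPair T F) [Abelian (HRSTilt T F)]
    (hC : ∀ Q, TwoTerm.tiltProperty (tiltTorsion T F) (tiltFree T F)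
      ((toArrow h ⋙ TwoTerm.strictFunctor (HRSTilt T F)).obj Q)) :
    FourTuple T F ⥤ IteratedTilt T F :=
  (TwoTerm.tiltProperty (tiltTorsion T F) (tiltFree T F)).lift
    (toArrow h ⋙ TwoTerm.strictFunctor (HRSTilt T F)) hC

end FourTuple

end

/-! Butterflies are fractions of strict morphisms. For a butterfly with central object `E`, the
complex `[X⁻¹ ⊕ Y⁻¹ ⟶ E]` maps to `X` by a quasi-isomorphism and to `Y` by a strict morphism. Hence
every morphism of two-term complexes becomes strict after replacing its source, or dually its
target, by a quasi-isomorphic complex. Strict morphisms agree exactly when they are homotopic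
(`ofStrict_eq_iff`), and a square with strict vertical sides commutes exactly when it comes from a
map of central objects (`square_iff`). These facts reduce questions about the tilt `B` to diagram
chases in `A`.

Why `B` is abelian: inside `ker ρ` let `S` be the preimage of the torsion part of `ker ρ / im κ`
(`Butterfly.Cut`). Then `[X⁻¹ ⟶ S]` is a kernel and `[E / S ⟶ Y⁰]` a cokernel. The vanishing needed
for liftings and for uniqueness has one source: the obstruction factors through an object of `T`
followed by an object of `F` (`eq_zero_of_cokernel_of_kernel`). If the kernel vanishes then `S =
X⁻¹`, and a pullback of `E ⟶ E / S` produces the butterflies that show the morphism to be a kernel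
of its cokernel; dually for epimorphisms with a pushout.

Why 4-tuples suffice: a butterfly `X ⟶ Y` is an object of the iterated tilt exactly when `κ` is mono
and `ρ` is epi (`tiltProperty_iff`). Up to isomorphism it is then given by the subobjects `K₁ = im
κ`, `K₂ = ker ρ` and `M = im ι` of `E` (`exists_model`). Its kernel and cokernel in `B` are `[0 ⟶ S
/ K₁]` and `[K₂ / S ⟶ 0]`, and `S / K₁`, `K₂ / S` are the torsion and the torsion-free part of `K₂ /
K₁`. A map of such extensions is invertible if and only if it is so on both parts, whence
`quasiIso_iff`.

Why the localization is the iterated tilt: a map `φ : H X ⟶ H Y` has a graph in `X ⊕ Y`, a 4-tuple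
whose projection to `X` is inverted by `H` (`hasGraphs`). So a morphism of the localization is
determined by its image under `H`, and the comparison functor is faithful once equal images in the
iterated tilt force equal images under `H` (`map_eq_of_inclusion_map_eq`). It is full because
morphisms between 4-tuples can be made strict, first as complexes in `B` and then in each degree
(`inclusion_exists_fraction`). -/

noncomputable section

/-! ### Commutative squares, triangles and homotopies of butterflies -/

namespace TwoTerm

variable {A : Type u} [Category.{v} A] [Abelian A]

attribute [local simp] pullback.lift_fst pullback.lift_snd pullback.lift_fst_assoc
  pullback.lift_snd_assoc

/-- The strict morphism given by a morphism of complexes. -/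
abbrev ofStrict {X Y : TwoTerm A} (f : X.neg ⟶ Y.neg) (g : X.zer ⟶ Y.zer)
    (w : f ≫ Y.d = X.d ≫ g) : X ⟶ Y :=
  ofButterfly (Butterfly.strict f g w)

lemma ofButterfly_eq_iff {X Y : TwoTerm A} (P Q : Butterfly X Y) :
    ofButterfly P = ofButterfly Q ↔ Butterfly.Isomorphic P Q :=
  ⟨fun h => Quotient.exact h, fun h => Quotient.sound h⟩

lemma ofButterfly_surjective {X Y : TwoTerm A} (f : X ⟶ Y) :
    ∃ P : Butterfly X Y, f = ofButterfly P := by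
  obtain ⟨P, hP⟩ := Quotient.exists_rep f
  exact ⟨P, hP.symm⟩

lemma ofButterfly_comp {X Y Z : TwoTerm A} (P : Butterfly X Y) (Q : Butterfly Y Z) :
    ofButterfly P ≫ ofButterfly Q = ofButterfly (P.comp Q) := rfl

lemma ofStrict_comp {X Y Z : TwoTerm A} (f : X.neg ⟶ Y.neg) (g : X.zer ⟶ Y.zer)
    (w : f ≫ Y.d = X.d ≫ g) (f' : Y.neg ⟶ Z.neg) (g' : Y.zer ⟶ Z.zer) (w' : f' ≫ Z.d = Y.d ≫ g') :
    ofStrict f g w ≫ ofStrict f' g' w' =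
      ofStrict (f ≫ f') (g ≫ g') (by simp [w', reassoc_of% w]) :=
  Quotient.sound (Butterfly.strict_comp f g w f' g' w')

lemma ofStrict_congr {X Y : TwoTerm A} {f f' : X.neg ⟶ Y.neg} {g g' : X.zer ⟶ Y.zer}
    (hf : f = f') (hg : g = g') (w : f ≫ Y.d = X.d ≫ g) :
    ofStrict f g w = ofStrict f' g' (by rw [← hf, ← hg, w]) := by
  subst hf hg; rfl

section square

variable {X Y X' Y' : TwoTerm A} (P : Butterfly X Y) (P' : Butterfly X' Y')
  (a : X.neg ⟶ X'.neg) (a' : X.zer ⟶ X'.zer) (wa : a ≫ X'.d = X.d ≫ a')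
  (b : Y.neg ⟶ Y'.neg) (b' : Y.zer ⟶ Y'.zer) (wb : b ≫ Y'.d = Y.d ≫ b')

/-- The comparison of fibre products sends `(e, (y⁰, y'⁻¹))` to `((σ e, 0), φ e + ι' y'⁻¹)`. It
respects `κ` only up to the antidiagonal `a ≫ diag`, which dies in the composite. -/
lemma comp_isomorphic_of_map (φ : P.E ⟶ P'.E) (h1 : P.κ ≫ φ = a ≫ P'.κ) (h2 : P.ι ≫ φ = b ≫ P'.ι)
    (h3 : φ ≫ P'.σ = P.σ ≫ a') (h4 : φ ≫ P'.ρ = P.ρ ≫ b') :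
    Butterfly.Isomorphic (P.comp (Butterfly.strict b b' wb))
      ((Butterfly.strict a a' wa).comp P') := by
  let S := Butterfly.strict a a' wa
  let S' := Butterfly.strict b b' wb
  let r : S'.E ⟶ Y'.neg := Butterfly.strictSnd _ _ wb
  let i : X.zer ⟶ S.E := Butterfly.strictInl a a' wa
  have hc : pullback.fst P.ρ S'.σ ≫ P.ρ = pullback.snd P.ρ S'.σ ≫ S'.σ := pullback.condition
  have hr1 : S'.κ ≫ r = -b := Butterfly.strict_κ_snd _ _ wb
  have hr2 : S'.ι ≫ r = 𝟙 _ := Butterfly.strict_ι_snd _ _ wb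
  have hi1 : i ≫ S.ρ = a' := Butterfly.strictInl_ρ _ _ wa
  have hi2 : i ≫ S.σ = 𝟙 _ := Butterfly.strictInl_σ _ _ wa
  have hκS : S.κ = X.d ≫ i - a ≫ S.ι := Butterfly.strict_κ _ _ wa
  have hρS' : pullback.snd P.ρ S'.σ ≫ S'.ρ = pullback.fst P.ρ S'.σ ≫
      P.ρ ≫ b' + pullback.snd P.ρ S'.σ ≫ r ≫ Y'.d := by
    rw [reassoc_of% hc]
    exact Butterfly.comp_strict_ρ _ _ wb _
  obtain ⟨ψ, hψ1, hψ2⟩ : ∃ ψ : Butterfly.fibre P S' ⟶ Butterfly.fibre S P',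
      ψ ≫ pullback.fst _ _ = pullback.fst _ _ ≫ P.σ ≫ i ∧
      ψ ≫ pullback.snd _ _ = pullback.fst _ _ ≫ φ + pullback.snd _ _ ≫ r ≫ P'.ι := by
    refine ⟨pullback.lift _ _ ?_, pullback.lift_fst _ _ _, pullback.lift_snd _ _ _⟩
    simp [hi1, h3]
  change Butterfly.Isomorphic (Butterfly.comp P S') (Butterfly.comp S P')
  refine Butterfly.comp_isomorphic _ _ _ (ψ ≫ Butterfly.compπ S P') ?_ ?_ ?_ ?_ ?_
  · have : Butterfly.diag P S' ≫ ψ = 0 := by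
      apply pullback.hom_ext
      · simp [hψ1]
      · simp [hψ2, h2, reassoc_of% hr1]
    rw [reassoc_of% this, zero_comp]
  · have : pullback.lift P.κ 0 (by simp) ≫ ψ =
        pullback.lift S.κ 0 (by simp) + a ≫ Butterfly.diag S P' := by
      apply pullback.hom_ext
      · simp [hψ1, hκS]
      · simp [hψ2, h1]
    rw [reassoc_of% this, Preadditive.add_comp, Category.assoc, Butterfly.diag_compπ, comp_zero,
      add_zero]
    rfl
  · have : pullback.lift 0 S'.ι (by simp) ≫ ψ = pullback.lift 0 P'.ι (by simp) := by
      apply pullback.hom_ext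
      · simp [hψ1]
      · simp [hψ2, reassoc_of% hr2]
    rw [reassoc_of% this]
    rfl
  · rw [Category.assoc, Butterfly.compπ_σ, reassoc_of% hψ1, hi2, Category.comp_id]
  · rw [Category.assoc, Butterfly.compπ_ρ, reassoc_of% hψ2, hρS']
    simp [h4]

/-- The canonical map `E → E''` from the central object of `P'` to that of `a ≫ P'` has a partial
inverse, `(x, e) ↦ e - κ (x⁻¹)`. -/
lemma exists_desc_strict_comp : ∃ θ : ((Butterfly.strict a a' wa).comp P').E ⟶ P'.E,
    Butterfly.compπ (Butterfly.strict a a' wa) P' ≫ θ =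
      pullback.snd _ _ - pullback.fst _ _ ≫ Butterfly.strictSnd a a' wa ≫ P'.κ := by
  refine ⟨cokernel.desc (Butterfly.diag _ _) _ ?_, cokernel.π_desc _ _ _⟩
  simp

/-- A square with strict vertical morphisms commutes if and only if there is a compatible morphism
of the central objects. -/
theorem square_iff : ofButterfly P ≫ ofStrict b b' wb = ofStrict a a' wa ≫ ofButterfly P' ↔
    ∃ φ : P.E ⟶ P'.E, P.κ ≫ φ = a ≫ P'.κ ∧ P.ι ≫ φ = b ≫ P'.ι ∧ φ ≫ P'.σ = P.σ ≫ a' ∧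
      φ ≫ P'.ρ = P.ρ ≫ b' := by
  constructor
  · intro h
    obtain ⟨e, h1, h2, h3, h4⟩ := (ofButterfly_eq_iff _ _).1 h
    obtain ⟨θ, hθ⟩ := exists_desc_strict_comp P' a a' wa
    let S := Butterfly.strict a a' wa
    let S' := Butterfly.strict b b' wb
    let i : Y.zer ⟶ S'.E := Butterfly.strictInl b b' wb
    have hi : i ≫ S'.σ = 𝟙 _ := Butterfly.strictInl_σ _ _ _
    have hiρ : i ≫ S'.ρ = b' := Butterfly.strictInl_ρ _ _ _
    have hκS' : S'.κ = Y.d ≫ i - b ≫ S'.ι := Butterfly.strict_κ _ _ wb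
    have hκθ : (S.comp P').κ ≫ θ = a ≫ P'.κ := by
      rw [Butterfly.comp_κ, Category.assoc, hθ]
      simp [S]
    have hιθ : (S.comp P').ι ≫ θ = P'.ι := by
      rw [Butterfly.comp_ι, Category.assoc, hθ]
      simp [S]
    have hσθ : θ ≫ P'.σ = (S.comp P').σ ≫ a' := by
      rw [← cancel_epi (Butterfly.compπ S P'), reassoc_of% hθ, Preadditive.sub_comp]
      have hc := pullback.condition (f := S.ρ) (g := P'.σ)
      have hS := Butterfly.comp_strict_ρ a a' wa (pullback.fst S.ρ P'.σ)
      rw [← Category.assoc (Butterfly.compπ S P'), Butterfly.compπ_σ, ← hc, hS]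
      simp [S]
    have hρθ : θ ≫ P'.ρ = (S.comp P').ρ := by
      rw [← cancel_epi (Butterfly.compπ S P'), reassoc_of% hθ, Preadditive.sub_comp]
      simp [S]
    -- The section `e ↦ (e, (ρ e, 0))` of the first projection. The required `φ` is the composite of
    -- `j`, the given isomorphism of composites and the retraction `θ`.
    let j : P.E ⟶ Butterfly.fibre P S' := pullback.lift (𝟙 _) (P.ρ ≫ i) (by simp [hi])
    have hj1 : j ≫ pullback.fst _ _ = 𝟙 _ := pullback.lift_fst _ _ _
    have hj2 : j ≫ pullback.snd _ _ = P.ρ ≫ i := pullback.lift_snd _ _ _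
    have hjκ : P.κ ≫ j = pullback.lift P.κ 0 (by simp) := by
      apply pullback.hom_ext <;> simp [hj1, hj2]
    have hjι : P.ι ≫ j = Butterfly.diag P S' + b ≫ pullback.lift 0 S'.ι (by simp) := by
      apply pullback.hom_ext <;> simp [hj1, hj2, hκS']
    refine ⟨j ≫ Butterfly.compπ P S' ≫ e.hom ≫ θ, ?_, ?_, ?_, ?_⟩
    · rw [reassoc_of% hjκ, ← Category.assoc, ← Butterfly.comp_κ, reassoc_of% h1, hκθ]
    · rw [reassoc_of% hjι, Preadditive.add_comp, ← Category.assoc, Butterfly.diag_compπ, zero_comp,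
        zero_add, Category.assoc, ← Category.assoc (pullback.lift _ _ _), ← Butterfly.comp_ι,
        reassoc_of% h2, hιθ]
    · simp only [Category.assoc, hσθ]
      rw [reassoc_of% h3, ← Category.assoc (Butterfly.compπ _ _), Butterfly.compπ_σ,
        Category.assoc, reassoc_of% hj1]
    · simp only [Category.assoc, hρθ]
      rw [h4, Butterfly.compπ_ρ, reassoc_of% hj2, hiρ]
  · rintro ⟨φ, h1, h2, h3, h4⟩
    exact Quotient.sound (comp_isomorphic_of_map P P' a a' wa b b' wb φ h1 h2 h3 h4)

end square

section triangle

variable {X Y Z : TwoTerm A}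

/-- This is `square_iff` with the identity butterfly of `X` on one side. Its central object is `X⁰ ⊕
X⁻¹`, and the compatibility with `ι` fixes a map out of it on `X⁻¹`; only the component on `X⁰`
remains free. -/
theorem strict_comp_eq_iff (P : Butterfly Y Z) (a : X.neg ⟶ Y.neg) (a' : X.zer ⟶ Y.zer)
    (wa : a ≫ Y.d = X.d ≫ a') (b : X.neg ⟶ Z.neg) (b' : X.zer ⟶ Z.zer) (wb : b ≫ Z.d = X.d ≫ b') :
    ofStrict a a' wa ≫ ofButterfly P = ofStrict b b' wb ↔
      ∃ φ : X.zer ⟶ P.E, X.d ≫ φ = a ≫ P.κ + b ≫ P.ι ∧ φ ≫ P.σ = a' ∧ φ ≫ P.ρ = b' := by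
  let I := Butterfly.strict (𝟙 X.neg) (𝟙 X.zer) (by simp)
  let r : I.E ⟶ X.neg := Butterfly.strictSnd (𝟙 X.neg) (𝟙 X.zer) (by simp)
  let i : X.zer ⟶ I.E := Butterfly.strictInl (𝟙 X.neg) (𝟙 X.zer) (by simp)
  have hiσ : i ≫ I.σ = 𝟙 _ := Butterfly.strictInl_σ _ _ _
  have hiρ : i ≫ I.ρ = 𝟙 _ := Butterfly.strictInl_ρ _ _ _
  have hκ : I.κ = X.d ≫ i - I.ι := by
    simpa using Butterfly.strict_κ (𝟙 X.neg) (𝟙 X.zer) (by simp)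
  have hκr : I.κ ≫ r = -𝟙 _ := Butterfly.strict_κ_snd _ _ _
  have hιr : I.ι ≫ r = 𝟙 _ := Butterfly.strict_ι_snd _ _ _
  have hρ : I.ρ = I.σ + r ≫ X.d := by
    simpa using Butterfly.comp_strict_ρ (𝟙 X.neg) (𝟙 X.zer) (by simp) (𝟙 I.E)
  have h := square_iff I P a a' wa b b' wb
  rw [show ofButterfly I = 𝟙 X from rfl, Category.id_comp, eq_comm] at h
  rw [h]
  constructor
  · rintro ⟨φ, h1, h2, h3, h4⟩
    refine ⟨i ≫ φ, ?_, ?_, ?_⟩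
    · rw [show X.d ≫ i ≫ φ = (I.κ + I.ι) ≫ φ by rw [hκ]; simp, Preadditive.add_comp, h1, h2]
    · rw [Category.assoc, h3, reassoc_of% hiσ]
    · rw [Category.assoc, h4, reassoc_of% hiρ]
  · rintro ⟨φ, h1, h2, h3⟩
    refine ⟨I.σ ≫ φ + r ≫ b ≫ P.ι, ?_, ?_, ?_, ?_⟩
    · simp [h1, reassoc_of% hκr]
    · simp [reassoc_of% hιr]
    · simp [h2]
    · simp [h3, hρ, wb]

/-- Dual use of `square_iff`, with the identity butterfly of `Z`: the component in `Z⁰` is forced,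
and `ψ` is the component in `Z⁻¹`. The sign in `-a` comes from the sign in the `κ` of a strict
butterfly. -/
theorem comp_strict_eq_iff (P : Butterfly X Y) (b : Y.neg ⟶ Z.neg) (b' : Y.zer ⟶ Z.zer)
    (wb : b ≫ Z.d = Y.d ≫ b') (a : X.neg ⟶ Z.neg) (a' : X.zer ⟶ Z.zer) (wa : a ≫ Z.d = X.d ≫ a') :
    ofButterfly P ≫ ofStrict b b' wb = ofStrict a a' wa ↔
      ∃ ψ : P.E ⟶ Z.neg, P.ι ≫ ψ = b ∧ P.κ ≫ ψ = -a ∧ P.ρ ≫ b' = P.σ ≫ a' + ψ ≫ Z.d := by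
  let I := Butterfly.strict (𝟙 Z.neg) (𝟙 Z.zer) (by simp)
  let r : I.E ⟶ Z.neg := Butterfly.strictSnd (𝟙 Z.neg) (𝟙 Z.zer) (by simp)
  let i : Z.zer ⟶ I.E := Butterfly.strictInl (𝟙 Z.neg) (𝟙 Z.zer) (by simp)
  have hiσ : i ≫ I.σ = 𝟙 _ := Butterfly.strictInl_σ _ _ _
  have hir : i ≫ r = 0 := Butterfly.strictInl_snd _ _ _
  have hiρ : i ≫ I.ρ = 𝟙 _ := Butterfly.strictInl_ρ _ _ _
  have hκr : I.κ ≫ r = -𝟙 _ := Butterfly.strict_κ_snd _ _ _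
  have hιr : I.ι ≫ r = 𝟙 _ := Butterfly.strict_ι_snd _ _ _
  have hρ : I.ρ = I.σ + r ≫ Z.d := by
    simpa using Butterfly.comp_strict_ρ (𝟙 Z.neg) (𝟙 Z.zer) (by simp) (𝟙 I.E)
  have hext : ∀ {V : A} {x y : V ⟶ I.E}, x ≫ I.σ = y ≫ I.σ → x ≫ r = y ≫ r → x = y :=
    fun h1 h2 => Butterfly.strict_hom_ext _ _ _ h1 h2
  have h := square_iff P I a a' wa b b' wb
  rw [show ofButterfly I = 𝟙 Z from rfl, Category.comp_id] at h
  rw [h]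
  constructor
  · rintro ⟨φ, h1, h2, h3, h4⟩
    refine ⟨φ ≫ r, ?_, ?_, ?_⟩
    · rw [reassoc_of% h2, hιr, Category.comp_id]
    · rw [reassoc_of% h1, hκr]; simp
    · rw [← h3, ← h4, hρ]; simp
  · rintro ⟨ψ, h1, h2, h3⟩
    refine ⟨P.σ ≫ a' ≫ i + ψ ≫ I.ι, ?_, ?_, ?_, ?_⟩
    · apply hext <;> simp [hiσ, hir, hιr, h2, hκr, wa]
    · apply hext
      · simp
      · simp [hιr, h1]
    · simp [hiσ]
    · simp [hiρ, h3]

/-- Strict morphisms agree if and only if they are homotopic. -/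
theorem ofStrict_eq_iff (a : X.neg ⟶ Y.neg) (a' : X.zer ⟶ Y.zer)
    (wa : a ≫ Y.d = X.d ≫ a') (b : X.neg ⟶ Y.neg) (b' : X.zer ⟶ Y.zer) (wb : b ≫ Y.d = X.d ≫ b') :
    ofStrict a a' wa = ofStrict b b' wb ↔
      ∃ h : X.zer ⟶ Y.neg, X.d ≫ h = b - a ∧ h ≫ Y.d = b' - a' := by
  let I := Butterfly.strict (𝟙 Y.neg) (𝟙 Y.zer) (by simp)
  let r : I.E ⟶ Y.neg := Butterfly.strictSnd (𝟙 Y.neg) (𝟙 Y.zer) (by simp)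
  let i : Y.zer ⟶ I.E := Butterfly.strictInl (𝟙 Y.neg) (𝟙 Y.zer) (by simp)
  have hiσ : i ≫ I.σ = 𝟙 _ := Butterfly.strictInl_σ _ _ _
  have hir : i ≫ r = 0 := Butterfly.strictInl_snd _ _ _
  have hiρ : i ≫ I.ρ = 𝟙 _ := Butterfly.strictInl_ρ _ _ _
  have hκr : I.κ ≫ r = -𝟙 _ := Butterfly.strict_κ_snd _ _ _
  have hιr : I.ι ≫ r = 𝟙 _ := Butterfly.strict_ι_snd _ _ _
  have hρ : I.ρ = I.σ + r ≫ Y.d := by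
    simpa using Butterfly.comp_strict_ρ (𝟙 Y.neg) (𝟙 Y.zer) (by simp) (𝟙 I.E)
  have hext : ∀ {V : A} {x y : V ⟶ I.E}, x ≫ I.σ = y ≫ I.σ → x ≫ r = y ≫ r → x = y :=
    fun h1 h2 => Butterfly.strict_hom_ext _ _ _ h1 h2
  have h := strict_comp_eq_iff I a a' wa b b' wb
  rw [show ofButterfly I = 𝟙 Y from rfl, Category.comp_id] at h
  rw [h]
  constructor
  · rintro ⟨φ, h1, h2, h3⟩
    refine ⟨φ ≫ r, ?_, ?_⟩
    · rw [reassoc_of% h1]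
      simp [hκr, hιr]
      abel
    · rw [← h2, ← h3, hρ]; simp
  · rintro ⟨s, h1, h2⟩
    refine ⟨a' ≫ i + s ≫ I.ι, ?_, ?_, ?_⟩
    · apply hext
      · simp [hiσ, wa]
      · simp [hir, hιr, hκr, reassoc_of% h1]
        abel
    · simp [hiσ]
    · simp [hiρ, h2]

end triangle

end TwoTerm
end

/-! ### Zero morphisms, quasi-isomorphisms and strictification -/

noncomputable section

namespace TwoTerm

variable {A : Type u} [Category.{v} A] [Abelian A]

attribute [local simp] pullback.lift_fst pullback.lift_snd pullback.lift_fst_assoc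
  pullback.lift_snd_assoc

section zero

/-- The zero morphisms of the category of two-term complexes. -/
abbrev hasZeroMorphisms : HasZeroMorphisms (TwoTerm A) where
  zero X Y := ⟨ofStrict 0 0 (by simp)⟩
  comp_zero := by
    intro X Y f Z
    obtain ⟨P, rfl⟩ := ofButterfly_surjective f
    exact (comp_strict_eq_iff P 0 0 (by simp) 0 0 (by simp)).2 ⟨0, by simp⟩
  zero_comp := by
    intro X Y Z f
    obtain ⟨P, rfl⟩ := ofButterfly_surjective f
    exact (strict_comp_eq_iff P 0 0 (by simp) 0 0 (by simp)).2 ⟨0, by simp⟩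

attribute [local instance] hasZeroMorphisms

lemma ofStrict_zero (X Y : TwoTerm A) : ofStrict (0 : X.neg ⟶ Y.neg) (0 : X.zer ⟶ Y.zer)
    (by simp) = 0 := rfl

variable {X Y Z : TwoTerm A}

lemma strict_comp_eq_zero_iff (P : Butterfly Y Z) (a : X.neg ⟶ Y.neg) (a' : X.zer ⟶ Y.zer)
    (wa : a ≫ Y.d = X.d ≫ a') : ofStrict a a' wa ≫ ofButterfly P = 0 ↔
      ∃ φ : X.zer ⟶ P.E, X.d ≫ φ = a ≫ P.κ ∧ φ ≫ P.σ = a' ∧ φ ≫ P.ρ = 0 := by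
  rw [← ofStrict_zero, strict_comp_eq_iff]
  simp

lemma comp_strict_eq_zero_iff (P : Butterfly X Y) (b : Y.neg ⟶ Z.neg) (b' : Y.zer ⟶ Z.zer)
    (wb : b ≫ Z.d = Y.d ≫ b') : ofButterfly P ≫ ofStrict b b' wb = 0 ↔
      ∃ ψ : P.E ⟶ Z.neg, P.ι ≫ ψ = b ∧ P.κ ≫ ψ = 0 ∧ P.ρ ≫ b' = ψ ≫ Z.d := by
  rw [← ofStrict_zero, comp_strict_eq_iff]
  simp

lemma ofStrict_eq_zero_iff (a : X.neg ⟶ Y.neg) (a' : X.zer ⟶ Y.zer)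
    (wa : a ≫ Y.d = X.d ≫ a') : ofStrict a a' wa = 0 ↔
      ∃ h : X.zer ⟶ Y.neg, X.d ≫ h = a ∧ h ≫ Y.d = a' := by
  rw [eq_comm, ← ofStrict_zero, ofStrict_eq_iff]
  simp

end zero

section iso

variable {X Y : TwoTerm A}

/-- The inverse of a butterfly with two short exact diagonals is the butterfly with the diagonals
exchanged. -/
lemma flip_comp (P : Butterfly X Y) (Q : Butterfly Y X) (e : P.E ≅ Q.E)
    (h1 : P.κ ≫ e.hom = Q.ι) (h2 : P.ι ≫ e.hom = Q.κ) (h3 : e.hom ≫ Q.σ = P.ρ)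
    (h4 : e.hom ≫ Q.ρ = P.σ) : ofButterfly P ≫ ofButterfly Q = 𝟙 X := by
  refine Quotient.sound ?_
  let I := Butterfly.strict (𝟙 X.neg) (𝟙 X.zer) (by simp)
  let r : I.E ⟶ X.neg := Butterfly.strictSnd (𝟙 X.neg) (𝟙 X.zer) (by simp)
  let i : X.zer ⟶ I.E := Butterfly.strictInl (𝟙 X.neg) (𝟙 X.zer) (by simp)
  have hext : ∀ {V : A} {x y : V ⟶ I.E}, x ≫ I.σ = y ≫ I.σ → x ≫ r = y ≫ r → x = y :=
    fun h1 h2 => Butterfly.strict_hom_ext _ _ _ h1 h2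
  have hiσ : i ≫ I.σ = 𝟙 _ := Butterfly.strictInl_σ _ _ _
  have hir : i ≫ r = 0 := Butterfly.strictInl_snd _ _ _
  have hiρ : i ≫ I.ρ = 𝟙 _ := Butterfly.strictInl_ρ _ _ _
  have hκr : I.κ ≫ r = -𝟙 _ := Butterfly.strict_κ_snd _ _ _
  have hιr : I.ι ≫ r = 𝟙 _ := Butterfly.strict_ι_snd _ _ _
  have hc := pullback.condition (f := P.ρ) (g := Q.σ)
  -- The two components of a point of the fibre product have the same image in `Y⁰`, so their
  -- difference comes from `X⁻¹` by exactness of the diagonal of `Q`.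
  obtain ⟨y, hy⟩ : ∃ y : Butterfly.fibre P Q ⟶ X.neg,
      y ≫ Q.ι = pullback.snd _ _ - pullback.fst _ _ ≫ e.hom :=
    ⟨Q.exact.exact.lift (pullback.snd _ _ - pullback.fst _ _ ≫ e.hom) (by simp [h3, hc]),
      Q.exact.exact.lift_f _ _⟩
  refine Butterfly.comp_isomorphic P Q I (pullback.fst _ _ ≫ P.σ ≫ i + y ≫ I.ι) ?_ ?_ ?_ ?_ ?_
  · have : Butterfly.diag P Q ≫ y = 0 := by
      rw [← cancel_mono Q.ι]; simp [hy, h2]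
    simp [reassoc_of% this]
  · have : pullback.lift P.κ 0 (by simp) ≫ y = -𝟙 _ := by
      rw [← cancel_mono Q.ι]; simp [hy, h1]
    apply hext <;> simp [reassoc_of% this, hiσ, hir, hιr, hκr]
  · have : pullback.lift 0 Q.ι (by simp) ≫ y = 𝟙 _ := by
      rw [← cancel_mono Q.ι]; simp [hy]
    apply hext <;> simp [reassoc_of% this]
  · simp [hiσ]
  · have : y ≫ X.d = pullback.snd _ _ ≫ Q.ρ - pullback.fst _ _ ≫ P.σ := by
      rw [← Q.ιρ, reassoc_of% hy]; simp [h4]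
    simp [hiρ, this]

/-- A butterfly both of whose diagonals are short exact is invertible. -/
theorem isIso_ofButterfly (P : Butterfly X Y)
    (hP : (ShortComplex.mk P.κ P.ρ P.κρ).ShortExact) : IsIso (ofButterfly P) := by
  let Q : Butterfly Y X :=
    { E := P.E, κ := P.ι, ι := P.κ, σ := P.ρ, ρ := P.σ, κσ := P.ιρ, ιρ := P.κσ, κρ := P.ισ,
      ισ := P.κρ, exact := hP }
  exact ⟨ofButterfly Q, flip_comp P Q (Iso.refl _) (by simp [Q]) (by simp [Q]) (by simp [Q])
    (by simp [Q]), flip_comp Q P (Iso.refl _) (by simp [Q]) (by simp [Q]) (by simp [Q])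
    (by simp [Q])⟩

/-- A morphism of complexes inducing isomorphisms on kernels and cokernels. -/
def IsQis (a : X.neg ⟶ Y.neg) (a' : X.zer ⟶ Y.zer) (w : a ≫ Y.d = X.d ≫ a') : Prop :=
  IsIso (kernel.map X.d Y.d a a' w.symm) ∧ IsIso (cokernel.map X.d Y.d a a' w.symm)

/-- The three conditions are the exactness of the mapping cone `0 ⟶ X⁻¹ ⟶ X⁰ ⊕ Y⁻¹ ⟶ Y⁰ ⟶ 0` at its
three terms, up to refinements. In this form they are statements about the second diagonal of the
strict butterfly. -/
lemma isQis_iff (a : X.neg ⟶ Y.neg) (a' : X.zer ⟶ Y.zer) (w : a ≫ Y.d = X.d ≫ a') :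
    IsQis a a' w ↔
      (∀ ⦃V : A⦄ (z : V ⟶ X.neg), z ≫ X.d = 0 → z ≫ a = 0 → z = 0) ∧
      (∀ ⦃V : A⦄ (x : V ⟶ X.zer) (y : V ⟶ Y.neg), x ≫ a' + y ≫ Y.d = 0 →
        ∃ (V' : A) (π : V' ⟶ V) (_ : Epi π) (z : V' ⟶ X.neg), z ≫ X.d = π ≫ x ∧
          z ≫ a = - π ≫ y) ∧
      (∀ ⦃V : A⦄ (y : V ⟶ Y.zer), ∃ (V' : A) (π : V' ⟶ V) (_ : Epi π) (x : V' ⟶ X.zer)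
        (z : V' ⟶ Y.neg), π ≫ y = x ≫ a' + z ≫ Y.d) := by
  have hX : (ShortComplex.mk X.d (cokernel.π X.d) (by simp)).Exact :=
    ShortComplex.exact_cokernel _
  have hY : (ShortComplex.mk Y.d (cokernel.π Y.d) (by simp)).Exact :=
    ShortComplex.exact_cokernel _
  constructor
  · rintro ⟨hk, hc⟩
    refine ⟨fun V z h1 h2 => ?_, fun V x y h => ?_, fun V y => ?_⟩
    · have h3 : kernel.lift X.d z h1 ≫ kernel.map X.d Y.d a a' w.symm = 0 := by
        rw [← cancel_mono (kernel.ι Y.d)]; simp [h2]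
      have h4 := zero_of_comp_mono _ h3
      rw [← kernel.lift_ι X.d z h1, h4, zero_comp]
    · have h1 : (x ≫ cokernel.π X.d) ≫ cokernel.map X.d Y.d a a' w.symm = 0 := by
        have : (x ≫ a' + y ≫ Y.d) ≫ cokernel.π Y.d = 0 := by rw [h, zero_comp]
        simpa using this
      have h2 := zero_of_comp_mono _ h1
      obtain ⟨V', π, hπ, z, hz⟩ := hX.exact_up_to_refinements x h2
      dsimp at z hz
      have h3 : (z ≫ a + π ≫ y) ≫ Y.d = 0 := by
        simp only [Preadditive.add_comp, Category.assoc, w, ← reassoc_of% hz]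
        rw [← Preadditive.comp_add, h, comp_zero]
      -- Correction term: `z` lifts `x`, but `z ≫ a` is the wanted element only up to a section of
      -- `ker Y.d`, which comes from `ker X.d` by hypothesis.
      let k := kernel.lift Y.d _ h3 ≫ inv (kernel.map X.d Y.d a a' w.symm)
      have hk1 : k ≫ kernel.ι X.d ≫ a = z ≫ a + π ≫ y := by
        have : kernel.ι X.d ≫ a = kernel.map X.d Y.d a a' w.symm ≫ kernel.ι Y.d := by simp
        have hk0 : k ≫ kernel.map X.d Y.d a a' w.symm = kernel.lift Y.d _ h3 := by
          simp only [k, Category.assoc, IsIso.inv_hom_id, Category.comp_id]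
        rw [this, reassoc_of% hk0, kernel.lift_ι]
      refine ⟨V', π, hπ, z - k ≫ kernel.ι X.d, by simp [hz], ?_⟩
      simp [hk1]
    · obtain ⟨V', π, hπ, x, hx⟩ := surjective_up_to_refinements_of_epi (cokernel.π X.d)
        (y ≫ cokernel.π Y.d ≫ inv (cokernel.map X.d Y.d a a' w.symm))
      have h1 : (π ≫ y - x ≫ a') ≫ cokernel.π Y.d = 0 := by
        have := congr($hx ≫ cokernel.map X.d Y.d a a' w.symm)
        simp only [Category.assoc, IsIso.inv_hom_id, Category.comp_id, cokernel.π_desc] at this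
        simp [this]
      obtain ⟨V'', π', hπ', z, hz⟩ := hY.exact_up_to_refinements _ h1
      refine ⟨V'', π' ≫ π, inferInstance, π' ≫ x, z, ?_⟩
      dsimp at z hz
      rw [← hz]
      simp
  · rintro ⟨h1, h2, h3⟩
    constructor
    · have : Mono (kernel.map X.d Y.d a a' w.symm) := by
        rw [Preadditive.mono_iff_cancel_zero]
        intro V z hz
        have := congr($hz ≫ kernel.ι _)
        rw [← cancel_mono (kernel.ι X.d), zero_comp]
        exact h1 _ (by simp) (by simpa using this)
      have : Epi (kernel.map X.d Y.d a a' w.symm) := by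
        rw [epi_iff_surjective_up_to_refinements]
        intro V k
        obtain ⟨V', π, hπ, z, hz, hz'⟩ := h2 0 (-k ≫ kernel.ι _) (by simp)
        refine ⟨V', π, hπ, kernel.lift _ z (by simp [hz]), ?_⟩
        rw [← cancel_mono (kernel.ι Y.d)]
        simp [hz']
      exact isIso_of_mono_of_epi _
    · have : Epi (cokernel.map X.d Y.d a a' w.symm) := by
        rw [epi_iff_surjective_up_to_refinements]
        intro V y
        obtain ⟨V', π, hπ, y', hy'⟩ := surjective_up_to_refinements_of_epi (cokernel.π Y.d) y
        obtain ⟨V'', π', hπ', x, z, hx⟩ := h3 y'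
        refine ⟨V'', π' ≫ π, inferInstance, x ≫ cokernel.π _, ?_⟩
        rw [Category.assoc, hy', reassoc_of% hx]
        simp
      have : Mono (cokernel.map X.d Y.d a a' w.symm) := by
        rw [Preadditive.mono_iff_cancel_zero]
        intro V z hz
        obtain ⟨V', π, hπ, x, hx⟩ := surjective_up_to_refinements_of_epi (cokernel.π X.d) z
        have h4 : (x ≫ a') ≫ cokernel.π Y.d = 0 := by
          have := congr(π ≫ $hz)
          rw [reassoc_of% hx] at this
          simpa using this
        obtain ⟨V'', π', hπ', y, hy⟩ := hY.exact_up_to_refinements _ h4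
        dsimp at y hy
        obtain ⟨V₃, π₃, hπ₃, t, ht, -⟩ := h2 (π' ≫ x) (-y) (by simp [hy])
        have : π₃ ≫ π' ≫ π ≫ z = 0 := by
          rw [hx, ← reassoc_of% ht]; simp
        have := zero_of_epi_comp _ this
        have := zero_of_epi_comp _ this
        exact zero_of_epi_comp _ this
      exact isIso_of_mono_of_epi _

/-- The second diagonal of a strict butterfly is the mapping cone; for a quasi-isomorphism it is
short exact and `isIso_ofButterfly` applies. -/
lemma IsQis.isIso {a : X.neg ⟶ Y.neg} {a' : X.zer ⟶ Y.zer} {w : a ≫ Y.d = X.d ≫ a'}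
    (h : IsQis a a' w) : IsIso (ofStrict a a' w) := by
  obtain ⟨h1, h2, h3⟩ := (isQis_iff a a' w).1 h
  let S := Butterfly.strict a a' w
  let r : S.E ⟶ Y.neg := Butterfly.strictSnd a a' w
  let i : X.zer ⟶ S.E := Butterfly.strictInl a a' w
  have hext : ∀ {V : A} {x y : V ⟶ S.E}, x ≫ S.σ = y ≫ S.σ → x ≫ r = y ≫ r → x = y :=
    fun h1 h2 => Butterfly.strict_hom_ext _ _ _ h1 h2
  have hκr : S.κ ≫ r = -a := Butterfly.strict_κ_snd _ _ _
  have hιr : S.ι ≫ r = 𝟙 _ := Butterfly.strict_ι_snd _ _ _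
  have hiρ : i ≫ S.ρ = a' := Butterfly.strictInl_ρ _ _ _
  have hρ : ∀ {V : A} (x : V ⟶ S.E), x ≫ S.ρ = (x ≫ S.σ) ≫ a' + (x ≫ r) ≫ Y.d := by
    intro V x
    simpa using Butterfly.comp_strict_ρ a a' w x
  refine isIso_ofButterfly _ (ShortComplex.ShortExact.mk' ?_ ?_ ?_)
  · rw [ShortComplex.exact_iff_exact_up_to_refinements]
    intro V x hx
    change V ⟶ S.E at x
    change x ≫ S.ρ = 0 at hx
    rw [hρ] at hx
    obtain ⟨V', π, hπ, z, hz, hz'⟩ := h2 _ _ hx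
    refine ⟨V', π, hπ, z, ?_⟩
    change π ≫ x = z ≫ S.κ
    apply hext
    · simp [hz]
    · simp [hκr, hz']
  · change Mono S.κ
    rw [Preadditive.mono_iff_cancel_zero]
    intro V z hz
    refine h1 z ?_ ?_
    · rw [← S.κσ, reassoc_of% hz, zero_comp]
    · rw [← neg_neg a, Preadditive.comp_neg, ← hκr, reassoc_of% hz, zero_comp, neg_zero]
  · change Epi S.ρ
    rw [epi_iff_surjective_up_to_refinements]
    intro V y
    obtain ⟨V', π, hπ, x, z, hx⟩ := h3 y
    refine ⟨V', π, hπ, x ≫ i + z ≫ S.ι, ?_⟩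
    simp [hx, hiρ]

lemma IsQis.comp {Z : TwoTerm A} {a : X.neg ⟶ Y.neg} {a' : X.zer ⟶ Y.zer}
    {w : a ≫ Y.d = X.d ≫ a'} {b : Y.neg ⟶ Z.neg} {b' : Y.zer ⟶ Z.zer} {w' : b ≫ Z.d = Y.d ≫ b'}
    (h : IsQis a a' w) (h' : IsQis b b' w') :
    IsQis (a ≫ b) (a' ≫ b') (by simp [w', reassoc_of% w]) := by
  obtain ⟨h1, h2⟩ := h
  obtain ⟨h3, h4⟩ := h'
  constructor
  · have : kernel.map X.d Z.d (a ≫ b) (a' ≫ b') (by simp [w', reassoc_of% w]) =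
      kernel.map X.d Y.d a a' w.symm ≫ kernel.map Y.d Z.d b b' w'.symm := by
      rw [← cancel_mono (kernel.ι _)]; simp
    rw [this]; infer_instance
  · have : cokernel.map X.d Z.d (a ≫ b) (a' ≫ b') (by simp [w', reassoc_of% w]) =
      cokernel.map X.d Y.d a a' w.symm ≫ cokernel.map Y.d Z.d b b' w'.symm := by
      rw [← cancel_epi (cokernel.π _)]; simp
    rw [this]; infer_instance

/-- Guarantees that the auxiliary complexes produced by strictification stay in the tilt. -/
lemma IsQis.tilt {a : X.neg ⟶ Y.neg} {a' : X.zer ⟶ Y.zer} {w : a ≫ Y.d = X.d ≫ a'}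
    (h : IsQis a a' w) (T F : ObjectProperty A) [T.IsClosedUnderIsomorphisms]
    [F.IsClosedUnderIsomorphisms] : tiltProperty T F X ↔ tiltProperty T F Y := by
  obtain ⟨h1, h2⟩ := h
  exact and_congr (F.prop_iff_of_iso (asIso (kernel.map X.d Y.d a a' w.symm)))
    (T.prop_iff_of_iso (asIso (cokernel.map X.d Y.d a a' w.symm)))

end iso

section strictify

variable {X Y Y' : TwoTerm A}

/-- Take `Z = [X⁻¹ ⊕ Y⁻¹ ⟶ E]` with differential `(κ, ι)`. Its projection to `X` is a
quasi-isomorphism because `Y⁻¹ ⟶ E ⟶ X⁰` is short exact, and its projection to `Y` is given by `snd`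
and `ρ`. -/
lemma exists_strict_source (f : X ⟶ Y) : ∃ (Z : TwoTerm A) (p : Z.neg ⟶ X.neg) (p' : Z.zer ⟶ X.zer)
    (wp : p ≫ X.d = Z.d ≫ p') (q : Z.neg ⟶ Y.neg) (q' : Z.zer ⟶ Y.zer)
    (wq : q ≫ Y.d = Z.d ≫ q'), IsQis p p' wp ∧ ofStrict p p' wp ≫ f = ofStrict q q' wq := by
  obtain ⟨P, rfl⟩ := ofButterfly_surjective f
  let Z : TwoTerm A := ⟨X.neg ⊞ Y.neg, P.E, biprod.desc P.κ P.ι⟩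
  refine ⟨Z, biprod.fst, P.σ, by apply biprod.hom_ext' <;> simp [Z], biprod.snd, P.ρ,
    by apply biprod.hom_ext' <;> simp [Z], ?_, ?_⟩
  · rw [isQis_iff]
    refine ⟨fun V z h1 h2 => ?_, fun V x y h => ?_, fun V y => ?_⟩
    · apply biprod.hom_ext
      · simpa using h2
      · rw [← cancel_mono P.ι]
        dsimp [Z] at h1
        rw [biprod.desc_eq, Preadditive.comp_add, reassoc_of% h2] at h1
        simpa using h1
    · have h1 : (x + y ≫ P.κ) ≫ P.σ = 0 := by simpa using h
      have h2 := P.exact.exact.lift_f _ h1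
      refine ⟨V, 𝟙 V, inferInstance, biprod.lift (-y) (P.exact.exact.lift _ h1), ?_, by simp⟩
      dsimp [Z] at h2 ⊢
      rw [biprod.lift_desc, h2]
      simp
    · obtain ⟨V', π, hπ, x, hx⟩ := surjective_up_to_refinements_of_epi P.σ y
      exact ⟨V', π, hπ, x, 0, by simpa using hx⟩
  · rw [strict_comp_eq_iff]
    -- The degree `0` term of `Z` is the central object, so its identity is the map required by the
    -- triangle criterion.
    exact ⟨𝟙 _, by simp [Z, biprod.desc_eq], by simp [Z], by simp [Z]⟩

/-- Dual construction: `Z = [E ⟶ X⁰ ⊕ Y⁰]` with differential `(σ, ρ)`. The morphism from `X` carries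
minus signs to match the sign convention of strict butterflies. -/
lemma exists_strict_target (f : X ⟶ Y) : ∃ (Z : TwoTerm A) (p : Y.neg ⟶ Z.neg) (p' : Y.zer ⟶ Z.zer)
    (wp : p ≫ Z.d = Y.d ≫ p') (q : X.neg ⟶ Z.neg) (q' : X.zer ⟶ Z.zer)
    (wq : q ≫ Z.d = X.d ≫ q'), IsQis p p' wp ∧ f ≫ ofStrict p p' wp = ofStrict q q' wq := by
  obtain ⟨P, rfl⟩ := ofButterfly_surjective f
  let Z : TwoTerm A := ⟨P.E, X.zer ⊞ Y.zer, biprod.lift P.σ P.ρ⟩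
  refine ⟨Z, P.ι, biprod.inr, by apply biprod.hom_ext <;> simp [Z], -P.κ, -biprod.inl,
    by apply biprod.hom_ext <;> simp [Z], ?_, ?_⟩
  · rw [isQis_iff]
    refine ⟨fun V z h1 h2 => ?_, fun V x y h => ?_, fun V y => ?_⟩
    · exact zero_of_comp_mono _ h2
    · have h1 : y ≫ P.σ = 0 := by simpa [Z] using congr($h ≫ biprod.fst)
      have h0 : x + y ≫ P.ρ = 0 := by simpa [Z] using congr($h ≫ biprod.snd)
      have h2 := P.exact.exact.lift_f _ h1
      dsimp at h2
      refine ⟨V, 𝟙 V, inferInstance, -P.exact.exact.lift _ h1, ?_, by simp [h2]⟩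
      rw [← P.ιρ, Preadditive.neg_comp, reassoc_of% h2, Category.id_comp]
      exact (eq_neg_of_add_eq_zero_left h0).symm
    · obtain ⟨V', π, hπ, x, hx⟩ := surjective_up_to_refinements_of_epi P.σ (y ≫ biprod.fst)
      refine ⟨V', π, hπ, π ≫ y ≫ biprod.snd - x ≫ P.ρ, x, ?_⟩
      apply biprod.hom_ext <;> simp [Z, hx]
  · rw [comp_strict_eq_iff]
    refine ⟨𝟙 _, by simp [Z], by simp [Z], ?_⟩
    apply biprod.hom_ext <;> simp [Z]

/-- Strictifying one morphism and then the other, on the new source, makes a parallel pair strict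
over a common quasi-isomorphism. -/
lemma exists_strict_source₂ (f : X ⟶ Y) (g : X ⟶ Y') : ∃ (Z : TwoTerm A) (p : Z.neg ⟶ X.neg)
    (p' : Z.zer ⟶ X.zer) (wp : p ≫ X.d = Z.d ≫ p')
    (q : Z.neg ⟶ Y.neg) (q' : Z.zer ⟶ Y.zer) (wq : q ≫ Y.d = Z.d ≫ q')
    (r : Z.neg ⟶ Y'.neg) (r' : Z.zer ⟶ Y'.zer) (wr : r ≫ Y'.d = Z.d ≫ r'),
    IsQis p p' wp ∧ ofStrict p p' wp ≫ f = ofStrict q q' wq ∧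
      ofStrict p p' wp ≫ g = ofStrict r r' wr := by
  obtain ⟨Z, p, p', wp, q, q', wq, hp, hq⟩ := exists_strict_source f
  obtain ⟨Z', s, s', ws, r, r', wr, hs, hr⟩ := exists_strict_source (ofStrict p p' wp ≫ g)
  refine ⟨Z', s ≫ p, s' ≫ p', by simp [wp, reassoc_of% ws], s ≫ q, s' ≫ q',
    by simp [wq, reassoc_of% ws], r, r', wr, hs.comp hp, ?_, ?_⟩
  · rw [← ofStrict_comp s s' ws p p' wp, Category.assoc, hq, ofStrict_comp]
  · rw [← ofStrict_comp s s' ws p p' wp, Category.assoc, hr]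

lemma exists_strict_target₂ (f : X ⟶ Y) (g : Y' ⟶ Y) : ∃ (Z : TwoTerm A) (p : Y.neg ⟶ Z.neg)
    (p' : Y.zer ⟶ Z.zer) (wp : p ≫ Z.d = Y.d ≫ p')
    (q : X.neg ⟶ Z.neg) (q' : X.zer ⟶ Z.zer) (wq : q ≫ Z.d = X.d ≫ q')
    (r : Y'.neg ⟶ Z.neg) (r' : Y'.zer ⟶ Z.zer) (wr : r ≫ Z.d = Y'.d ≫ r'),
    IsQis p p' wp ∧ f ≫ ofStrict p p' wp = ofStrict q q' wq ∧
      g ≫ ofStrict p p' wp = ofStrict r r' wr := by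
  obtain ⟨Z, p, p', wp, q, q', wq, hp, hq⟩ := exists_strict_target f
  obtain ⟨Z', s, s', ws, r, r', wr, hs, hr⟩ := exists_strict_target (g ≫ ofStrict p p' wp)
  refine ⟨Z', p ≫ s, p' ≫ s', by simp [ws, reassoc_of% wp], q ≫ s, q' ≫ s',
    by simp [ws, reassoc_of% wq], r, r', wr, hp.comp hs, ?_, ?_⟩
  · rw [← ofStrict_comp p p' wp s s' ws, reassoc_of% hq, ofStrict_comp]
  · rw [← ofStrict_comp p p' wp s s' ws, ← hr, Category.assoc]

end strictify

end TwoTerm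
end

/-! ### Kernels and cokernels in the tilt -/

noncomputable section

namespace IsTorsionPair

variable {A : Type u} [Category.{v} A] [Abelian A] {T F : ObjectProperty A}

lemma F_of_hom_eq_zero (h : IsTorsionPair T F) {N : A} (hN : ∀ ⦃V : A⦄ (_ : T V) (f : V ⟶ N), f = 0) :
    F N := by
  obtain ⟨P, Q, i, p, w, hs, hP, hQ⟩ := h.exists_shortExact N
  have : Epi p := hs.epi_g
  have : Mono p := hs.exact.mono_g (hN hP i)
  have : IsIso p := isIso_of_mono_of_epi p
  have := h.isoF
  exact F.prop_of_iso (asIso p).symm hQ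

lemma T_of_hom_eq_zero (h : IsTorsionPair T F) {N : A} (hN : ∀ ⦃V : A⦄ (_ : F V) (f : N ⟶ V), f = 0) :
    T N := by
  obtain ⟨P, Q, i, p, w, hs, hP, hQ⟩ := h.exists_shortExact N
  have : Mono i := hs.mono_f
  have : Epi i := hs.exact.epi_f (hN hQ p)
  have : IsIso i := isIso_of_mono_of_epi i
  have := h.isoT
  exact T.prop_of_iso (asIso i) hP

lemma F_of_isZero (h : IsTorsionPair T F) {N : A} (hN : IsZero N) : F N :=
  h.F_of_hom_eq_zero fun _ _ _ => hN.eq_of_tgt _ _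

lemma T_of_isZero (h : IsTorsionPair T F) {N : A} (hN : IsZero N) : T N :=
  h.T_of_hom_eq_zero fun _ _ _ => hN.eq_of_src _ _

/-- A morphism that factors through a torsion quotient and a torsion-free subobject vanishes. -/
lemma eq_zero_of_cokernel_of_kernel (h : IsTorsionPair T F) {X Y V W : A} (f : X ⟶ Y) (g : V ⟶ W)
    (hf : T (cokernel f)) (hg : F (kernel g)) (D : Y ⟶ V) (h1 : f ≫ D = 0) (h2 : D ≫ g = 0) :
    D = 0 := by
  have h3 : cokernel.desc f (kernel.lift g D h2) (by rw [← cancel_mono (kernel.ι g)]; simp [h1]) = 0 :=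
    h.hom_eq_zero hf hg _
  have h4 : kernel.lift g D h2 = 0 := by
    rw [← cokernel.π_desc f (kernel.lift g D h2) (by rw [← cancel_mono (kernel.ι g)]; simp [h1]),
      h3, comp_zero]
  rw [← kernel.lift_ι g D h2, h4, zero_comp]

end IsTorsionPair

/-- For a butterfly `P`, a subobject `S` of `ker ρ` containing the image of `κ` such that the
quotient of `S` by `X⁻¹` is torsion and the quotient of `ker ρ` by `S` is torsion-free. -/
structure Butterfly.Cut {A : Type u} [Category.{v} A] [Abelian A] (T F : ObjectProperty A)
    {X Y : TwoTerm A} (P : Butterfly X Y) where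
  S : A
  s : S ⟶ P.E
  x : X.neg ⟶ S
  mono : Mono s
  xs : x ≫ s = P.κ
  sρ : s ≫ P.ρ = 0
  torsion : T (cokernel x)
  free : F (kernel (cokernel.desc s P.ρ sρ))

namespace Butterfly.Cut

variable {A : Type u} [Category.{v} A] [Abelian A] {T F : ObjectProperty A} {X Y : TwoTerm A}
  {P : Butterfly X Y}

attribute [instance] Cut.mono
attribute [simp] Cut.xs Cut.sρ

@[simp] lemma xs_assoc (c : P.Cut T F) {V : A} (f : P.E ⟶ V) : c.x ≫ c.s ≫ f = P.κ ≫ f := by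
  rw [← Category.assoc, c.xs]

@[simp] lemma sρ_assoc (c : P.Cut T F) {V : A} (f : Y.zer ⟶ V) : c.s ≫ P.ρ ≫ f = 0 := by
  rw [← Category.assoc, c.sρ, zero_comp]

@[simp] lemma κ_cokernel (c : P.Cut T F) : P.κ ≫ cokernel.π c.s = 0 := by
  rw [← c.xs, Category.assoc, cokernel.condition, comp_zero]

/-- `S` is the preimage in `ker ρ` of the torsion subobject of `ker ρ / im κ`. The quotient of `S`
by `X⁻¹` is then torsion, and `ker ρ / S` is the torsion-free quotient. -/
lemma nonempty (h : IsTorsionPair T F) (P : Butterfly X Y) : Nonempty (P.Cut T F) := by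
  let k := kernel.lift P.ρ P.κ P.κρ
  have hk : k ≫ kernel.ι P.ρ = P.κ := kernel.lift_ι _ _ _
  obtain ⟨V, Q, i, q, w, hs, hV, hQ⟩ := h.exists_shortExact (cokernel k)
  have : Mono i := hs.mono_f
  have : Epi q := hs.epi_g
  have hex : (ShortComplex.mk k (cokernel.π k) (by simp)).Exact := ShortComplex.exact_cokernel _
  let fst := pullback.fst (cokernel.π k) i
  let snd := pullback.snd (cokernel.π k) i
  have hc : fst ≫ cokernel.π k = snd ≫ i := pullback.condition
  let s := fst ≫ kernel.ι P.ρ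
  have hsρ : s ≫ P.ρ = 0 := by simp [s]
  let x : X.neg ⟶ pullback (cokernel.π k) i := pullback.lift k 0 (by simp)
  have hx1 : x ≫ fst = k := pullback.lift_fst _ _ _
  have hx2 : x ≫ snd = 0 := pullback.lift_snd _ _ _
  have hexs : (ShortComplex.mk s (cokernel.π s) (by simp)).Exact := ShortComplex.exact_cokernel _
  refine ⟨⟨_, s, x, inferInstance, by simp [s, reassoc_of% hx1, hk], hsρ, ?_, ?_⟩⟩
  -- `x` covers the kernel of `snd : S ⟶ V`, so `coker x` is a quotient of the torsion object `V`.
  · have h0 : kernel.ι snd ≫ cokernel.π x = 0 := by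
      have h1 : (kernel.ι snd ≫ fst) ≫ cokernel.π k = 0 := by simp [hc]
      obtain ⟨V', π, hπ, z, hz⟩ := hex.exact_up_to_refinements _ h1
      dsimp at z hz
      have h2 : π ≫ kernel.ι snd = z ≫ x := by
        apply pullback.hom_ext
        · change (π ≫ kernel.ι snd) ≫ fst = (z ≫ x) ≫ fst
          simp [hx1, hz]
        · change (π ≫ kernel.ι snd) ≫ snd = (z ≫ x) ≫ snd
          simp [hx2]
      apply zero_of_epi_comp π
      rw [reassoc_of% h2]; simp
    have h1 := Abelian.comp_epiDesc snd (cokernel.π x) h0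
    have : Epi (Abelian.epiDesc snd (cokernel.π x) h0) := by
      have : Epi (snd ≫ Abelian.epiDesc snd (cokernel.π x) h0) := by rw [h1]; infer_instance
      exact epi_of_epi snd _
    exact h.T_of_epi (Abelian.epiDesc snd (cokernel.π x) h0) hV
  -- The map `ker ρ ⟶ E / S` kills the kernel of `ker ρ ⟶ Q`, hence induces `Q ⟶ E / S`; the rest
  -- identifies `Q` with the kernel of `E / S ⟶ Y⁰`.
  · have h0 : kernel.ι (cokernel.π k ≫ q) ≫ kernel.ι P.ρ ≫ cokernel.π s = 0 := by
      let t := hs.exact.lift (kernel.ι (cokernel.π k ≫ q) ≫ cokernel.π k) (by simp)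
      have ht : t ≫ i = _ := hs.exact.lift_f _ _
      have h1 : kernel.ι (cokernel.π k ≫ q) = pullback.lift _ _ ht.symm ≫ fst :=
        (pullback.lift_fst _ _ _).symm
      have h2 : fst ≫ kernel.ι P.ρ ≫ cokernel.π s = 0 := by
        rw [← Category.assoc]
        exact cokernel.condition s
      rw [h1, Category.assoc, h2, comp_zero]
    let g := Abelian.epiDesc (cokernel.π k ≫ q) _ h0
    have hg : (cokernel.π k ≫ q) ≫ g = kernel.ι P.ρ ≫ cokernel.π s := Abelian.comp_epiDesc _ _ _
    have hgd : g ≫ cokernel.desc s P.ρ hsρ = 0 := by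
      rw [← cancel_epi (cokernel.π k ≫ q), ← Category.assoc, hg]; simp
    let e := kernel.lift _ g hgd
    have he : e ≫ kernel.ι _ = g := kernel.lift_ι _ _ _
    have : Mono e := by
      rw [Preadditive.mono_iff_cancel_zero]
      intro V' z hz
      have hz' : z ≫ g = 0 := by rw [← he, reassoc_of% hz, zero_comp]
      obtain ⟨V₁, π, hπ, l, hl⟩ := surjective_up_to_refinements_of_epi (cokernel.π k ≫ q) z
      have h1 : (l ≫ kernel.ι P.ρ) ≫ cokernel.π s = 0 := by
        rw [Category.assoc, ← hg, ← Category.assoc, ← hl, Category.assoc, hz', comp_zero]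
      obtain ⟨V₂, π₂, hπ₂, t, ht⟩ := hexs.exact_up_to_refinements _ h1
      dsimp at t ht
      have h2 : π₂ ≫ l = t ≫ fst := by
        rw [← cancel_mono (kernel.ι P.ρ)]; simp [ht, s]
      apply zero_of_epi_comp π
      apply zero_of_epi_comp π₂
      rw [hl, reassoc_of% h2, reassoc_of% hc, w, comp_zero, comp_zero]
    have : Epi e := by
      rw [epi_iff_surjective_up_to_refinements]
      intro V' z
      obtain ⟨V₁, π, hπ, l, hl⟩ := surjective_up_to_refinements_of_epi (cokernel.π s)
        (z ≫ kernel.ι _)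
      have h1 : l ≫ P.ρ = 0 := by
        rw [← cokernel.π_desc s P.ρ hsρ, ← reassoc_of% hl]; simp
      refine ⟨V₁, π, hπ, kernel.lift _ l h1 ≫ cokernel.π k ≫ q, ?_⟩
      rw [← cancel_mono (kernel.ι _)]
      have := hg
      simp only [Category.assoc] at this
      simp [he, this, hl]
    have : IsIso e := isIso_of_mono_of_epi e
    have := h.isoF
    exact F.prop_of_iso (asIso e) hQ

section

variable (c : P.Cut T F)

/-- The kernel of the morphism given by a butterfly. -/
abbrev kerObj : TwoTerm A := ⟨X.neg, c.S, c.x⟩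

/-- The cokernel of the morphism given by a butterfly. -/
abbrev cokerObj : TwoTerm A := ⟨cokernel c.s, Y.zer, cokernel.desc c.s P.ρ c.sρ⟩

lemma kerObj_w : 𝟙 X.neg ≫ X.d = c.kerObj.d ≫ c.s ≫ P.σ := by
  simp

lemma cokerObj_w : (P.ι ≫ cokernel.π c.s) ≫ c.cokerObj.d = Y.d ≫ 𝟙 Y.zer := by simp

/-- The inclusion of the kernel. -/
abbrev kerι : c.kerObj ⟶ X := TwoTerm.ofStrict (Y := X) (𝟙 X.neg) (c.s ≫ P.σ) c.kerObj_w

/-- The projection to the cokernel. -/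
abbrev cokerπ : Y ⟶ c.cokerObj :=
  TwoTerm.ofStrict (P.ι ≫ cokernel.π c.s) (𝟙 Y.zer) c.cokerObj_w

open TwoTerm

attribute [local instance] hasZeroMorphisms

/-- `ker x` is a subobject of `ker X.d`, since `d = x ≫ s ≫ σ`. -/
lemma kerObj_tilt (h : IsTorsionPair T F) (hX : tiltProperty T F X) :
    tiltProperty T F c.kerObj := by
  refine ⟨?_, c.torsion⟩
  have h1 : kernel.ι c.x ≫ X.d = 0 := by
    rw [← P.κσ, ← c.xs_assoc, kernel.condition_assoc, zero_comp]
  have h2 : kernel.lift X.d (kernel.ι c.x) h1 ≫ kernel.ι X.d = kernel.ι c.x := kernel.lift_ι _ _ _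
  have : Mono (kernel.lift X.d (kernel.ι c.x) h1) := by
    have : Mono (kernel.lift X.d (kernel.ι c.x) h1 ≫ kernel.ι X.d) := by rw [h2]; infer_instance
    exact mono_of_mono _ (kernel.ι X.d)
  exact h.F_of_mono (kernel.lift X.d (kernel.ι c.x) h1) hX.1

lemma cokerObj_tilt (h : IsTorsionPair T F) (hY : tiltProperty T F Y) :
    tiltProperty T F c.cokerObj := by
  refine ⟨c.free, ?_⟩
  have h1 : Y.d ≫ cokernel.π c.cokerObj.d = 0 := by
    have := c.cokerObj_w
    rw [Category.comp_id] at this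
    rw [← this, Category.assoc, cokernel.condition, comp_zero]
  have h2 : cokernel.π Y.d ≫ cokernel.desc Y.d (cokernel.π c.cokerObj.d) h1 =
      cokernel.π c.cokerObj.d := cokernel.π_desc _ _ _
  have : Epi (cokernel.desc Y.d (cokernel.π c.cokerObj.d) h1) := by
    have : Epi (cokernel.π Y.d ≫ cokernel.desc Y.d (cokernel.π c.cokerObj.d) h1) := by
      rw [h2]; infer_instance
    exact epi_of_epi (cokernel.π Y.d) _
  exact h.T_of_epi (cokernel.desc Y.d (cokernel.π c.cokerObj.d) h1) hY.2

lemma kerι_comp : c.kerι ≫ ofButterfly P = 0 := by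
  rw [strict_comp_eq_zero_iff]
  exact ⟨c.s, by simp, rfl, by simp⟩

lemma comp_cokerπ : ofButterfly P ≫ c.cokerπ = 0 := by
  rw [comp_strict_eq_zero_iff]
  refine ⟨cokernel.π c.s, rfl, by simp, by simp⟩

/-- A morphism from a tilt object into the central object that vanishes under `ρ` and restricts
to `κ` lifts to `S`. -/
lemma exists_lift (h : IsTorsionPair T F) {W : TwoTerm A} (hW : tiltProperty T F W)
    (a : W.neg ⟶ X.neg) (φ : W.zer ⟶ P.E) (h1 : W.d ≫ φ = a ≫ P.κ) (h2 : φ ≫ P.ρ = 0) :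
    ∃ v : W.zer ⟶ c.S, v ≫ c.s = φ := by
  have h3 : φ ≫ cokernel.π c.s = 0 := by
    refine h.eq_zero_of_cokernel_of_kernel W.d _ hW.2 c.free _ ?_ (by simp [h2])
    rw [reassoc_of% h1]; simp
  exact ⟨Abelian.monoLift c.s φ h3, Abelian.monoLift_comp _ _ _⟩

/-- After making `u` strict, its composite with `P` vanishes by means of a map from the degree `0`
term to `E` that `ρ` kills. By orthogonality this map lands in `S`, and it is the degree `0` part of
the lift. -/
lemma ker_lift (h : IsTorsionPair T F) {W : TwoTerm A} (hW : tiltProperty T F W) (u : W ⟶ X)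
    (hu : u ≫ ofButterfly P = 0) : ∃ v, v ≫ c.kerι = u := by
  obtain ⟨Z, p, p', wp, q, q', wq, hp, hq⟩ := exists_strict_source u
  have := hp.isIso
  have h1 : ofStrict q q' wq ≫ ofButterfly P = 0 := by rw [← hq, Category.assoc, hu, comp_zero]
  obtain ⟨φ, h2, h3, h4⟩ := (strict_comp_eq_zero_iff _ _ _ _).1 h1
  have := h.isoT
  have := h.isoF
  obtain ⟨v, hv⟩ := c.exists_lift h ((hp.tilt T F).2 hW) q φ h2 h4
  have wv : q ≫ c.kerObj.d = Z.d ≫ v := by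
    rw [← cancel_mono c.s]; simp [hv, h2]
  refine ⟨inv (ofStrict p p' wp) ≫ ofStrict (Y := c.kerObj) q v wv, ?_⟩
  rw [Category.assoc, IsIso.inv_comp_eq, hq, ofStrict_comp (Y := c.kerObj)]
  exact ofStrict_congr (by simp) (by rw [← Category.assoc, hv, h3]) _

/-- A homotopy `t` between the composites into `X` is already a homotopy between the maps into `[X⁻¹
⟶ S]`. The failure `D` takes values in `ker σ = Y⁻¹`, vanishes on the differential of the source and
is killed by `Y.d`; it therefore factors through an object of `T` and then one of `F`. -/
lemma ker_hom_ext (h : IsTorsionPair T F) (hY : tiltProperty T F Y) {W : TwoTerm A}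
    (hW : tiltProperty T F W) (u v : W ⟶ c.kerObj) (huv : u ≫ c.kerι = v ≫ c.kerι) : u = v := by
  obtain ⟨Z, p, p', wp, q, q', wq, r, r', wr, hp, hq, hr⟩ := exists_strict_source₂ u v
  have := hp.isIso
  have := h.isoT
  have := h.isoF
  rw [← cancel_epi (ofStrict p p' wp), hq, hr]
  rw [← cancel_epi (ofStrict p p' wp), ← Category.assoc, ← Category.assoc, hq, hr,
    ofStrict_comp, ofStrict_comp, ofStrict_eq_iff] at huv
  obtain ⟨t, h1, h2⟩ := huv
  rw [ofStrict_eq_iff]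
  simp only [Category.comp_id] at t h1 h2
  refine ⟨t, h1, ?_⟩
  have hD0 : (t ≫ P.κ - (r' - q') ≫ c.s) ≫ P.σ = 0 := by simp [h2]
  have hD1 := P.exact.exact.lift_f _ hD0
  set D := P.exact.exact.lift _ hD0
  dsimp at D hD1
  have hD : D = 0 := by
    refine h.eq_zero_of_cokernel_of_kernel Z.d Y.d ((hp.tilt T F).2 hW).2 hY.1 _ ?_ ?_
    · rw [← cancel_mono P.ι, Category.assoc, hD1, zero_comp, Preadditive.comp_sub,
        reassoc_of% h1, Preadditive.comp_sub_assoc, ← wq, ← wr]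
      simp
    · rw [← P.ιρ, reassoc_of% hD1]; simp
  rw [hD, zero_comp] at hD1
  rw [← cancel_mono c.s, ← sub_eq_zero.1 hD1.symm]
  simp

/-- A morphism from the central object that vanishes on `κ` and is compatible with `ρ` descends
to the quotient by `S`. -/
lemma exists_desc (h : IsTorsionPair T F) {W : TwoTerm A} (hW : tiltProperty T F W)
    (b : Y.zer ⟶ W.zer) (ψ : P.E ⟶ W.neg) (h1 : P.κ ≫ ψ = 0) (h2 : P.ρ ≫ b = ψ ≫ W.d) :
    ∃ v : cokernel c.s ⟶ W.neg, cokernel.π c.s ≫ v = ψ := by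
  have h3 : c.s ≫ ψ = 0 := by
    refine h.eq_zero_of_cokernel_of_kernel c.x W.d c.torsion hW.1 _ ?_ ?_
    · rw [← Category.assoc, c.xs, h1]
    · rw [Category.assoc, ← h2, reassoc_of% c.sρ, zero_comp]
  exact ⟨cokernel.desc c.s ψ h3, cokernel.π_desc _ _ _⟩

/-- Dual to `ker_lift`: the strictification is on the target, and the map from `E` that trivializes
the composite descends to `E / S` by orthogonality. -/
lemma coker_desc (h : IsTorsionPair T F) {W : TwoTerm A} (hW : tiltProperty T F W) (u : Y ⟶ W)
    (hu : ofButterfly P ≫ u = 0) : ∃ v, c.cokerπ ≫ v = u := by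
  obtain ⟨Z, p, p', wp, q, q', wq, hp, hq⟩ := exists_strict_target u
  have := hp.isIso
  have h1 : ofButterfly P ≫ ofStrict q q' wq = 0 := by rw [← hq, reassoc_of% hu, zero_comp]
  obtain ⟨ψ, h2, h3, h4⟩ := (comp_strict_eq_zero_iff _ _ _ _).1 h1
  have := h.isoT
  have := h.isoF
  obtain ⟨v, hv⟩ := c.exists_desc h ((hp.tilt T F).1 hW) q' ψ h3 h4
  have wv : v ≫ Z.d = c.cokerObj.d ≫ q' := by
    rw [← cancel_epi (cokernel.π c.s), reassoc_of% hv]; simp [h4]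
  refine ⟨ofStrict (X := c.cokerObj) v q' wv ≫ inv (ofStrict p p' wp), ?_⟩
  rw [← Category.assoc, IsIso.comp_inv_eq, hq, ofStrict_comp (Y := c.cokerObj)]
  exact ofStrict_congr (by rw [Category.assoc, hv, h2]) (by simp) _

/-- Dual to `ker_hom_ext`. Here the failure of the homotopy kills `Y⁻¹`, hence is a map `D` from
`X⁰`, and it factors through `coker X.d ∈ T` and the kernel of the target differential in `F`. -/
lemma coker_hom_ext (h : IsTorsionPair T F) (hX : tiltProperty T F X) {W : TwoTerm A}
    (hW : tiltProperty T F W) (u v : c.cokerObj ⟶ W) (huv : c.cokerπ ≫ u = c.cokerπ ≫ v) :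
    u = v := by
  obtain ⟨Z, p, p', wp, q, q', wq, r, r', wr, hp, hq, hr⟩ := exists_strict_target₂ u v
  have := hp.isIso
  have := h.isoT
  have := h.isoF
  rw [← cancel_mono (ofStrict p p' wp), hq, hr]
  rw [← cancel_mono (ofStrict p p' wp), Category.assoc, Category.assoc, hq, hr,
    ofStrict_comp, ofStrict_comp, ofStrict_eq_iff] at huv
  obtain ⟨t, h1, h2⟩ := huv
  rw [ofStrict_eq_iff]
  simp only [Category.id_comp] at t h1 h2
  refine ⟨t, ?_, h2⟩
  have hD0 : P.ι ≫ (P.ρ ≫ t - cokernel.π c.s ≫ (r - q)) = 0 := by simp [h1]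
  have hD1 := P.exact.exact.g_desc _ hD0
  set D := P.exact.exact.desc _ hD0
  dsimp at D hD1
  have hD : D = 0 := by
    refine h.eq_zero_of_cokernel_of_kernel X.d Z.d hX.2 ((hp.tilt T F).1 hW).1 _ ?_ ?_
    · rw [← P.κσ, Category.assoc, hD1, Preadditive.comp_sub, reassoc_of% c.κ_cokernel]
      simp
    · rw [← cancel_epi P.σ, reassoc_of% hD1, Preadditive.sub_comp, comp_zero, Category.assoc, h2]
      simp [wr, wq]
  rw [hD, comp_zero] at hD1
  rw [← cancel_epi (cokernel.π c.s), ← sub_eq_zero.1 hD1.symm]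
  simp

end

end Butterfly.Cut
end

/-! ### Normality of monomorphisms and epimorphisms in the tilt -/

noncomputable section

namespace TwoTerm

variable {A : Type u} [Category.{v} A] [Abelian A]

attribute [local simp] pullback.lift_fst pullback.lift_snd pullback.lift_fst_assoc
  pullback.lift_snd_assoc pushout.inl_desc pushout.inr_desc pushout.inl_desc_assoc
  pushout.inr_desc_assoc

attribute [local instance] hasZeroMorphisms

section

variable {X Y Z : TwoTerm A}

/-- For a point `(p, q)` of the fibre product, `q - φ p` is killed by `Q.σ` and so lies in `Z⁻¹`.
Together with `σ p` it gives the map to the central object `X⁰ ⊕ Z⁻¹` of the strict butterfly. -/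
lemma comp_eq_ofStrict_of_map (P : Butterfly X Y) (Q : Butterfly Y Z) (q : X.neg ⟶ Z.neg)
    (q' : X.zer ⟶ Z.zer) (w : q ≫ Z.d = X.d ≫ q') (φ : P.E ⟶ Q.E) (h1 : P.κ ≫ φ = q ≫ Q.ι)
    (h2 : P.ι ≫ φ = Q.κ) (h3 : φ ≫ Q.σ = P.ρ) (h4 : φ ≫ Q.ρ = P.σ ≫ q') :
    ofButterfly P ≫ ofButterfly Q = ofStrict q q' w := by
  refine Quotient.sound ?_
  let I := Butterfly.strict q q' w
  let r : I.E ⟶ Z.neg := Butterfly.strictSnd q q' w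
  let i : X.zer ⟶ I.E := Butterfly.strictInl q q' w
  have hext : ∀ {V : A} {x y : V ⟶ I.E}, x ≫ I.σ = y ≫ I.σ → x ≫ r = y ≫ r → x = y :=
    fun h1 h2 => Butterfly.strict_hom_ext _ _ _ h1 h2
  have hiσ : i ≫ I.σ = 𝟙 _ := Butterfly.strictInl_σ _ _ _
  have hir : i ≫ r = 0 := Butterfly.strictInl_snd _ _ _
  have hiρ : i ≫ I.ρ = q' := Butterfly.strictInl_ρ _ _ _
  have hκr : I.κ ≫ r = -q := Butterfly.strict_κ_snd _ _ _
  have hιr : I.ι ≫ r = 𝟙 _ := Butterfly.strict_ι_snd _ _ _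
  have hc := pullback.condition (f := P.ρ) (g := Q.σ)
  obtain ⟨y, hy⟩ : ∃ y : Butterfly.fibre P Q ⟶ Z.neg,
      y ≫ Q.ι = pullback.snd _ _ - pullback.fst _ _ ≫ φ :=
    ⟨Q.exact.exact.lift (pullback.snd _ _ - pullback.fst _ _ ≫ φ) (by simp [h3, hc]),
      Q.exact.exact.lift_f _ _⟩
  refine Butterfly.comp_isomorphic P Q I (pullback.fst _ _ ≫ P.σ ≫ i + y ≫ I.ι) ?_ ?_ ?_ ?_ ?_
  · have : Butterfly.diag P Q ≫ y = 0 := by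
      rw [← cancel_mono Q.ι]; simp [hy, h2]
    simp [reassoc_of% this]
  · have : pullback.lift P.κ 0 (by simp) ≫ y = -q := by
      rw [← cancel_mono Q.ι]; simp [hy, h1]
    apply hext <;> simp [reassoc_of% this, hiσ, hir, hιr, hκr]
  · have : pullback.lift 0 Q.ι (by simp) ≫ y = 𝟙 _ := by
      rw [← cancel_mono Q.ι]; simp [hy]
    apply hext <;> simp [reassoc_of% this]
  · simp [hiσ]
  · have : y ≫ Z.d = pullback.snd _ _ ≫ Q.ρ - pullback.fst _ _ ≫ P.σ ≫ q' := by
      rw [← Q.ιρ, reassoc_of% hy]; simp [h4]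
    simp [hiρ, this]

/-- If the kernel of `P` vanishes then `P` is a kernel of its cokernel. -/
lemma exists_lift_of_isIso {T F : ObjectProperty A} {P : Butterfly X Y} (c : P.Cut T F) [IsIso c.x]
    (u : Z ⟶ Y) (hu : u ≫ c.cokerπ = 0) : ∃ v, v ≫ ofButterfly P = u := by
  obtain ⟨W, p, p', wp, q, q', wq, hp, hq⟩ := exists_strict_source u
  have := hp.isIso
  have h1 : ofStrict q q' wq ≫ c.cokerπ = 0 := by rw [← hq, Category.assoc, hu, comp_zero]
  rw [ofStrict_comp, ofStrict_eq_zero_iff] at h1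
  obtain ⟨t, h2, h3⟩ := h1
  have hex : (ShortComplex.mk c.s (cokernel.π c.s) (by simp)).Exact := ShortComplex.exact_cokernel _
  have hκ : Mono P.κ := by rw [← c.xs]; infer_instance
  have hc := pullback.condition (f := t) (g := cokernel.π c.s)
  -- The null-homotopy `t : W⁰ ⟶ E / S` of the composite to the cokernel pulls back the extension `S
  -- ⟶ E ⟶ E / S`. As `S` is `X⁻¹`, the result is an extension of `W⁰` by `X⁻¹`, the central object
  -- of the lift.
  let G : Butterfly W X :=
    { E := pullback t (cokernel.π c.s)
      κ := pullback.lift W.d (q ≫ P.ι) (by simp [h2])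
      ι := pullback.lift 0 P.κ (by simp)
      σ := pullback.fst _ _
      ρ := pullback.snd _ _ ≫ P.σ
      κσ := by simp
      ιρ := by simp
      κρ := by simp
      ισ := by simp
      exact := by
        refine ShortComplex.ShortExact.mk' ?_ ?_ ?_
        · rw [ShortComplex.exact_iff_exact_up_to_refinements]
          intro V x hx
          dsimp at x hx
          have h4 : (x ≫ pullback.snd _ _) ≫ cokernel.π c.s = 0 := by
            rw [Category.assoc, ← hc, reassoc_of% hx, zero_comp]
          obtain ⟨V', π, hπ, z, hz⟩ := hex.exact_up_to_refinements _ h4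
          dsimp at z hz
          refine ⟨V', π, hπ, z ≫ inv c.x, ?_⟩
          apply pullback.hom_ext
          · simp [hx]
          · have : inv c.x ≫ P.κ = c.s := by rw [IsIso.inv_comp_eq, c.xs]
            simp [hz, this]
        · have : Mono (pullback.lift 0 P.κ (by simp) ≫ pullback.snd t (cokernel.π c.s)) := by
            rw [pullback.lift_snd]; infer_instance
          exact mono_of_mono _ (pullback.snd t (cokernel.π c.s))
        · dsimp; infer_instance }
  refine ⟨inv (ofStrict p p' wp) ≫ ofButterfly G, ?_⟩
  rw [Category.assoc, IsIso.inv_comp_eq, hq]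
  refine comp_eq_ofStrict_of_map G P q q' wq (pullback.snd _ _) ?_ ?_ rfl ?_
  · simp [G]
  · simp [G]
  · dsimp [G]
    simp only [Category.comp_id] at h3
    rw [← h3, reassoc_of% hc]; simp

/-- If the cokernel of `P` vanishes then `P` is a cokernel of its kernel. -/
lemma exists_desc_of_isIso {T F : ObjectProperty A} {P : Butterfly X Y} (c : P.Cut T F)
    [IsIso c.cokerObj.d] (u : X ⟶ Z) (hu : c.kerι ≫ u = 0) : ∃ v, ofButterfly P ≫ v = u := by
  obtain ⟨W, p, p', wp, q, q', wq, hp, hq⟩ := exists_strict_target u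
  have := hp.isIso
  have h1 : c.kerι ≫ ofStrict q q' wq = 0 := by rw [← hq, reassoc_of% hu, zero_comp]
  rw [ofStrict_comp (X := c.kerObj), ofStrict_eq_zero_iff] at h1
  obtain ⟨t, h2, h3⟩ := h1
  dsimp at t h2 h3
  simp only [Category.id_comp] at h2
  have hex : (ShortComplex.mk c.s (cokernel.π c.s) (by simp)).Exact := ShortComplex.exact_cokernel _
  have hρ : Epi P.ρ := by
    have : cokernel.π c.s ≫ c.cokerObj.d = P.ρ := by simp
    rw [← this]; infer_instance
  have hc := pushout.condition (f := c.s) (g := t)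
  -- The null-homotopy `t : S ⟶ W⁻¹` of the composite from the kernel pushes out the extension `S ⟶
  -- E ⟶ E / S`. As `E / S` is `Y⁰`, the result is an extension of `Y⁰` by `W⁻¹`.
  let G : Butterfly Y W :=
    { E := pushout c.s t
      κ := P.ι ≫ pushout.inl _ _
      ι := pushout.inr _ _
      σ := pushout.desc P.ρ 0 (by simp)
      ρ := pushout.desc (P.σ ≫ q') W.d (by simp [h3])
      κσ := by simp
      ιρ := by simp
      κρ := by simp
      ισ := by simp
      exact := by
        have hepi : Epi (pushout.desc P.ρ 0 (by simp) : pushout c.s t ⟶ Y.zer) := by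
          have : Epi (pushout.inl c.s t ≫ pushout.desc P.ρ 0 (by simp)) := by
            rw [pushout.inl_desc]; infer_instance
          exact epi_of_epi (pushout.inl c.s t) _
        refine ShortComplex.ShortExact.mk' ?_ ?_ hepi
        · refine ShortComplex.exact_of_g_is_cokernel _ (CokernelCofork.IsColimit.ofπ' _ _ ?_)
          intro V k hk
          refine ⟨inv c.cokerObj.d ≫ cokernel.desc c.s (pushout.inl _ _ ≫ k)
            (by rw [reassoc_of% hc, hk, comp_zero]), ?_⟩
          apply pushout.hom_ext
          · have : P.ρ ≫ inv c.cokerObj.d = cokernel.π c.s := by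
              rw [IsIso.comp_inv_eq]; simp
            dsimp at this ⊢
            rw [pushout.inl_desc_assoc, reassoc_of% this]
            simp
          · simpa using hk.symm
        · dsimp; infer_instance }
  refine ⟨ofButterfly G ≫ inv (ofStrict p p' wp), ?_⟩
  rw [← Category.assoc, IsIso.comp_inv_eq, hq]
  refine comp_eq_ofStrict_of_map P G q q' wq (pushout.inl _ _) ?_ rfl ?_ ?_
  · dsimp [G]
    rw [← h2, ← c.xs, Category.assoc, hc, Category.assoc]
  · simp [G]
  · simp [G]

end

end TwoTerm
end

/-! ### Direct sums and the abelian structure of the tilt -/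

noncomputable section

namespace TwoTerm

open scoped ZeroObject

variable {A : Type u} [Category.{v} A] [Abelian A]

attribute [local instance] hasZeroMorphisms

section biprod

variable {X Y Z : TwoTerm A}

/-- The termwise direct sum of two-term complexes. -/
abbrev sum (X Y : TwoTerm A) : TwoTerm A := ⟨X.neg ⊞ Y.neg, X.zer ⊞ Y.zer, biprod.map X.d Y.d⟩

/-- The first projection. -/
abbrev sumFst (X Y : TwoTerm A) : sum X Y ⟶ X :=
  ofStrict (X := sum X Y) (biprod.fst : X.neg ⊞ Y.neg ⟶ _) biprod.fst (by simp)

/-- The second projection. -/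
abbrev sumSnd (X Y : TwoTerm A) : sum X Y ⟶ Y :=
  ofStrict (X := sum X Y) (biprod.snd : X.neg ⊞ Y.neg ⟶ _) biprod.snd (by simp)

/-- The first inclusion. -/
abbrev sumInl (X Y : TwoTerm A) : X ⟶ sum X Y :=
  ofStrict (Y := sum X Y) (biprod.inl : _ ⟶ X.neg ⊞ Y.neg) biprod.inl (by simp)

/-- The second inclusion. -/
abbrev sumInr (X Y : TwoTerm A) : Y ⟶ sum X Y :=
  ofStrict (Y := sum X Y) (biprod.inr : _ ⟶ X.neg ⊞ Y.neg) biprod.inr (by simp)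

/-- Once both morphisms are strict, the two hypotheses are homotopies, and these are the components
of a homotopy into the sum. -/
lemma sum_hom_ext {u v : Z ⟶ sum X Y} (h1 : u ≫ sumFst X Y = v ≫ sumFst X Y)
    (h2 : u ≫ sumSnd X Y = v ≫ sumSnd X Y) : u = v := by
  obtain ⟨W, p, p', wp, q, q', wq, r, r', wr, hp, hq, hr⟩ := exists_strict_source₂ u v
  have := hp.isIso
  rw [← cancel_epi (ofStrict p p' wp), hq, hr]
  rw [← cancel_epi (ofStrict p p' wp), ← Category.assoc, ← Category.assoc, hq, hr,
    ofStrict_comp, ofStrict_comp, ofStrict_eq_iff] at h1 h2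
  obtain ⟨s, h3, h4⟩ := h1
  obtain ⟨t, h5, h6⟩ := h2
  rw [ofStrict_eq_iff]
  refine ⟨biprod.lift s t, ?_, ?_⟩ <;> apply biprod.hom_ext <;> simp [h3, h4, h5, h6]

lemma sum_hom_ext' {u v : sum X Y ⟶ Z} (h1 : sumInl X Y ≫ u = sumInl X Y ≫ v)
    (h2 : sumInr X Y ≫ u = sumInr X Y ≫ v) : u = v := by
  obtain ⟨W, p, p', wp, q, q', wq, r, r', wr, hp, hq, hr⟩ := exists_strict_target₂ u v
  have := hp.isIso
  rw [← cancel_mono (ofStrict p p' wp), hq, hr]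
  rw [← cancel_mono (ofStrict p p' wp), Category.assoc, Category.assoc, hq, hr,
    ofStrict_comp, ofStrict_comp, ofStrict_eq_iff] at h1 h2
  obtain ⟨s, h3, h4⟩ := h1
  obtain ⟨t, h5, h6⟩ := h2
  rw [ofStrict_eq_iff]
  refine ⟨biprod.desc s t, ?_, ?_⟩ <;> apply biprod.hom_ext' <;> simp [h3, h4, h5, h6]

lemma sum_lift (u : Z ⟶ X) (v : Z ⟶ Y) : ∃ w, w ≫ sumFst X Y = u ∧ w ≫ sumSnd X Y = v := by
  obtain ⟨W, p, p', wp, q, q', wq, r, r', wr, hp, hq, hr⟩ := exists_strict_source₂ u v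
  have := hp.isIso
  refine ⟨inv (ofStrict p p' wp) ≫ ofStrict (Y := sum X Y) (biprod.lift q r) (biprod.lift q' r')
    (by apply biprod.hom_ext <;> simp [wq, wr]), ?_, ?_⟩
  · rw [Category.assoc, IsIso.inv_comp_eq, hq, ofStrict_comp]
    exact ofStrict_congr (by simp) (by simp) _
  · rw [Category.assoc, IsIso.inv_comp_eq, hr, ofStrict_comp]
    exact ofStrict_congr (by simp) (by simp) _

lemma sum_desc (u : X ⟶ Z) (v : Y ⟶ Z) : ∃ w, sumInl X Y ≫ w = u ∧ sumInr X Y ≫ w = v := by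
  obtain ⟨W, p, p', wp, q, q', wq, r, r', wr, hp, hq, hr⟩ := exists_strict_target₂ u v
  have := hp.isIso
  refine ⟨ofStrict (X := sum X Y) (biprod.desc q r) (biprod.desc q' r')
    (by apply biprod.hom_ext' <;> simp [wq, wr]) ≫ inv (ofStrict p p' wp), ?_, ?_⟩
  · rw [← Category.assoc, IsIso.comp_inv_eq, hq, ofStrict_comp]
    exact ofStrict_congr (by simp) (by simp) _
  · rw [← Category.assoc, IsIso.comp_inv_eq, hr, ofStrict_comp]
    exact ofStrict_congr (by simp) (by simp) _

lemma sum_tilt {T F : ObjectProperty A} (h : IsTorsionPair T F) (hX : tiltProperty T F X)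
    (hY : tiltProperty T F Y) : tiltProperty T F (sum X Y) := by
  constructor
  · refine h.F_of_hom_eq_zero fun V hV f => ?_
    have h1 : kernel.ι (biprod.map X.d Y.d) ≫ biprod.fst ≫ X.d = 0 := by
      rw [← biprod.map_fst X.d Y.d, kernel.condition_assoc, zero_comp]
    have h2 : kernel.ι (biprod.map X.d Y.d) ≫ biprod.snd ≫ Y.d = 0 := by
      rw [← biprod.map_snd X.d Y.d, kernel.condition_assoc, zero_comp]
    rw [← cancel_mono (kernel.ι _), zero_comp]
    apply biprod.hom_ext
    · rw [← kernel.lift_ι X.d ((f ≫ kernel.ι _) ≫ biprod.fst) (by simp [h1]),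
        h.hom_eq_zero hV hX.1 (kernel.lift X.d _ _)]
      simp
    · rw [← kernel.lift_ι Y.d ((f ≫ kernel.ι _) ≫ biprod.snd) (by simp [h2]),
        h.hom_eq_zero hV hY.1 (kernel.lift Y.d _ _)]
      simp
  · refine h.T_of_hom_eq_zero fun V hV f => ?_
    have h1 : X.d ≫ biprod.inl ≫ cokernel.π (biprod.map X.d Y.d) = 0 := by
      rw [← biprod.inl_map_assoc X.d Y.d, cokernel.condition, comp_zero]
    have h2 : Y.d ≫ biprod.inr ≫ cokernel.π (biprod.map X.d Y.d) = 0 := by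
      rw [← biprod.inr_map_assoc X.d Y.d, cokernel.condition, comp_zero]
    rw [← cancel_epi (cokernel.π _), comp_zero]
    apply biprod.hom_ext'
    · rw [← cokernel.π_desc X.d (biprod.inl ≫ (cokernel.π _ ≫ f)) (by simp [reassoc_of% h1]),
        h.hom_eq_zero hX.2 hV (cokernel.desc X.d _ _)]
      simp
    · rw [← cokernel.π_desc Y.d (biprod.inr ≫ (cokernel.π _ ≫ f)) (by simp [reassoc_of% h2]),
        h.hom_eq_zero hY.2 hV (cokernel.desc Y.d _ _)]
      simp

end biprod

end TwoTerm

namespace HRSTilt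

open TwoTerm

variable {A : Type u} [Category.{v} A] [Abelian A] {T F : ObjectProperty A}

section

open scoped ZeroObject

attribute [local instance] hasZeroMorphisms

lemma exists_cut (h : IsTorsionPair T F) {X Y : HRSTilt T F} (f : X ⟶ Y) :
    ∃ (P : Butterfly X.obj Y.obj) (_ : P.Cut T F), f = ObjectProperty.homMk (ofButterfly P) := by
  obtain ⟨P, hP⟩ := ofButterfly_surjective f.hom
  exact ⟨P, (Butterfly.Cut.nonempty h P).some, ObjectProperty.hom_ext _ hP⟩

/-- Zero morphisms are unique when they exist, so the explicit zero butterflies agree with the zeros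
of whichever additive structure is put on the tilt. -/
lemma hom_zero [inst : HasZeroMorphisms (HRSTilt T F)] (X Y : HRSTilt T F) :
    (0 : X ⟶ Y).hom = 0 := by
  have : inst = ObjectProperty.instHasZeroMorphismsFullSubcategory _ := Subsingleton.elim _ _
  subst this
  rfl

lemma hom_eq_zero [HasZeroMorphisms (HRSTilt T F)] {X Y : HRSTilt T F} {f : X ⟶ Y} (hf : f = 0) :
    f.hom = 0 := by
  rw [hf, hom_zero]

lemma eq_zero_of_hom [HasZeroMorphisms (HRSTilt T F)] {X Y : HRSTilt T F} {f : X ⟶ Y}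
    (hf : f.hom = 0) : f = 0 :=
  ObjectProperty.hom_ext _ (by rw [hf, hom_zero])

section

variable (h : IsTorsionPair T F) {X Y : HRSTilt T F} {P : Butterfly X.obj Y.obj} (c : P.Cut T F)

/-- The kernel of a morphism of the tilt. -/
abbrev ker : HRSTilt T F := ⟨c.kerObj, c.kerObj_tilt h X.property⟩

/-- The cokernel of a morphism of the tilt. -/
abbrev coker : HRSTilt T F := ⟨c.cokerObj, c.cokerObj_tilt h Y.property⟩

/-- The inclusion of the kernel. -/
abbrev kerι : ker h c ⟶ X := ObjectProperty.homMk c.kerι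

/-- The projection to the cokernel. -/
abbrev cokerπ : Y ⟶ coker h c := ObjectProperty.homMk c.cokerπ

instance mono_kerι : Mono (kerι h c) :=
  ⟨fun u v huv => ObjectProperty.hom_ext _ (c.ker_hom_ext h Y.property (ObjectProperty.FullSubcategory.property _)
    u.hom v.hom congr(($huv).hom))⟩

instance epi_cokerπ : Epi (cokerπ h c) :=
  ⟨fun u v huv => ObjectProperty.hom_ext _ (c.coker_hom_ext h X.property
    (ObjectProperty.FullSubcategory.property _) u.hom v.hom congr(($huv).hom))⟩

variable [HasZeroMorphisms (HRSTilt T F)]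

lemma kerι_comp : kerι h c ≫ ObjectProperty.homMk (ofButterfly P) = 0 :=
  eq_zero_of_hom c.kerι_comp

lemma comp_cokerπ : ObjectProperty.homMk (ofButterfly P) ≫ cokerπ h c = 0 :=
  eq_zero_of_hom c.comp_cokerπ

/-- `kerι` is a kernel. -/
def isLimitKer : IsLimit (KernelFork.ofι (kerι h c) (kerι_comp h c)) :=
  KernelFork.IsLimit.ofι' _ _ fun {W} k hk =>
    have H := c.ker_lift h W.property k.hom (hom_eq_zero hk)
    ⟨ObjectProperty.homMk H.choose, ObjectProperty.hom_ext _ H.choose_spec⟩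

/-- `cokerπ` is a cokernel. -/
def isColimitCoker : IsColimit (CokernelCofork.ofπ (cokerπ h c) (comp_cokerπ h c)) :=
  CokernelCofork.IsColimit.ofπ' _ _ fun {W} k hk =>
    have H := c.coker_desc h W.property k.hom (hom_eq_zero hk)
    ⟨ObjectProperty.homMk H.choose, ObjectProperty.hom_ext _ H.choose_spec⟩

/-- The kernel `[X⁻¹ ⟶ S]` is a zero object, so its identity is null-homotopic; the homotopy is an
inverse of `x`. -/
lemma isIso_x_of_mono (h : IsTorsionPair T F) {X Y : HRSTilt T F} {P : Butterfly X.obj Y.obj}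
    (c : P.Cut T F) [Mono (ObjectProperty.homMk (ofButterfly P) : X ⟶ Y)] : IsIso c.x := by
  have h1 : kerι h c = 0 := zero_of_comp_mono _ (kerι_comp h c)
  have h2 : 𝟙 (ker h c) = 0 := by rw [← cancel_mono (kerι h c), h1]; simp
  have h3 : ofStrict (X := c.kerObj) (Y := c.kerObj) (𝟙 _) (𝟙 _) (by simp) = 0 := hom_eq_zero h2
  obtain ⟨t, h4, h5⟩ := (ofStrict_eq_zero_iff _ _ _).1 h3
  exact ⟨t, h4, h5⟩

/-- The identity of the cokernel is null-homotopic, and the homotopy inverts its differential. -/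
lemma isIso_d_of_epi (h : IsTorsionPair T F) {X Y : HRSTilt T F} {P : Butterfly X.obj Y.obj}
    (c : P.Cut T F) [Epi (ObjectProperty.homMk (ofButterfly P) : X ⟶ Y)] :
    IsIso c.cokerObj.d := by
  have h1 : cokerπ h c = 0 := zero_of_epi_comp _ (comp_cokerπ h c)
  have h2 : 𝟙 (coker h c) = 0 := by rw [← cancel_epi (cokerπ h c), h1]; simp
  have h3 : ofStrict (X := c.cokerObj) (Y := c.cokerObj) (𝟙 _) (𝟙 _) (by simp) = 0 :=
    hom_eq_zero h2
  obtain ⟨t, h4, h5⟩ := (ofStrict_eq_zero_iff _ _ _).1 h3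
  exact ⟨t, h4, h5⟩

end

/-- The tilt with respect to a torsion pair is an abelian category. -/
lemma nonempty_nonPreadditiveAbelian (h : IsTorsionPair T F) :
    Nonempty (NonPreadditiveAbelian (HRSTilt T F)) := by
  have hk : HasKernels (HRSTilt T F) := ⟨fun {X Y} f => by
    obtain ⟨P, c, rfl⟩ := exists_cut h f
    exact ⟨⟨⟨_, isLimitKer h c⟩⟩⟩⟩
  have hc : HasCokernels (HRSTilt T F) := ⟨fun {X Y} f => by
    obtain ⟨P, c, rfl⟩ := exists_cut h f
    exact ⟨⟨⟨_, isColimitCoker h c⟩⟩⟩⟩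
  have hmono : IsNormalMonoCategory (HRSTilt T F) := ⟨fun {X Y} f hf => by
    obtain ⟨P, c, rfl⟩ := exists_cut h f
    have := isIso_x_of_mono h c
    exact ⟨⟨_, cokerπ h c, comp_cokerπ h c, KernelFork.IsLimit.ofι' _ _ fun {W} k hk =>
      have H := exists_lift_of_isIso c k.hom (hom_eq_zero hk)
      ⟨ObjectProperty.homMk H.choose, ObjectProperty.hom_ext _ H.choose_spec⟩⟩⟩⟩
  have hepi : IsNormalEpiCategory (HRSTilt T F) := ⟨fun {X Y} f hf => by
    obtain ⟨P, c, rfl⟩ := exists_cut h f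
    have := isIso_d_of_epi h c
    exact ⟨⟨_, kerι h c, kerι_comp h c, CokernelCofork.IsColimit.ofπ' _ _ fun {W} k hk =>
      have H := exists_desc_of_isIso c k.hom (hom_eq_zero hk)
      ⟨ObjectProperty.homMk H.choose, ObjectProperty.hom_ext _ H.choose_spec⟩⟩⟩⟩
  let O : HRSTilt T F := ⟨⟨0, 0, 0⟩, h.F_of_isZero ((isZero_zero A).of_mono (kernel.ι _)),
    h.T_of_isZero ((isZero_zero A).of_epi (cokernel.π _))⟩
  have hO : IsZero O := (IsZero.iff_id_eq_zero _).2 (ObjectProperty.hom_ext _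
    (ofStrict_congr (X := O.obj) (Y := O.obj) ((isZero_zero A).eq_of_src _ _)
      ((isZero_zero A).eq_of_src _ _) _))
  have hO' : HasZeroObject (HRSTilt T F) := ⟨O, hO⟩
  let S (X Y : HRSTilt T F) : HRSTilt T F := ⟨sum X.obj Y.obj, sum_tilt h X.property Y.property⟩
  have hprod : HasBinaryProducts (HRSTilt T F) := by
    have (X Y : HRSTilt T F) : HasLimit (pair X Y) := ⟨⟨⟨BinaryFan.mk
      (ObjectProperty.homMk (sumFst X.obj Y.obj) : S X Y ⟶ X)
      (ObjectProperty.homMk (sumSnd X.obj Y.obj) : S X Y ⟶ Y), BinaryFan.IsLimit.mk _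
        (fun f g => ObjectProperty.homMk (sum_lift f.hom g.hom).choose)
        (fun f g => ObjectProperty.hom_ext _ (sum_lift f.hom g.hom).choose_spec.1)
        (fun f g => ObjectProperty.hom_ext _ (sum_lift f.hom g.hom).choose_spec.2)
        (fun f g m h1 h2 => ObjectProperty.hom_ext _ (sum_hom_ext
          (congr(($h1).hom).trans (sum_lift f.hom g.hom).choose_spec.1.symm)
          (congr(($h2).hom).trans (sum_lift f.hom g.hom).choose_spec.2.symm)))⟩⟩⟩
    exact hasBinaryProducts_of_hasLimit_pair _
  have hcoprod : HasBinaryCoproducts (HRSTilt T F) := by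
    have (X Y : HRSTilt T F) : HasColimit (pair X Y) := ⟨⟨⟨BinaryCofan.mk
      (ObjectProperty.homMk (sumInl X.obj Y.obj) : X ⟶ S X Y)
      (ObjectProperty.homMk (sumInr X.obj Y.obj) : Y ⟶ S X Y), BinaryCofan.IsColimit.mk _
        (fun f g => ObjectProperty.homMk (sum_desc f.hom g.hom).choose)
        (fun f g => ObjectProperty.hom_ext _ (sum_desc f.hom g.hom).choose_spec.1)
        (fun f g => ObjectProperty.hom_ext _ (sum_desc f.hom g.hom).choose_spec.2)
        (fun f g m h1 h2 => ObjectProperty.hom_ext _ (sum_hom_ext'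
          (congr(($h1).hom).trans (sum_desc f.hom g.hom).choose_spec.1.symm)
          (congr(($h2).hom).trans (sum_desc f.hom g.hom).choose_spec.2.symm)))⟩⟩⟩
    exact hasBinaryCoproducts_of_hasColimit_pair _
  have : HasFiniteProducts (HRSTilt T F) := hasFiniteProducts_of_has_binary_and_terminal
  have : HasFiniteCoproducts (HRSTilt T F) := hasFiniteCoproducts_of_has_binary_and_initial
  -- Butterflies are never added by hand: the group structure on morphisms is recovered from
  -- kernels, cokernels, products and normality.
  exact ⟨{ }⟩

end

/-- The abelian structure on the tilt with respect to a torsion pair. -/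
@[reducible]
def abelian (h : IsTorsionPair T F) : Abelian (HRSTilt T F) :=
  letI := (nonempty_nonPreadditiveAbelian h).some
  { NonPreadditiveAbelian.preadditive with
    normalMonoOfMono := IsNormalMonoCategory.normalMonoOfMono
    normalEpiOfEpi := IsNormalEpiCategory.normalEpiOfEpi }

end HRSTilt

end

/-! ### The torsion pair `(F[1], T)` and the objects of the iterated tilt -/

noncomputable section

namespace TwoTerm

open scoped ZeroObject

variable {A : Type u} [Category.{v} A] [Abelian A]

attribute [local instance] hasZeroMorphisms

attribute [local simp] pullback.lift_fst pullback.lift_snd pullback.lift_fst_assoc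
  pullback.lift_snd_assoc

/-- An object in degree `-1`. -/
abbrev negObj (Y : A) : TwoTerm A := ⟨Y, 0, 0⟩

/-- An object in degree `0`. -/
abbrev zerObj (Y : A) : TwoTerm A := ⟨0, Y, 0⟩

/-- The inclusion of the kernel of the differential. -/
abbrev negι (X : TwoTerm A) : negObj (kernel X.d) ⟶ X :=
  ofStrict (X := negObj (kernel X.d)) (kernel.ι X.d) 0 (by simp)

/-- The projection to the cokernel of the differential. -/
abbrev zerπ (X : TwoTerm A) : X ⟶ zerObj (cokernel X.d) :=
  ofStrict (Y := zerObj (cokernel X.d)) 0 (cokernel.π X.d) (by simp)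

/-- In a butterfly `Q` for the inverse, `σ` lands in `0`, so `ι` is invertible, and `-κ ≫ ι⁻¹`
inverts `g`. The sign is the one in the `κ` of a strict butterfly. -/
lemma isIso_of_isIso_neg {Y Y' : A} (g : Y ⟶ Y')
    (hg : IsIso (ofStrict (X := negObj Y) (Y := negObj Y') g 0 (by simp))) : IsIso g := by
  obtain ⟨Q, hQ⟩ := ofButterfly_surjective
    (inv (ofStrict (X := negObj Y) (Y := negObj Y') g 0 _))
  have h1 := IsIso.hom_inv_id (ofStrict (X := negObj Y) (Y := negObj Y') g 0 _)
  have h2 := IsIso.inv_hom_id (ofStrict (X := negObj Y) (Y := negObj Y') g 0 _)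
  rw [hQ] at h1 h2
  obtain ⟨φ, h3, -, -⟩ := (strict_comp_eq_iff _ _ _ _ _ _ _).1 h1
  obtain ⟨ψ, h4, h5, -⟩ := (comp_strict_eq_iff _ _ _ _ _ _ _).1 h2
  have : Epi Q.ι := Q.exact.exact.epi_f ((isZero_zero A).eq_of_tgt _ _)
  have : IsIso Q.ι := isIso_of_mono_of_epi _
  simp only [zero_comp, Category.id_comp] at h3
  refine ⟨-(Q.κ ≫ inv Q.ι), ?_, ?_⟩
  · rw [Preadditive.comp_neg, ← Category.assoc,
      eq_neg_of_add_eq_zero_left h3.symm]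
    simp
  · have : inv Q.ι ≫ g = ψ := by rw [IsIso.inv_comp_eq, h4]
    simp [this, h5]

/-- Here `Q.ι` starts at `0`, so `Q.σ` is invertible and `σ⁻¹ ≫ ρ` is the inverse of `g`. -/
lemma isIso_of_isIso_zer {Y Y' : A} (g : Y ⟶ Y')
    (hg : IsIso (ofStrict (X := zerObj Y) (Y := zerObj Y') 0 g (by simp))) : IsIso g := by
  obtain ⟨Q, hQ⟩ := ofButterfly_surjective
    (inv (ofStrict (X := zerObj Y) (Y := zerObj Y') 0 g _))
  have h1 := IsIso.hom_inv_id (ofStrict (X := zerObj Y) (Y := zerObj Y') 0 g _)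
  have h2 := IsIso.inv_hom_id (ofStrict (X := zerObj Y) (Y := zerObj Y') 0 g _)
  rw [hQ] at h1 h2
  obtain ⟨φ, -, h3, h4⟩ := (strict_comp_eq_iff _ _ _ _ _ _ _).1 h1
  obtain ⟨ψ, -, -, h5⟩ := (comp_strict_eq_iff _ _ _ _ _ _ _).1 h2
  have : Mono Q.σ := Q.exact.exact.mono_g ((isZero_zero A).eq_of_src _ _)
  have : IsIso Q.σ := isIso_of_mono_of_epi _
  refine ⟨inv Q.σ ≫ Q.ρ, ?_, ?_⟩
  · rw [← h3]; simpa using h4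
  · rw [Category.assoc, IsIso.inv_comp_eq, h5]; simp

/-- The central object of such a butterfly is an extension of `0` by `0`. -/
lemma neg_zer_eq_zero {Y Z : A} (f : negObj Y ⟶ zerObj Z) : f = 0 := by
  obtain ⟨P, rfl⟩ := ofButterfly_surjective f
  have hE : IsZero P.E := by
    rw [IsZero.iff_id_eq_zero]
    have h1 : P.σ = 0 := (isZero_zero A).eq_of_tgt _ _
    have h2 : P.ι = 0 := (isZero_zero A).eq_of_src _ _
    have : Mono P.σ := P.exact.exact.mono_g h2
    rw [← cancel_mono P.σ, h1]; simp
  rw [ofButterfly, ← ofStrict_zero]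
  exact Quotient.sound (Butterfly.isomorphic_of_hom 0 ((Butterfly.strict_hom_ext _ _ _)
    ((isZero_zero A).eq_of_tgt _ _) ((isZero_zero A).eq_of_tgt _ _))
    ((isZero_zero A).eq_of_src _ _) (hE.eq_of_src _ _) (hE.eq_of_src _ _))

/-- The degree `0` terms of the target vanish, so a homotopy of the composites into `X` is killed by
`X.d` and lifts to `ker X.d`. -/
lemma negι_hom_ext {W X : TwoTerm A} (u v : W ⟶ negObj (kernel X.d))
    (huv : u ≫ negι X = v ≫ negι X) : u = v := by
  obtain ⟨Z, p, p', wp, q, q', wq, r, r', wr, hp, hq, hr⟩ := exists_strict_source₂ u v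
  have := hp.isIso
  rw [← cancel_epi (ofStrict p p' wp), hq, hr]
  rw [← cancel_epi (ofStrict p p' wp), ← Category.assoc, ← Category.assoc, hq, hr,
    ofStrict_comp, ofStrict_comp, ofStrict_eq_iff] at huv
  obtain ⟨t, h1, h2⟩ := huv
  rw [ofStrict_eq_iff]
  refine ⟨kernel.lift X.d t (by simp [h2]), ?_, (isZero_zero A).eq_of_tgt _ _⟩
  rw [← cancel_mono (kernel.ι X.d)]
  simp [h1]

lemma zerπ_hom_ext {W X : TwoTerm A} (u v : zerObj (cokernel X.d) ⟶ W)
    (huv : zerπ X ≫ u = zerπ X ≫ v) : u = v := by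
  obtain ⟨Z, p, p', wp, q, q', wq, r, r', wr, hp, hq, hr⟩ := exists_strict_target₂ u v
  have := hp.isIso
  rw [← cancel_mono (ofStrict p p' wp), hq, hr]
  rw [← cancel_mono (ofStrict p p' wp), Category.assoc, Category.assoc, hq, hr,
    ofStrict_comp, ofStrict_comp, ofStrict_eq_iff] at huv
  obtain ⟨t, h1, h2⟩ := huv
  rw [ofStrict_eq_iff]
  refine ⟨cokernel.desc X.d t (by simp [h1]), (isZero_zero A).eq_of_src _ _, ?_⟩
  rw [← cancel_epi (cokernel.π X.d)]
  simp [h2]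

lemma negι_zerπ (X : TwoTerm A) : negι X ≫ zerπ X = 0 := neg_zer_eq_zero _

lemma negι_lift {W X : TwoTerm A} (u : W ⟶ X) (hu : u ≫ zerπ X = 0) : ∃ v, v ≫ negι X = u := by
  obtain ⟨Z, p, p', wp, q, q', wq, hp, hq⟩ := exists_strict_source u
  have := hp.isIso
  have h1 : ofStrict q q' wq ≫ zerπ X = 0 := by rw [← hq, Category.assoc, hu, comp_zero]
  rw [ofStrict_comp, ofStrict_eq_zero_iff] at h1
  obtain ⟨t, -, h3⟩ := h1
  rw [comp_zero] at h3
  have hex : (ShortComplex.mk X.d (cokernel.π X.d) (by simp)).Exact := ShortComplex.exact_cokernel _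
  have hc := pullback.condition (f := q') (g := X.d)
  -- Since `q'` dies in `coker X.d`, it locally factors through `X.d`. Hence the fibre product of
  -- `q'` and `X.d` is an extension of `Z⁰` by `ker X.d`.
  let G : Butterfly Z (negObj (kernel X.d)) :=
    { E := pullback q' X.d
      κ := pullback.lift Z.d q (by simp [wq])
      ι := pullback.lift 0 (-kernel.ι X.d) (by simp)
      σ := pullback.fst _ _
      ρ := 0
      κσ := by simp
      ιρ := by simp
      κρ := by simp
      ισ := by simp
      exact := by
        have hepi : Epi (pullback.fst q' X.d) := by
          rw [epi_iff_surjective_up_to_refinements]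
          intro V y
          obtain ⟨V', π, hπ, z, hz⟩ := hex.exact_up_to_refinements (y ≫ q')
            (by dsimp; rw [Category.assoc, ← h3, comp_zero])
          exact ⟨V', π, hπ, pullback.lift (π ≫ y) z (by simpa using hz), by simp⟩
        refine ShortComplex.ShortExact.mk' ?_ ?_ hepi
        · rw [ShortComplex.exact_iff_exact_up_to_refinements]
          intro V x hx
          dsimp at x hx
          refine ⟨V, 𝟙 V, inferInstance, -kernel.lift X.d (x ≫ pullback.snd _ _)
            (by rw [Category.assoc, ← hc, reassoc_of% hx, zero_comp]), ?_⟩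
          apply pullback.hom_ext <;> simp [hx]
        · have : Mono (pullback.lift 0 (-kernel.ι X.d) (by simp) ≫ pullback.snd q' X.d) := by
            rw [pullback.lift_snd]; infer_instance
          exact mono_of_mono _ (pullback.snd q' X.d) }
  refine ⟨inv (ofStrict p p' wp) ≫ ofButterfly G, ?_⟩
  rw [Category.assoc, IsIso.inv_comp_eq, hq, comp_strict_eq_iff]
  refine ⟨-pullback.snd _ _, ?_, ?_, ?_⟩
  · simp [G]
  · simp [G]
  · simp [G, hc]

section

variable {T F : ObjectProperty A}

lemma negObj_tilt (h : IsTorsionPair T F) {Y : A} (hY : F Y) : tiltProperty T F (negObj Y) :=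
  ⟨h.F_of_mono (kernel.ι _) hY, h.T_of_isZero ((isZero_zero A).of_epi (cokernel.π _))⟩

lemma zerObj_tilt (h : IsTorsionPair T F) {Y : A} (hY : T Y) : tiltProperty T F (zerObj Y) :=
  ⟨h.F_of_isZero ((isZero_zero A).of_mono (kernel.ι _)), h.T_of_epi (cokernel.π _) hY⟩

lemma isQis_zerπ (X : TwoTerm A) [Mono X.d] :
    IsQis (X := X) (Y := zerObj (cokernel X.d)) 0 (cokernel.π X.d) (by simp) := by
  rw [isQis_iff]
  refine ⟨fun V z h1 _ => zero_of_comp_mono _ h1, fun V x y h => ?_, fun V y => ?_⟩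
  · have hex : (ShortComplex.mk X.d (cokernel.π X.d) (by simp)).Exact :=
      ShortComplex.exact_cokernel _
    obtain ⟨V', π, hπ, z, hz⟩ := hex.exact_up_to_refinements x (by simpa using h)
    exact ⟨V', π, hπ, z, hz.symm, (isZero_zero A).eq_of_tgt _ _⟩
  · obtain ⟨V', π, hπ, x, hx⟩ := surjective_up_to_refinements_of_epi (cokernel.π X.d) y
    exact ⟨V', π, hπ, x, 0, by simpa using hx⟩

lemma isQis_negι (X : TwoTerm A) [Epi X.d] :
    IsQis (X := negObj (kernel X.d)) (Y := X) (kernel.ι X.d) 0 (by simp) := by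
  rw [isQis_iff]
  refine ⟨fun V z _ h1 => zero_of_comp_mono _ h1, fun V x y h => ?_, fun V y => ?_⟩
  · refine ⟨V, 𝟙 V, inferInstance, -kernel.lift X.d y (by simpa using h),
      (isZero_zero A).eq_of_tgt _ _, by simp⟩
  · obtain ⟨V', π, hπ, x, hx⟩ := surjective_up_to_refinements_of_epi X.d y
    exact ⟨V', π, hπ, 0, x, by simpa using hx⟩

/-- The map from `[ker d ⟶ 0]` to `X` vanishes, because there are no nonzero morphisms to `[0 ⟶ Y]`.
A null-homotopy of it starts at `0`, so `ker d ⟶ X⁻¹` is zero. -/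
lemma mono_d_of_iso {X : TwoTerm A} {Y : A} (e : X ≅ zerObj Y) : Mono X.d := by
  have h1 : negι X = 0 := by
    rw [← Category.comp_id (negι X), ← e.hom_inv_id, ← Category.assoc,
      neg_zer_eq_zero (negι X ≫ e.hom), zero_comp]
  obtain ⟨t, h2, -⟩ := (ofStrict_eq_zero_iff _ _ _).1 h1
  exact Preadditive.mono_of_kernel_zero (by rw [← h2, zero_comp])

lemma epi_d_of_iso {X : TwoTerm A} {Y : A} (e : X ≅ negObj Y) : Epi X.d := by
  have h1 : zerπ X = 0 := by
    rw [← Category.id_comp (zerπ X), ← e.hom_inv_id, Category.assoc,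
      neg_zer_eq_zero (e.inv ≫ zerπ X), comp_zero]
  obtain ⟨t, -, h2⟩ := (ofStrict_eq_zero_iff _ _ _).1 h1
  exact Preadditive.epi_of_cokernel_zero (by rw [← h2, comp_zero])

lemma epi_d_cokerObj_iff {X Y : TwoTerm A} {P : Butterfly X Y} (c : P.Cut T F) :
    Epi c.cokerObj.d ↔ Epi P.ρ := by
  have h : cokernel.π c.s ≫ c.cokerObj.d = P.ρ := by simp
  constructor
  · intro
    rw [← h]; infer_instance
  · intro hP
    rw [← h] at hP
    exact epi_of_epi (cokernel.π c.s) _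

lemma mono_x_iff {X Y : TwoTerm A} {P : Butterfly X Y} (c : P.Cut T F) :
    Mono c.x ↔ Mono P.κ := by
  constructor
  · intro
    rw [← c.xs]; infer_instance
  · intro hP
    rw [← c.xs] at hP
    exact mono_of_mono _ c.s

end

end TwoTerm

namespace HRSTilt

open TwoTerm

open scoped ZeroObject

variable {A : Type u} [Category.{v} A] [Abelian A] {T F : ObjectProperty A}

section additive

/-- In a preadditive category a sum is the composite of `(a, b)` with the codiagonal of a biproduct.
Both factors are strict, so every preadditive structure on the tilt adds strict morphisms termwise.
-/
lemma ofStrict_add [Preadditive (HRSTilt T F)] (h : IsTorsionPair T F) {X Y : HRSTilt T F}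
    (a b : X.obj.neg ⟶ Y.obj.neg) (a' b' : X.obj.zer ⟶ Y.obj.zer) (w : a ≫ Y.obj.d = X.obj.d ≫ a')
    (w' : b ≫ Y.obj.d = X.obj.d ≫ b') :
    (ObjectProperty.homMk (ofStrict (a + b) (a' + b') (by simp [w, w'])) : X ⟶ Y) =
      ObjectProperty.homMk (ofStrict a a' w) + ObjectProperty.homMk (ofStrict b b' w') := by
  let S : HRSTilt T F := ⟨sum Y.obj Y.obj, sum_tilt h Y.property Y.property⟩
  let i₁ : Y ⟶ S := ObjectProperty.homMk (sumInl _ _)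
  let i₂ : Y ⟶ S := ObjectProperty.homMk (sumInr _ _)
  let p₁ : S ⟶ Y := ObjectProperty.homMk (sumFst _ _)
  let p₂ : S ⟶ Y := ObjectProperty.homMk (sumSnd _ _)
  let m : S ⟶ Y := ObjectProperty.homMk (ofStrict (X := sum Y.obj Y.obj) (biprod.desc (𝟙 _) (𝟙 _))
    (biprod.desc (𝟙 _) (𝟙 _)) (by apply biprod.hom_ext' <;> simp))
  let l : X ⟶ S := ObjectProperty.homMk (ofStrict (Y := sum Y.obj Y.obj) (biprod.lift a b)
    (biprod.lift a' b') (by apply biprod.hom_ext <;> simp [w, w']))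
  let u : X ⟶ Y := ObjectProperty.homMk (ofStrict a a' w)
  let v : X ⟶ Y := ObjectProperty.homMk (ofStrict b b' w')
  have h11 : i₁ ≫ p₁ = 𝟙 Y := ObjectProperty.hom_ext _ ((ofStrict_comp _ _ _ _ _ _).trans
    (ofStrict_congr (by simp) (by simp) _))
  have h22 : i₂ ≫ p₂ = 𝟙 Y := ObjectProperty.hom_ext _ ((ofStrict_comp _ _ _ _ _ _).trans
    (ofStrict_congr (by simp) (by simp) _))
  have h12 : i₁ ≫ p₂ = 0 := eq_zero_of_hom ((ofStrict_comp _ _ _ _ _ _).trans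
    (ofStrict_congr (by simp) (by simp) _))
  have h21 : i₂ ≫ p₁ = 0 := eq_zero_of_hom ((ofStrict_comp _ _ _ _ _ _).trans
    (ofStrict_congr (by simp) (by simp) _))
  have h1m : i₁ ≫ m = 𝟙 Y := ObjectProperty.hom_ext _ ((ofStrict_comp _ _ _ _ _ _).trans
    (ofStrict_congr (by simp) (by simp) _))
  have h2m : i₂ ≫ m = 𝟙 Y := ObjectProperty.hom_ext _ ((ofStrict_comp _ _ _ _ _ _).trans
    (ofStrict_congr (by simp) (by simp) _))
  have hl1 : l ≫ p₁ = u := ObjectProperty.hom_ext _ ((ofStrict_comp _ _ _ _ _ _).trans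
    (ofStrict_congr (by simp) (by simp) _))
  have hl2 : l ≫ p₂ = v := ObjectProperty.hom_ext _ ((ofStrict_comp _ _ _ _ _ _).trans
    (ofStrict_congr (by simp) (by simp) _))
  have hlm : l ≫ m = ObjectProperty.homMk (ofStrict (a + b) (a' + b') (by simp [w, w'])) :=
    ObjectProperty.hom_ext _ ((ofStrict_comp _ _ _ _ _ _).trans
    (ofStrict_congr (by simp) (by simp) _))
  have hl : l = u ≫ i₁ + v ≫ i₂ := by
    apply ObjectProperty.hom_ext
    apply sum_hom_ext
    · have : l ≫ p₁ = (u ≫ i₁ + v ≫ i₂) ≫ p₁ := by simp [hl1, h11, h21]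
      exact congr(($this).hom)
    · have : l ≫ p₂ = (u ≫ i₁ + v ≫ i₂) ≫ p₂ := by simp [hl2, h12, h22]
      exact congr(($this).hom)
  rw [← hlm, hl]
  simp [h1m, h2m, u, v]

end additive

section torsion

lemma tiltTorsion_of_iso {X Y : HRSTilt T F} (e : X ≅ Y) (hX : tiltTorsion T F X) :
    tiltTorsion T F Y := by
  obtain ⟨Z, hZ, ⟨e'⟩⟩ := hX
  exact ⟨Z, hZ, ⟨((ObjectProperty.ι _).mapIso e).symm ≪≫ e'⟩⟩

lemma tiltFree_of_iso {X Y : HRSTilt T F} (e : X ≅ Y) (hX : tiltFree T F X) :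
    tiltFree T F Y := by
  obtain ⟨Z, hZ, ⟨e'⟩⟩ := hX
  exact ⟨Z, hZ, ⟨((ObjectProperty.ι _).mapIso e).symm ≪≫ e'⟩⟩

variable [Abelian (HRSTilt T F)]

/-- `(F[1], T)` is a torsion pair in the tilt. -/
theorem isTorsionPair (h : IsTorsionPair T F) :
    IsTorsionPair (tiltTorsion T F) (tiltFree T F) where
  isoT := ⟨fun e hX => tiltTorsion_of_iso e hX⟩
  isoF := ⟨fun e hX => tiltFree_of_iso e hX⟩
  hom_eq_zero := by
    rintro X Y ⟨X', -, ⟨e⟩⟩ ⟨Y', -, ⟨e'⟩⟩ f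
    apply eq_zero_of_hom
    let := hasZeroMorphisms (A := A)
    have := neg_zer_eq_zero (e.inv ≫ f.hom ≫ e'.hom)
    rwa [Iso.inv_comp_eq, comp_zero, ← Iso.eq_comp_inv, zero_comp] at this
  exists_shortExact := by
    intro X
    let N : HRSTilt T F := ⟨negObj (kernel X.obj.d), negObj_tilt h X.property.1⟩
    let Z : HRSTilt T F := ⟨zerObj (cokernel X.obj.d), zerObj_tilt h X.property.2⟩
    let i : N ⟶ X := ObjectProperty.homMk (negι X.obj)
    let p : X ⟶ Z := ObjectProperty.homMk (zerπ X.obj)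
    have hi : Mono i :=
      ⟨fun u v huv => ObjectProperty.hom_ext _ (negι_hom_ext u.hom v.hom congr(($huv).hom))⟩
    have hp : Epi p :=
      ⟨fun u v huv => ObjectProperty.hom_ext _ (zerπ_hom_ext u.hom v.hom congr(($huv).hom))⟩
    have w : i ≫ p = 0 := eq_zero_of_hom (negι_zerπ X.obj)
    refine ⟨N, Z, i, p, w, ShortComplex.ShortExact.mk' (ShortComplex.exact_of_f_is_kernel _
      (KernelFork.IsLimit.ofι' _ _ fun {W} k hk =>
        have H := negι_lift k.hom (hom_eq_zero hk)
        ⟨ObjectProperty.homMk H.choose, ObjectProperty.hom_ext _ H.choose_spec⟩)) hi hp,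
      ⟨_, X.property.1, ⟨Iso.refl _⟩⟩, ⟨_, X.property.2, ⟨Iso.refl _⟩⟩⟩

variable (h : IsTorsionPair T F) {X Y : HRSTilt T F} {P : Butterfly X.obj Y.obj} (c : P.Cut T F)

/-- The kernel of a morphism of the tilt, in terms of a butterfly. -/
def kernelIso : kernel (ObjectProperty.homMk (ofButterfly P) : X ⟶ Y) ≅ ker h c :=
  IsLimit.conePointUniqueUpToIso (kernelIsKernel _) (isLimitKer h c)

/-- The cokernel of a morphism of the tilt, in terms of a butterfly. -/
def cokernelIso : cokernel (ObjectProperty.homMk (ofButterfly P) : X ⟶ Y) ≅ coker h c :=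
  IsColimit.coconePointUniqueUpToIso (cokernelIsCokernel _) (isColimitCoker h c)

lemma kernelIso_hom_comp : (kernelIso h c).hom ≫ kerι h c = kernel.ι _ :=
  IsLimit.conePointUniqueUpToIso_hom_comp (kernelIsKernel _) (isLimitKer h c)
    WalkingParallelPair.zero

lemma comp_cokernelIso_hom : cokernel.π _ ≫ (cokernelIso h c).hom = cokerπ h c :=
  IsColimit.comp_coconePointUniqueUpToIso_hom (cokernelIsCokernel _) (isColimitCoker h c)
    WalkingParallelPair.one

/-- The objects of the iterated tilt are the butterflies with `κ` mono and `ρ` epi. -/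
theorem tiltProperty_iff (h : IsTorsionPair T F) {X Y : HRSTilt T F} {P : Butterfly X.obj Y.obj} :
    tiltProperty (tiltTorsion T F) (tiltFree T F)
      ⟨X, Y, ObjectProperty.homMk (ofButterfly P)⟩ ↔ Mono P.κ ∧ Epi P.ρ := by
  have c := (Butterfly.Cut.nonempty h P).some
  -- The kernel `[X⁻¹ ⟶ S]` is concentrated in degree `0` exactly when `x` is mono, and the cokernel
  -- `[E / S ⟶ Y⁰]` in degree `-1` exactly when its differential is epi. Their remaining cohomology
  -- lies in `T` and in `F` by the choice of the cut.
  rw [← mono_x_iff c, ← epi_d_cokerObj_iff c]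
  constructor
  · rintro ⟨h1, h2⟩
    obtain ⟨Z, -, ⟨e⟩⟩ := tiltFree_of_iso (kernelIso h c) h1
    obtain ⟨Z', -, ⟨e'⟩⟩ := tiltTorsion_of_iso (cokernelIso h c) h2
    exact ⟨mono_d_of_iso e, epi_d_of_iso e'⟩
  · rintro ⟨h1, h2⟩
    have : Mono c.kerObj.d := h1
    have := (isQis_zerπ c.kerObj).isIso
    have := (isQis_negι c.cokerObj).isIso
    exact ⟨tiltFree_of_iso (kernelIso h c).symm ⟨_, c.torsion, ⟨asIso (zerπ c.kerObj)⟩⟩,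
      tiltTorsion_of_iso (cokernelIso h c).symm ⟨_, c.free, ⟨(asIso (negι c.cokerObj)).symm⟩⟩⟩

end torsion

end HRSTilt

end

/-! ### Isomorphisms on kernels and cokernels, detected in `A` -/

noncomputable section

/-- A morphism between extensions of torsion-free by torsion objects is an isomorphism if and only
if it is one on both parts. -/
lemma IsTorsionPair.isIso_τ₂_iff {A : Type u} [Category.{v} A] [Abelian A] {T F : ObjectProperty A}
    (h : IsTorsionPair T F) {S S' : ShortComplex A} (hS : S.ShortExact) (hS' : S'.ShortExact)
    (φ : S ⟶ S') (h3 : F S.X₃) (h1' : T S'.X₁) :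
    IsIso φ.τ₂ ↔ IsIso φ.τ₁ ∧ IsIso φ.τ₃ := by
  constructor
  · intro
    have := hS.mono_f
    have := hS'.mono_f
    have := hS.epi_g
    have := hS'.epi_g
    -- The inverse of the middle map also respects the torsion parts, since maps from `T` to `F`
    -- vanish; so it induces inverses on both ends.
    have h0 : (S'.f ≫ inv φ.τ₂) ≫ S.g = 0 := h.hom_eq_zero h1' h3 _
    have h0' : S'.f ≫ inv φ.τ₂ ≫ S.g = 0 := by simpa using h0
    have hl := hS.exact.lift_f _ h0
    have hm := hS'.exact.g_desc _ h0'
    constructor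
    · refine ⟨hS.exact.lift _ h0, ?_, ?_⟩
      · rw [← cancel_mono S.f, Category.assoc, hl, φ.comm₁₂_assoc]; simp
      · rw [← cancel_mono S'.f, Category.assoc, φ.comm₁₂, reassoc_of% hl]; simp
    · refine ⟨hS'.exact.desc _ h0', ?_, ?_⟩
      · rw [← cancel_epi S.g, ← φ.comm₂₃_assoc, hm]; simp
      · rw [← cancel_epi S'.g, reassoc_of% hm, ← φ.comm₂₃]; simp
  · rintro ⟨_, _⟩
    exact ShortComplex.isIso₂_of_shortExact_of_isIso₁₃ φ hS hS'

namespace TwoTerm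

variable {A : Type u} [Category.{v} A] [Abelian A]

lemma isIso_ofStrict {X Y : TwoTerm A} (a : X.neg ⟶ Y.neg) (a' : X.zer ⟶ Y.zer) [IsIso a]
    [IsIso a'] (w : a ≫ Y.d = X.d ≫ a') : IsIso (ofStrict a a' w) := by
  have w' : inv a ≫ X.d = Y.d ≫ inv a' := by
    rw [IsIso.inv_comp_eq, ← Category.assoc, w]; simp
  refine ⟨ofStrict (inv a) (inv a') w', ?_, ?_⟩
  · rw [ofStrict_comp]
    exact ofStrict_congr (by simp) (by simp) _
  · rw [ofStrict_comp]
    exact ofStrict_congr (by simp) (by simp) _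

/-- A complex with monic differential is quasi-isomorphic to its cokernel in degree `0`. -/
lemma isIso_ofStrict_iff_cokernel {X Y : TwoTerm A} [Mono X.d] [Mono Y.d] (a : X.neg ⟶ Y.neg)
    (a' : X.zer ⟶ Y.zer) (w : a ≫ Y.d = X.d ≫ a') :
    IsIso (ofStrict a a' w) ↔ IsIso (cokernel.map X.d Y.d a a' w.symm) := by
  have hX := (isQis_zerπ X).isIso
  have hY := (isQis_zerπ Y).isIso
  let z := ofStrict (X := zerObj (cokernel X.d)) (Y := zerObj (cokernel Y.d)) 0
    (cokernel.map X.d Y.d a a' w.symm) (by simp)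
  have hz : ofStrict a a' w ≫ zerπ Y = zerπ X ≫ z := by
    rw [ofStrict_comp, ofStrict_comp]
    exact ofStrict_congr (by simp) (by simp) _
  have h1 : IsIso (ofStrict a a' w) ↔ IsIso z := by
    rw [← isIso_comp_right_iff (ofStrict a a' w) (zerπ Y), hz, isIso_comp_left_iff]
  rw [h1]
  exact ⟨fun hz => isIso_of_isIso_zer _ hz, fun _ => isIso_ofStrict _ _ _⟩

lemma isIso_ofStrict_iff_kernel {X Y : TwoTerm A} [Epi X.d] [Epi Y.d] (a : X.neg ⟶ Y.neg)
    (a' : X.zer ⟶ Y.zer) (w : a ≫ Y.d = X.d ≫ a') :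
    IsIso (ofStrict a a' w) ↔ IsIso (kernel.map X.d Y.d a a' w.symm) := by
  have hX := (isQis_negι X).isIso
  have hY := (isQis_negι Y).isIso
  let z := ofStrict (X := negObj (kernel X.d)) (Y := negObj (kernel Y.d))
    (kernel.map X.d Y.d a a' w.symm) 0 (by simp)
  have hz : negι X ≫ ofStrict a a' w = z ≫ negι Y := by
    rw [ofStrict_comp, ofStrict_comp]
    exact ofStrict_congr (by simp) (by simp) _
  have h1 : IsIso (ofStrict a a' w) ↔ IsIso z := by
    rw [← isIso_comp_left_iff (negι X) (ofStrict a a' w), hz, isIso_comp_right_iff]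
  rw [h1]
  exact ⟨fun hz => isIso_of_isIso_neg _ hz, fun _ => isIso_ofStrict _ _ _⟩

end TwoTerm

namespace HRSTilt

open TwoTerm

variable {A : Type u} [Category.{v} A] [Abelian A] {T F : ObjectProperty A}

lemma isIso_homMk_iff {X Y : HRSTilt T F} (f : X.obj ⟶ Y.obj) :
    IsIso (ObjectProperty.homMk f : X ⟶ Y) ↔ IsIso f := by
  rw [← isIso_iff_of_reflects_iso (ObjectProperty.homMk f : X ⟶ Y) (ObjectProperty.ι _)]
  rfl

section

variable {X Y X' Y' : HRSTilt T F} {P : Butterfly X.obj Y.obj}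
  {P' : Butterfly X'.obj Y'.obj} (c : P.Cut T F) (c' : P'.Cut T F)
  {a : X.obj.neg ⟶ X'.obj.neg} {a' : X.obj.zer ⟶ X'.obj.zer} (wa : a ≫ X'.obj.d = X.obj.d ≫ a')
  {b : Y.obj.neg ⟶ Y'.obj.neg} {b' : Y.obj.zer ⟶ Y'.obj.zer} (wb : b ≫ Y'.obj.d = Y.obj.d ≫ b')
  (φ : P.E ⟶ P'.E)

lemma exists_cut_map (h : IsTorsionPair T F) {X Y X' Y' : HRSTilt T F} {P : Butterfly X.obj Y.obj}
    {P' : Butterfly X'.obj Y'.obj} (c : P.Cut T F) (c' : P'.Cut T F) (φ : P.E ⟶ P'.E)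
    {a : X.obj.neg ⟶ X'.obj.neg} (h1 : P.κ ≫ φ = a ≫ P'.κ)
    {b' : Y.obj.zer ⟶ Y'.obj.zer} (h4 : φ ≫ P'.ρ = P.ρ ≫ b') :
    ∃ v : c.S ⟶ c'.S, v ≫ c'.s = c.s ≫ φ :=
  c'.exists_lift h (W := c.kerObj) (c.kerObj_tilt h X.property) a (c.s ≫ φ) (by simp [h1])
    (by simp [h4])

variable [Abelian (HRSTilt T F)] (w : (ObjectProperty.homMk (ofButterfly P) : X ⟶ Y) ≫
  (ObjectProperty.homMk (ofStrict b b' wb) : Y ⟶ Y') =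
    (ObjectProperty.homMk (ofStrict a a' wa) : X ⟶ X') ≫ ObjectProperty.homMk (ofButterfly P'))

/-- Through `kernelIso` the map of kernels is the strict morphism between the complexes `[X⁻¹ ⟶ S]`.
Their differentials are monic, so only the quotients `S / X⁻¹` matter. -/
lemma isIso_kernel_map_iff (h : IsTorsionPair T F) (hP : Mono P.κ) (hP' : Mono P'.κ)
    (h3 : φ ≫ P'.σ = P.σ ≫ a') (v : c.S ⟶ c'.S) (hv : v ≫ c'.s = c.s ≫ φ)
    (hx : c.x ≫ v = a ≫ c'.x) :
    IsIso (kernel.map _ _ _ _ w) ↔ IsIso (cokernel.map c.x c'.x a v hx) := by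
  let k : ker h c ⟶ ker h c' := ObjectProperty.homMk
    (ofStrict (X := c.kerObj) (Y := c'.kerObj) a v hx.symm)
  have hk : kernel.map _ _ _ _ w ≫ (kernelIso h c').hom = (kernelIso h c).hom ≫ k := by
    rw [← cancel_mono (kerι h c'), Category.assoc, kernelIso_hom_comp, Category.assoc]
    have : k ≫ kerι h c' = kerι h c ≫ ObjectProperty.homMk (ofStrict a a' wa) := by
      apply ObjectProperty.hom_ext
      refine (ofStrict_comp (X := c.kerObj) (Y := c'.kerObj) _ _ _ _ _ _).trans
        (Eq.trans (ofStrict_congr ?_ ?_ _) (ofStrict_comp (X := c.kerObj) _ _ _ _ _ _).symm)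
      · simp
      · rw [reassoc_of% hv, h3, Category.assoc]
    rw [this, ← Category.assoc, kernelIso_hom_comp]
    simp
  have : Mono c.kerObj.d := (mono_x_iff c).2 inferInstance
  have : Mono c'.kerObj.d := (mono_x_iff c').2 inferInstance
  rw [← isIso_comp_right_iff _ (kernelIso h c').hom, hk, isIso_comp_left_iff, isIso_homMk_iff]
  exact isIso_ofStrict_iff_cokernel (X := c.kerObj) (Y := c'.kerObj) _ _ _

/-- Dually, the cokernels `[E / S ⟶ Y⁰]` have epic differentials and are governed by the kernels of
these. -/
lemma isIso_cokernel_map_iff (h : IsTorsionPair T F) (hP : Epi P.ρ) (hP' : Epi P'.ρ)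
    (h2 : P.ι ≫ φ = b ≫ P'.ι)
    (v : cokernel c.s ⟶ cokernel c'.s) (hv : cokernel.π c.s ≫ v = φ ≫ cokernel.π c'.s)
    (hd : c.cokerObj.d ≫ b' = v ≫ c'.cokerObj.d) :
    IsIso (cokernel.map _ _ _ _ w) ↔ IsIso (kernel.map c.cokerObj.d c'.cokerObj.d v b' hd) := by
  let k : coker h c ⟶ coker h c' := ObjectProperty.homMk
    (ofStrict (X := c.cokerObj) (Y := c'.cokerObj) v b' hd.symm)
  have hk : (cokernelIso h c).hom ≫ k = cokernel.map _ _ _ _ w ≫ (cokernelIso h c').hom := by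
    rw [← cancel_epi (cokernel.π _), ← Category.assoc, comp_cokernelIso_hom]
    have : cokerπ h c ≫ k = ObjectProperty.homMk (ofStrict b b' wb) ≫ cokerπ h c' := by
      apply ObjectProperty.hom_ext
      refine (ofStrict_comp (Y := c.cokerObj) (Z := c'.cokerObj) _ _ _ _ _ _).trans
        (Eq.trans (ofStrict_congr ?_ ?_ _) (ofStrict_comp (Z := c'.cokerObj) _ _ _ _ _ _).symm)
      · rw [Category.assoc, hv, reassoc_of% h2]
      · simp
    rw [this, ← comp_cokernelIso_hom]
    simp
  have : Epi c.cokerObj.d := (epi_d_cokerObj_iff c).2 inferInstance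
  have : Epi c'.cokerObj.d := (epi_d_cokerObj_iff c').2 inferInstance
  rw [← isIso_comp_right_iff _ (cokernelIso h c').hom, ← hk, isIso_comp_left_iff, isIso_homMk_iff]
  exact isIso_ofStrict_iff_kernel (X := c.cokerObj) (Y := c'.cokerObj) _ _ _

end

end HRSTilt

end

/-! ### The torsion sequence of `K₂ / K₁` and the quasi-isomorphisms -/

noncomputable section

namespace FourTuple

open TwoTerm HRSTilt

variable {A : Type u} [Category.{v} A] [Abelian A] {T F : ObjectProperty A}

instance (Q : FourTuple T F) : Mono Q.butterfly.κ := inferInstanceAs (Mono Q.K₁.arrow)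
instance (Q : FourTuple T F) : Epi Q.butterfly.ρ := inferInstanceAs (Epi (cokernel.π Q.K₂.arrow))

@[simp] lemma toE_fromE (Q : FourTuple T F) : Q.toE ≫ Q.fromE = 𝟙 _ := Category.id_comp _

@[simp] lemma toE_fromE_assoc (Q : FourTuple T F) {V : A} (f : Q.butterfly.E ⟶ V) :
    Q.toE ≫ Q.fromE ≫ f = f := by
  rw [← Category.assoc, toE_fromE, Category.id_comp]

/-- The map between central objects induced by a morphism of 4-tuples. -/
def centre {Q R : FourTuple T F} (f : Q ⟶ R) : Q.butterfly.E ⟶ R.butterfly.E :=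
  Q.toE ≫ f.f ≫ R.fromE

section centre

variable {Q R : FourTuple T F} (f : Q ⟶ R)

lemma κ_centre : Q.butterfly.κ ≫ centre f = subMap f.f f.K₁ ≫ R.butterfly.κ := by
  simp [centre, butterfly_κ]

lemma ι_centre : Q.butterfly.ι ≫ centre f = subMap f.f f.M ≫ R.butterfly.ι := by
  simp [centre, butterfly_ι]

lemma centre_σ : centre f ≫ R.butterfly.σ = Q.butterfly.σ ≫ quotMap f.f f.M := by
  simp [centre, butterfly_σ]

lemma centre_ρ : centre f ≫ R.butterfly.ρ = Q.butterfly.ρ ≫ quotMap f.f f.K₂ := by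
  simp [centre, butterfly_ρ]

end centre

section H

variable (Q : FourTuple T F)

/-- The projection `K₂ ⟶ K₂ / K₁`. -/
def Hπ : (Q.K₂ : A) ⟶ (H T F).obj Q := cokernel.π (Subobject.ofLE Q.K₁ Q.K₂ Q.le)

instance : Epi Q.Hπ := inferInstanceAs (Epi (cokernel.π _))

lemma ofLE_Hπ : Subobject.ofLE Q.K₁ Q.K₂ Q.le ≫ Q.Hπ = 0 := cokernel.condition _

lemma Hπ_exact : (ShortComplex.mk _ _ Q.ofLE_Hπ).Exact := ShortComplex.exact_cokernel _

lemma exists_of_comp_Hπ {V : A} (l : V ⟶ (Q.K₂ : A)) (hl : l ≫ Q.Hπ = 0) :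
    ∃ (V' : A) (π : V' ⟶ V) (_ : Epi π) (t : V' ⟶ (Q.K₁ : A)),
      π ≫ l = t ≫ Subobject.ofLE Q.K₁ Q.K₂ Q.le :=
  Q.Hπ_exact.exact_up_to_refinements l hl

lemma Hπ_map {Q R : FourTuple T F} (f : Q ⟶ R) :
    Q.Hπ ≫ (H T F).map f = subMap f.f f.K₂ ≫ R.Hπ :=
  cokernel.π_desc _ _ _

end H

section sequence

variable (Q : FourTuple T F) (c : Q.butterfly.Cut T F)

lemma exists_toK₂ : ∃ l : c.S ⟶ (Q.K₂ : A), l ≫ Q.K₂.arrow = c.s ≫ Q.toE := by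
  have h0 : (c.s ≫ Q.toE) ≫ cokernel.π Q.K₂.arrow = 0 := by
    rw [Category.assoc, ← butterfly_ρ]; exact c.sρ
  exact ⟨Abelian.monoLift _ _ h0, Abelian.monoLift_comp _ _ _⟩

/-- The inclusion of `S` in `K₂`. -/
def toK₂ : c.S ⟶ (Q.K₂ : A) := (Q.exists_toK₂ c).choose

@[simp] lemma toK₂_arrow : Q.toK₂ c ≫ Q.K₂.arrow = c.s ≫ Q.toE := (Q.exists_toK₂ c).choose_spec

@[simp] lemma toK₂_arrow_assoc {V : A} (f : Q.E ⟶ V) :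
    Q.toK₂ c ≫ Q.K₂.arrow ≫ f = c.s ≫ Q.toE ≫ f := by
  rw [← Category.assoc, toK₂_arrow, Category.assoc]

lemma x_toK₂ : c.x ≫ Q.toK₂ c = Subobject.ofLE Q.K₁ Q.K₂ Q.le := by
  rw [← cancel_mono Q.K₂.arrow]
  simp [butterfly_κ]

/-- The torsion part of `K₂ / K₁`. -/
def torsionι : cokernel c.x ⟶ (H T F).obj Q :=
  cokernel.desc c.x (Q.toK₂ c ≫ Q.Hπ) (by rw [← Category.assoc, x_toK₂, ofLE_Hπ])

lemma π_torsionι : cokernel.π c.x ≫ Q.torsionι c = Q.toK₂ c ≫ Q.Hπ :=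
  cokernel.π_desc _ _ _

lemma exists_toQuotient : ∃ q : (H T F).obj Q ⟶ cokernel c.s,
    Q.Hπ ≫ q = Q.K₂.arrow ≫ Q.fromE ≫ cokernel.π c.s := by
  refine ⟨cokernel.desc _ (Q.K₂.arrow ≫ Q.fromE ≫ cokernel.π c.s) ?_, cokernel.π_desc _ _ _⟩
  rw [Subobject.ofLE_arrow_assoc]
  have : Q.K₁.arrow ≫ Q.fromE ≫ cokernel.π c.s = Q.butterfly.κ ≫ cokernel.π c.s := by
    simp [butterfly_κ]
  rw [this, c.κ_cokernel]

/-- The map from `K₂ / K₁` to the quotient of the central object by `S`. -/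
def toQuotient : (H T F).obj Q ⟶ cokernel c.s := (Q.exists_toQuotient c).choose

lemma Hπ_toQuotient : Q.Hπ ≫ Q.toQuotient c = Q.K₂.arrow ≫ Q.fromE ≫ cokernel.π c.s :=
  (Q.exists_toQuotient c).choose_spec

lemma π_cokerObj_d : cokernel.π c.s ≫ c.cokerObj.d = Q.butterfly.ρ := cokernel.π_desc _ _ _

lemma toQuotient_d : Q.toQuotient c ≫ c.cokerObj.d = 0 := by
  rw [← cancel_epi Q.Hπ, ← Category.assoc, Hπ_toQuotient, Category.assoc, Category.assoc,
    π_cokerObj_d, butterfly_ρ]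
  simp

/-- The torsion-free part of `K₂ / K₁`. -/
def freeπ : (H T F).obj Q ⟶ kernel c.cokerObj.d :=
  kernel.lift _ (Q.toQuotient c) (Q.toQuotient_d c)

lemma freeπ_ι : Q.freeπ c ≫ kernel.ι c.cokerObj.d = Q.toQuotient c := kernel.lift_ι _ _ _

lemma torsionι_toQuotient : Q.torsionι c ≫ Q.toQuotient c = 0 := by
  rw [← cancel_epi (cokernel.π c.x), ← Category.assoc, π_torsionι, Category.assoc, Hπ_toQuotient]
  simp

/-- The torsion and the torsion-free part of `K₂ / K₁`. -/
def sequence : ShortComplex A := ShortComplex.mk (Q.torsionι c) (Q.freeπ c) (by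
  rw [← cancel_mono (kernel.ι c.cokerObj.d), Category.assoc, freeπ_ι, torsionι_toQuotient,
    zero_comp])

/-- Since `K₁ ⊆ S ⊆ K₂`, this is `0 ⟶ S / K₁ ⟶ K₂ / K₁ ⟶ K₂ / S ⟶ 0`, where `K₂ / S` appears as the
kernel of `E / S ⟶ E / K₂`. -/
lemma sequence_shortExact : (Q.sequence c).ShortExact := by
  have hs : (ShortComplex.mk c.s (cokernel.π c.s) (by simp)).Exact :=
    ShortComplex.exact_cokernel _
  refine ShortComplex.ShortExact.mk' ?_ ?_ ?_
  · rw [ShortComplex.exact_iff_exact_up_to_refinements]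
    intro V y hy
    change V ⟶ (H T F).obj Q at y
    change y ≫ Q.freeπ c = 0 at hy
    obtain ⟨V', π, hπ, l, hl⟩ := surjective_up_to_refinements_of_epi Q.Hπ y
    have h1 : (l ≫ Q.K₂.arrow ≫ Q.fromE) ≫ cokernel.π c.s = 0 := by
      have h2 : y ≫ Q.toQuotient c = 0 := by rw [← freeπ_ι, reassoc_of% hy, zero_comp]
      have h3 : (π ≫ y) ≫ Q.toQuotient c = 0 := by rw [Category.assoc, h2, comp_zero]
      rw [hl, Category.assoc, Hπ_toQuotient] at h3
      simpa using h3
    obtain ⟨V'', π', hπ', t, ht⟩ := hs.exact_up_to_refinements _ h1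
    dsimp at t ht
    refine ⟨V'', π' ≫ π, inferInstance, t ≫ cokernel.π c.x, ?_⟩
    have h4 : π' ≫ l = t ≫ Q.toK₂ c := by
      rw [← cancel_mono Q.K₂.arrow]
      simp [← reassoc_of% ht]
    change (π' ≫ π) ≫ y = (t ≫ cokernel.π c.x) ≫ Q.torsionι c
    rw [Category.assoc, hl, reassoc_of% h4, Category.assoc, π_torsionι]
  · change Mono (Q.torsionι c)
    rw [Preadditive.mono_iff_cancel_zero]
    intro V z hz
    obtain ⟨V', π, hπ, l, hl⟩ := surjective_up_to_refinements_of_epi (cokernel.π c.x) z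
    have h1 : (l ≫ Q.toK₂ c) ≫ Q.Hπ = 0 := by
      rw [Category.assoc, ← π_torsionι, ← reassoc_of% hl, hz, comp_zero]
    obtain ⟨V'', π', hπ', t, ht⟩ := Q.exists_of_comp_Hπ _ h1
    have h2 : π' ≫ l = t ≫ c.x := by
      have h3 : Mono (Q.toK₂ c) := by
        have : Mono (Q.toK₂ c ≫ Q.K₂.arrow ≫ Q.fromE) := by
          rw [toK₂_arrow_assoc, toE_fromE]; simpa using c.mono
        exact mono_of_mono _ (Q.K₂.arrow ≫ Q.fromE)
      rw [← cancel_mono (Q.toK₂ c), Category.assoc, Category.assoc, x_toK₂, ht]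
    apply zero_of_epi_comp π
    apply zero_of_epi_comp π'
    rw [hl, reassoc_of% h2, cokernel.condition, comp_zero]
  · change Epi (Q.freeπ c)
    rw [epi_iff_surjective_up_to_refinements]
    intro V k
    obtain ⟨V', π, hπ, l, hl⟩ := surjective_up_to_refinements_of_epi (cokernel.π c.s)
      (k ≫ kernel.ι c.cokerObj.d)
    have h1 : (l ≫ Q.toE) ≫ cokernel.π Q.K₂.arrow = 0 := by
      rw [Category.assoc, ← butterfly_ρ, ← π_cokerObj_d Q c, ← reassoc_of% hl, kernel.condition]
      simp
    have h2 : Abelian.monoLift _ _ h1 ≫ Q.K₂.arrow = _ := Abelian.monoLift_comp _ _ _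
    refine ⟨V', π, hπ, Abelian.monoLift _ _ h1 ≫ Q.Hπ, ?_⟩
    rw [← cancel_mono (kernel.ι c.cokerObj.d), Category.assoc, Category.assoc, Category.assoc,
      freeπ_ι, Hπ_toQuotient, reassoc_of% h2, hl]
    simp

end sequence

variable (h : IsTorsionPair T F)

/-- The quasi-isomorphisms of 4-tuples are the morphisms inverted by `H`. -/
theorem quasiIso_iff [Abelian (HRSTilt T F)] {Q R : FourTuple T F} (f : Q ⟶ R) :
    quasiIso h f ↔ IsIso ((H T F).map f) := by
  have c := (Butterfly.Cut.nonempty h Q.butterfly).some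
  have c' := (Butterfly.Cut.nonempty h R.butterfly).some
  let X : HRSTilt T F := (src h).obj Q
  let Y : HRSTilt T F := (tgt h).obj Q
  let X' : HRSTilt T F := (src h).obj R
  let Y' : HRSTilt T F := (tgt h).obj R
  -- Cuts are functorial: orthogonality forces `S` into `S'`.
  obtain ⟨v, hv⟩ := exists_cut_map h (X := X) (Y := Y) (X' := X') (Y' := Y') c c' (centre f)
    (κ_centre f) (centre_ρ f)
  have hx : c.x ≫ v = subMap f.f f.K₁ ≫ c'.x := by
    rw [← cancel_mono c'.s, Category.assoc, hv, c.xs_assoc, Category.assoc, c'.xs, κ_centre]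
  obtain ⟨v', hv'⟩ : ∃ v' : cokernel c.s ⟶ cokernel c'.s,
      cokernel.π c.s ≫ v' = centre f ≫ cokernel.π c'.s :=
    ⟨cokernel.map _ _ v (centre f) hv.symm, cokernel.π_desc _ _ _⟩
  have hd : c.cokerObj.d ≫ quotMap f.f f.K₂ = v' ≫ c'.cokerObj.d := by
    rw [← cancel_epi (cokernel.π c.s), reassoc_of% hv']
    have h1 : cokernel.π c.s ≫ c.cokerObj.d = Q.butterfly.ρ := by simp
    have h2 : cokernel.π c'.s ≫ c'.cokerObj.d = R.butterfly.ρ := by simp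
    rw [reassoc_of% h1, h2, centre_ρ]
  -- The outer maps govern the kernels and the cokernels in the tilt, the middle one is the value of
  -- `H`; `isIso_τ₂_iff` relates the three.
  let Φ : Q.sequence c ⟶ R.sequence c' :=
    { τ₁ := cokernel.map c.x c'.x (subMap f.f f.K₁) v hx
      τ₂ := (H T F).map f
      τ₃ := kernel.map c.cokerObj.d c'.cokerObj.d v' (quotMap f.f f.K₂) hd
      comm₁₂ := by
        change cokernel.map c.x c'.x _ v hx ≫ R.torsionι c' = Q.torsionι c ≫ (H T F).map f
        rw [← cancel_epi (cokernel.π c.x), cokernel.π_desc_assoc, Category.assoc, π_torsionι,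
          ← Category.assoc (cokernel.π c.x), π_torsionι, Category.assoc, Hπ_map,
          ← Category.assoc v, ← Category.assoc (Q.toK₂ c)]
        congr 1
        rw [← cancel_mono R.K₂.arrow, Category.assoc, toK₂_arrow, reassoc_of% hv]
        simp [centre]
      comm₂₃ := by
        change (H T F).map f ≫ R.freeπ c' = Q.freeπ c ≫ kernel.map c.cokerObj.d c'.cokerObj.d _ _ hd
        rw [← cancel_mono (kernel.ι c'.cokerObj.d), Category.assoc, freeπ_ι, Category.assoc,
          kernel.lift_ι, ← Category.assoc (Q.freeπ c), freeπ_ι, ← cancel_epi Q.Hπ,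
          ← Category.assoc, Hπ_map, Category.assoc, Hπ_toQuotient, ← Category.assoc Q.Hπ,
          Hπ_toQuotient, Category.assoc, Category.assoc, hv']
        simp [centre] }
  have key := h.isIso_τ₂_iff (Q.sequence_shortExact c) (R.sequence_shortExact c') Φ c.free c'.torsion
  refine Iff.trans (and_congr ?_ ?_) key.symm
  · exact isIso_kernel_map_iff (X := X) (Y := Y) (X' := X') (Y' := Y') c c' _ _ (centre f) _ h
      (inferInstanceAs (Mono Q.butterfly.κ)) (inferInstanceAs (Mono R.butterfly.κ)) (centre_σ f) v hv hx
  · exact isIso_cokernel_map_iff (X := X) (Y := Y) (X' := X') (Y' := Y') c c' _ _ (centre f) _ h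
      (inferInstanceAs (Epi Q.butterfly.ρ)) (inferInstanceAs (Epi R.butterfly.ρ)) (ι_centre f) v' hv' hd

end FourTuple

end

noncomputable section

/-! ### Localization at the morphisms inverted by a functor with graphs -/

/-- For every `φ : H X ⟶ H Y` there is a universal roof `X ⟵ X' ⟶ Y` inducing `φ`. -/
def HasGraphs {C : Type*} [Category* C] {A : Type*} [Category* A] (H : C ⥤ A) : Prop :=
  ∀ ⦃X Y : C⦄ (φ : H.obj X ⟶ H.obj Y), ∃ (X' : C) (s : X' ⟶ X) (g : X' ⟶ Y),
    IsIso (H.map s) ∧ H.map s ≫ φ = H.map g ∧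
    ∀ ⦃W : C⦄ (a : W ⟶ X) (b : W ⟶ Y), H.map a ≫ φ = H.map b → ∃ m, m ≫ s = a ∧ m ≫ g = b

namespace HasGraphs

variable {C : Type*} [Category* C] {A : Type*} [Category* A] {D : Type*} [Category* D]
  {H : C ⥤ A} {W : MorphismProperty C}
  (hW : ∀ ⦃X Y : C⦄ (f : X ⟶ Y), W f ↔ IsIso (H.map f))

lemma isInvertedBy (hW : ∀ ⦃X Y : C⦄ (f : X ⟶ Y), W f ↔ IsIso (H.map f)) : W.IsInvertedBy H := fun _ _ f hf => (hW f).1 hf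

/-- The functor induced by `H` on the localization. -/
abbrev induced : W.Localization ⥤ A := Localization.Construction.lift H (isInvertedBy hW)

lemma lift_Q_map (G : C ⥤ D) (hG : W.IsInvertedBy G) {X Y : C} (f : X ⟶ Y) :
    (Localization.Construction.lift G hG).map (W.Q.map f) = G.map f := by
  have h := Functor.congr_hom (Localization.Construction.fac G hG) f
  exact h.trans ((Category.id_comp _).trans (Category.comp_id _))

lemma exists_Q_obj_eq (X : W.Localization) : ∃ X₀ : C, X = W.Q.obj X₀ :=
  ⟨(Localization.Construction.objEquiv W).symm X,
    ((Localization.Construction.objEquiv W).apply_symm_apply X).symm⟩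

lemma exists_roof (hH : HasGraphs H) {X Y : C}
    (φ : (induced hW).obj (W.Q.obj X) ⟶ (induced hW).obj (W.Q.obj Y)) :
    ∃ (X' : C) (s : X' ⟶ X) (g : X' ⟶ Y), IsIso (W.Q.map s) ∧
      (induced hW).map (W.Q.map s) ≫ φ = (induced hW).map (W.Q.map g) := by
  obtain ⟨X', s, g, hs, h1, -⟩ := hH (X := X) (Y := Y) φ
  refine ⟨X', s, g, W.Q_inverts s ((hW s).2 hs), ?_⟩
  exact (congrArg (· ≫ φ) (lift_Q_map H _ s)).trans (h1.trans (lift_Q_map H _ g).symm)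

/-- Both `a` and `b` have the graph of their common image under `H`. They factor through it by
sections `m`, `m'` of the projection `s`, and `s` becomes invertible, so `m` and `m'` become equal.
-/
lemma Q_map_eq (hH : HasGraphs H) {X Y : C} {a b : X ⟶ Y}
    (hab : (induced hW).map (W.Q.map a) = (induced hW).map (W.Q.map b)) :
    W.Q.map a = W.Q.map b := by
  rw [lift_Q_map, lift_Q_map] at hab
  change H.map a = H.map b at hab
  obtain ⟨X', s, g, hs, -, hu⟩ := hH (H.map a)
  obtain ⟨m, h1, h2⟩ := hu (𝟙 X) a (by simp)
  obtain ⟨m', h1', h2'⟩ := hu (𝟙 X) b (by simp [hab])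
  have := W.Q_inverts s ((hW s).2 hs)
  have hm : W.Q.map m = W.Q.map m' := by
    rw [← cancel_mono (W.Q.map s), ← Functor.map_comp, ← Functor.map_comp, h1, h1']
  rw [← h2, ← h2', Functor.map_comp, Functor.map_comp, hm]

/-- A morphism of the localization is determined by its image under the induced functor. -/
lemma Q_map_comp_eq (hH : HasGraphs H) {X Y Z : C} (α : W.Q.obj X ⟶ W.Q.obj Y) (a : Z ⟶ X) (b : Z ⟶ Y)
    (hab : (induced hW).map (W.Q.map a ≫ α) = (induced hW).map (W.Q.map b)) :
    W.Q.map a ≫ α = W.Q.map b := by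
  -- The claim is proved for all morphisms of the localization by checking the generators and
  -- closure under composition. The equalities of objects allow the property to be stated for
  -- arbitrary objects of the localization.
  let P : MorphismProperty W.Localization := fun X Y α =>
    ∀ ⦃X₀ Y₀ Z : C⦄ (e : X = W.Q.obj X₀) (e' : Y = W.Q.obj Y₀) (a : Z ⟶ X₀) (b : Z ⟶ Y₀),
      (induced hW).map (W.Q.map a ≫ eqToHom e.symm ≫ α ≫ eqToHom e') =
        (induced hW).map (W.Q.map b) → W.Q.map a ≫ eqToHom e.symm ≫ α ≫ eqToHom e' = W.Q.map b
  suffices hP : P = ⊤ by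
    have : P α := by rw [hP]; trivial
    simpa using this rfl rfl a b (by simpa using hab)
  have : P.IsStableUnderComposition := ⟨by
    intro X Y V α β hα hβ X₀ V₀ Z e e' a b hab
    obtain ⟨Y, rfl⟩ := exists_Q_obj_eq Y
    subst e e'
    simp only [eqToHom_refl, Category.id_comp, Category.comp_id] at hab ⊢
    -- A roof for the image of `a ≫ α` supplies a morphism `g` to the intermediate object. The
    -- hypothesis on `α` identifies it with `s ≫ a ≫ α`, after which the hypothesis on `β` applies
    -- to `g`.
    obtain ⟨Z', s, g, hs, h1⟩ := exists_roof hW hH ((induced hW).map (W.Q.map a ≫ α))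
    have h2 := hα rfl rfl (s ≫ a) g (by
      rw [← h1, ← Functor.map_comp]; simp)
    simp only [eqToHom_refl, Category.id_comp, Category.comp_id] at h2
    have h3 := hβ rfl rfl g (s ≫ b) (by
      rw [Functor.map_comp W.Q, Functor.map_comp _ _ (W.Q.map b), ← hab, ← h2,
        ← Functor.map_comp]
      simp)
    simp only [eqToHom_refl, Category.id_comp, Category.comp_id] at h3
    rw [← cancel_epi (W.Q.map s), ← Functor.map_comp W.Q s b, ← h3, ← h2]
    simp⟩
  refine Localization.Construction.morphismProperty_eq_top P ?_ ?_
  · intro X Y f X₀ Y₀ Z e e' a b hab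
    obtain rfl := (Localization.Construction.objEquiv W).injective e
    obtain rfl := (Localization.Construction.objEquiv W).injective e'
    simp only [eqToHom_refl, Category.id_comp, Category.comp_id, ← Functor.map_comp W.Q] at hab ⊢
    exact Q_map_eq hW hH hab
  · intro X Y w hw Y₀ X₀ Z e e' a b hab
    obtain rfl := (Localization.Construction.objEquiv W).injective e
    obtain rfl := (Localization.Construction.objEquiv W).injective e'
    simp only [eqToHom_refl, Category.id_comp, Category.comp_id] at hab ⊢
    -- For a formal inverse, multiplying by `w` reduces the claim to morphisms of the original
    -- category.
    have h1 : Localization.Construction.wInv w hw ≫ W.Q.map w = 𝟙 _ :=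
      (Localization.Construction.wIso w hw).inv_hom_id
    have h2 : Mono (W.Q.map w) := by
      have := W.Q_inverts w hw
      infer_instance
    have h3 : W.Q.map a = W.Q.map (b ≫ w) := Q_map_eq hW hH (by
      rw [Functor.map_comp W.Q, Functor.map_comp (induced hW), ← hab, ← Functor.map_comp,
        Category.assoc, h1, Category.comp_id])
    rw [← cancel_mono (W.Q.map w), Category.assoc, h1, Category.comp_id, h3, Functor.map_comp]

/-- Criterion for a functor to identify its target with the localization. -/
theorem lift_isEquivalence (hW : ∀ ⦃X Y : C⦄ (f : X ⟶ Y), W f ↔ IsIso (H.map f))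
    (hH : HasGraphs H) (G : C ⥤ D) (hG : W.IsInvertedBy G)
    (hful : ∀ ⦃X Y : C⦄ (u : G.obj X ⟶ G.obj Y), ∃ (Z : C) (s : Z ⟶ X) (t : Z ⟶ Y), W s ∧
      G.map s ≫ u = G.map t)
    (hfai : ∀ ⦃X Y : C⦄ (a b : X ⟶ Y), G.map a = G.map b → H.map a = H.map b)
    (hess : ∀ V : D, ∃ X : C, Nonempty (G.obj X ≅ V)) :
    (Localization.Construction.lift G hG).IsEquivalence where
  essSurj := ⟨fun V => by
    obtain ⟨X, ⟨e⟩⟩ := hess V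
    exact ⟨W.Q.obj X, ⟨e⟩⟩⟩
  full := ⟨by
    intro X Y u
    obtain ⟨X, rfl⟩ := exists_Q_obj_eq X
    obtain ⟨Y, rfl⟩ := exists_Q_obj_eq Y
    obtain ⟨X', s, g, hs, h1⟩ := hful (X := X) (Y := Y) u
    have := W.Q_inverts s hs
    refine ⟨inv (W.Q.map s) ≫ W.Q.map g, ?_⟩
    rw [Functor.map_comp, Functor.map_inv, IsIso.inv_comp_eq]
    exact (lift_Q_map G _ g).trans (h1.symm.trans (congrArg (· ≫ u) (lift_Q_map G _ s).symm))⟩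
  faithful := ⟨by
    intro X Y α β hαβ
    obtain ⟨X, rfl⟩ := exists_Q_obj_eq X
    obtain ⟨Y, rfl⟩ := exists_Q_obj_eq Y
    -- Two successive roofs turn `α` and `β` into images of morphisms with the same source, which
    -- `hfai` and `Q_map_eq` can compare.
    obtain ⟨X', s, g, hs, h1⟩ := exists_roof hW hH ((induced hW).map α)
    obtain ⟨X'', s', g', hs', h2⟩ := exists_roof hW hH ((induced hW).map (W.Q.map s ≫ β))
    have h3 : W.Q.map s ≫ α = W.Q.map g := Q_map_comp_eq hW hH α _ _ (by rw [Functor.map_comp, h1])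
    have h4 : W.Q.map (s' ≫ s) ≫ β = W.Q.map g' := Q_map_comp_eq hW hH β _ _ (by
      rw [← h2, ← Functor.map_comp]; simp)
    have h5 : W.Q.map (s' ≫ s) ≫ α = W.Q.map (s' ≫ g) := by simp [h3]
    have h6 : IsIso (W.Q.map (s' ≫ s)) := by rw [Functor.map_comp]; infer_instance
    rw [← cancel_epi (W.Q.map (s' ≫ s)), h4, h5]
    refine Q_map_eq hW hH ?_
    rw [lift_Q_map, lift_Q_map]
    refine hfai _ _ ?_
    rw [← lift_Q_map G hG, ← lift_Q_map G hG, ← h4, ← h5,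
      Functor.map_comp _ _ α, hαβ, Functor.map_comp _ _ β]⟩

end HasGraphs
end

/-! ### Graphs of morphisms `K₂ / K₁ ⟶ K₂' / K₁'` in the category of 4-tuples -/

noncomputable section

namespace FourTuple

variable {A : Type u} [Category.{v} A] [Abelian A] {T F : ObjectProperty A}

section criteria

variable {E : A} (K M : Subobject E)

/-- Orthogonality replaces the intersection by a test on maps from torsion objects; this can be
checked componentwise on a direct sum. `torsion_iff` does the same for the quotient by `K + M`. -/
lemma free_iff (h : IsTorsionPair T F) : F ((K ⊓ M : Subobject E) : A) ↔
    ∀ ⦃V : A⦄, T V → ∀ f : V ⟶ E, K.Factors f → M.Factors f → f = 0 := by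
  constructor
  · intro hF V hV f h1 h2
    have h3 : (K ⊓ M).Factors f := (Subobject.inf_factors f).2 ⟨h1, h2⟩
    rw [← Subobject.factorThru_arrow _ f h3, h.hom_eq_zero hV hF (Subobject.factorThru _ f h3),
      zero_comp]
  · intro H
    refine h.F_of_hom_eq_zero fun V hV f => ?_
    refine (cancel_mono (K ⊓ M).arrow).1 ?_
    rw [zero_comp]
    have := (Subobject.inf_factors (f ≫ (K ⊓ M).arrow)).1 (Subobject.factors_comp_arrow f)
    exact H hV _ this.1 this.2

lemma torsion_iff (h : IsTorsionPair T F) : T (cokernel (K ⊔ M).arrow) ↔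
    ∀ ⦃V : A⦄, F V → ∀ f : E ⟶ V, K.arrow ≫ f = 0 → M.arrow ≫ f = 0 → f = 0 := by
  constructor
  · intro hT V hV f h1 h2
    have h3 : K ⊔ M ≤ kernelSubobject f :=
      sup_le (le_kernelSubobject _ _ h1) (le_kernelSubobject _ _ h2)
    have h4 : (K ⊔ M).arrow ≫ f = 0 := by
      rw [← Subobject.ofLE_arrow h3, Category.assoc, kernelSubobject_arrow_comp, comp_zero]
    rw [← cokernel.π_desc _ f h4, h.hom_eq_zero hT hV (cokernel.desc _ f h4), comp_zero]
  · intro H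
    refine h.T_of_hom_eq_zero fun V hV f => ?_
    refine (cancel_epi (cokernel.π (K ⊔ M).arrow)).1 ?_
    rw [comp_zero]
    refine H hV _ ?_ ?_
    · rw [← Subobject.ofLE_arrow (le_sup_left : K ≤ K ⊔ M), Category.assoc, cokernel.condition_assoc,
        zero_comp, comp_zero]
    · rw [← Subobject.ofLE_arrow (le_sup_right : M ≤ K ⊔ M), Category.assoc, cokernel.condition_assoc,
        zero_comp, comp_zero]

end criteria

/-- The product of two subobjects. -/
def prodSub {E E' : A} (K : Subobject E) (K' : Subobject E') : Subobject (E ⊞ E') :=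
  (Subobject.pullback biprod.fst).obj K ⊓ (Subobject.pullback biprod.snd).obj K'

lemma prodSub_factors_iff {E E' V : A} (K : Subobject E) (K' : Subobject E') (f : V ⟶ E ⊞ E') :
    (prodSub K K').Factors f ↔ K.Factors (f ≫ biprod.fst) ∧ K'.Factors (f ≫ biprod.snd) := by
  rw [prodSub, Subobject.inf_factors, pullback_factors_iff, pullback_factors_iff]

lemma comp_inl_eq_zero {E E' V : A} {K : Subobject E} {K' : Subobject E'} {f : E ⊞ E' ⟶ V}
    (hf : (prodSub K K').arrow ≫ f = 0) : K.arrow ≫ biprod.inl ≫ f = 0 := by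
  have h : (prodSub K K').Factors (K.arrow ≫ biprod.inl) :=
    (prodSub_factors_iff _ _ _).2 ⟨by simpa using Subobject.factors_self K,
      by simpa using Subobject.factors_zero⟩
  rw [← Category.assoc, ← Subobject.factorThru_arrow _ _ h, Category.assoc, hf, comp_zero]

lemma comp_inr_eq_zero {E E' V : A} {K : Subobject E} {K' : Subobject E'} {f : E ⊞ E' ⟶ V}
    (hf : (prodSub K K').arrow ≫ f = 0) : K'.arrow ≫ biprod.inr ≫ f = 0 := by
  have h : (prodSub K K').Factors (K'.arrow ≫ biprod.inr) :=
    (prodSub_factors_iff _ _ _).2 ⟨by simpa using Subobject.factors_zero,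
      by simpa using Subobject.factors_self K'⟩
  rw [← Category.assoc, ← Subobject.factorThru_arrow _ _ h, Category.assoc, hf, comp_zero]

section graph

variable {X Y : FourTuple T F} (φ : (H T F).obj X ⟶ (H T F).obj Y)

/-- The inclusion of `K₂ ×_{H Y} K₂'` in the sum of the ambient objects. -/
def graphι : pullback (X.Hπ ≫ φ) Y.Hπ ⟶ X.E ⊞ Y.E :=
  biprod.lift (pullback.fst _ _ ≫ X.K₂.arrow) (pullback.snd _ _ ≫ Y.K₂.arrow)

instance : Mono (graphι φ) := by
  constructor
  intro V a b hab
  have h1 := congr($hab ≫ biprod.fst)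
  have h2 := congr($hab ≫ biprod.snd)
  apply pullback.hom_ext
  · rw [← cancel_mono X.K₂.arrow]; simpa [graphι] using h1
  · rw [← cancel_mono Y.K₂.arrow]; simpa [graphι] using h2

lemma graphι_factors_iff {V : A} (f : V ⟶ X.E ⊞ Y.E) : (Subobject.mk (graphι φ)).Factors f ↔
    ∃ (a : V ⟶ (X.K₂ : A)) (b : V ⟶ (Y.K₂ : A)), a ≫ X.K₂.arrow = f ≫ biprod.fst ∧
      b ≫ Y.K₂.arrow = f ≫ biprod.snd ∧ a ≫ X.Hπ ≫ φ = b ≫ Y.Hπ := by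
  change (∃ l, l ≫ graphι φ = f) ↔ _
  constructor
  · rintro ⟨l, rfl⟩
    exact ⟨l ≫ pullback.fst _ _, l ≫ pullback.snd _ _, by simp [graphι], by simp [graphι],
      by simp [pullback.condition]⟩
  · rintro ⟨a, b, h1, h2, h3⟩
    refine ⟨pullback.lift a b h3, ?_⟩
    apply biprod.hom_ext
    · rw [← h1, Category.assoc, graphι, biprod.lift_fst, pullback.lift_fst_assoc]
    · rw [← h2, Category.assoc, graphι, biprod.lift_snd, pullback.lift_snd_assoc]

/-- The graph of a morphism `K₂ / K₁ ⟶ K₂' / K₁'`. -/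
def graph (h : IsTorsionPair T F) : FourTuple T F where
  E := X.E ⊞ Y.E
  K₁ := prodSub X.K₁ Y.K₁
  K₂ := Subobject.mk (graphι φ)
  M := prodSub X.M Y.M
  le := by
    apply Subobject.le_of_factors
    obtain ⟨h1, h2⟩ := (prodSub_factors_iff X.K₁ Y.K₁ _).1 (Subobject.factors_self _)
    refine (graphι_factors_iff φ _).2 ⟨X.K₁.factorThru _ h1 ≫ Subobject.ofLE _ _ X.le,
      Y.K₁.factorThru _ h2 ≫ Subobject.ofLE _ _ Y.le, by simp, by simp, ?_⟩
    rw [Category.assoc, Category.assoc, ofLE_Hπ, reassoc_of% X.ofLE_Hπ]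
    simp
  free := by
    rw [free_iff _ _ h]
    intro V hV f h1 h2
    obtain ⟨a, b, h3, h4, -⟩ := (graphι_factors_iff φ f).1 h1
    obtain ⟨h5, h6⟩ := (prodSub_factors_iff _ _ f).1 h2
    apply biprod.hom_ext
    · rw [zero_comp]
      exact (free_iff _ _ h).1 X.free hV _ (by rw [← h3]; exact Subobject.factors_comp_arrow _) h5
    · rw [zero_comp]
      exact (free_iff _ _ h).1 Y.free hV _ (by rw [← h4]; exact Subobject.factors_comp_arrow _) h6
  torsion := by
    rw [torsion_iff _ _ h]
    intro V hV f h1 h2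
    apply biprod.hom_ext'
    · rw [comp_zero]
      exact (torsion_iff _ _ h).1 X.torsion hV _ (comp_inl_eq_zero h1) (comp_inl_eq_zero h2)
    · rw [comp_zero]
      exact (torsion_iff _ _ h).1 Y.torsion hV _ (comp_inr_eq_zero h1) (comp_inr_eq_zero h2)

variable (h : IsTorsionPair T F)

/-- The projection of the graph to the source. -/
def graphFst : graph φ h ⟶ X where
  f := (biprod.fst : X.E ⊞ Y.E ⟶ X.E)
  K₁ := ((prodSub_factors_iff _ _ _).1 (Subobject.factors_self (graph φ h).K₁)).1
  K₂ := by
    obtain ⟨a, b, h1, -, -⟩ := (graphι_factors_iff φ _).1 (Subobject.factors_self (graph φ h).K₂)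
    exact (congrArg X.K₂.Factors h1).mp (Subobject.factors_comp_arrow _)
  M := ((prodSub_factors_iff _ _ _).1 (Subobject.factors_self (graph φ h).M)).1

/-- The projection of the graph to the target. -/
def graphSnd : graph φ h ⟶ Y where
  f := (biprod.snd : X.E ⊞ Y.E ⟶ Y.E)
  K₁ := ((prodSub_factors_iff _ _ _).1 (Subobject.factors_self (graph φ h).K₁)).2
  K₂ := by
    obtain ⟨a, b, -, h1, -⟩ := (graphι_factors_iff φ _).1 (Subobject.factors_self (graph φ h).K₂)
    exact (congrArg Y.K₂.Factors h1).mp (Subobject.factors_comp_arrow _)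
  M := ((prodSub_factors_iff _ _ _).1 (Subobject.factors_self (graph φ h).M)).2

lemma exists_lift_graph {V : A} (a : V ⟶ X.E) (b : V ⟶ Y.E) : ∃ m : V ⟶ (graph φ h).E,
    m ≫ (graphFst φ h).f = a ∧ m ≫ (graphSnd φ h).f = b :=
  ⟨biprod.lift a b, biprod.lift_fst _ _, biprod.lift_snd _ _⟩

lemma graph_K₁_factors_iff {V : A} (f : V ⟶ (graph φ h).E) : (graph φ h).K₁.Factors f ↔
    X.K₁.Factors (f ≫ (graphFst φ h).f) ∧ Y.K₁.Factors (f ≫ (graphSnd φ h).f) :=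
  prodSub_factors_iff _ _ _

lemma graph_M_factors_iff {V : A} (f : V ⟶ (graph φ h).E) : (graph φ h).M.Factors f ↔
    X.M.Factors (f ≫ (graphFst φ h).f) ∧ Y.M.Factors (f ≫ (graphSnd φ h).f) :=
  prodSub_factors_iff _ _ _

lemma graph_K₂_factors_iff {V : A} (f : V ⟶ (graph φ h).E) : (graph φ h).K₂.Factors f ↔
    ∃ (a : V ⟶ (X.K₂ : A)) (b : V ⟶ (Y.K₂ : A)), a ≫ X.K₂.arrow = f ≫ (graphFst φ h).f ∧
      b ≫ Y.K₂.arrow = f ≫ (graphSnd φ h).f ∧ a ≫ X.Hπ ≫ φ = b ≫ Y.Hπ :=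
  graphι_factors_iff φ f

lemma subMap_graph_comp : subMap (graphFst φ h).f (graphFst φ h).K₂ ≫ X.Hπ ≫ φ =
    subMap (graphSnd φ h).f (graphSnd φ h).K₂ ≫ Y.Hπ := by
  obtain ⟨a, b, h1, h2, h3⟩ := (graph_K₂_factors_iff φ h _).1 (Subobject.factors_self _)
  have h4 : subMap (graphFst φ h).f (graphFst φ h).K₂ = a := by
    rw [← cancel_mono X.K₂.arrow, h1]; simp
  have h5 : subMap (graphSnd φ h).f (graphSnd φ h).K₂ = b := by
    rw [← cancel_mono Y.K₂.arrow, h2]; simp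
  rw [h4, h5, h3]

lemma map_graphFst_comp : (H T F).map (graphFst φ h) ≫ φ = (H T F).map (graphSnd φ h) := by
  rw [← cancel_epi (graph φ h).Hπ, ← Category.assoc, Hπ_map, Hπ_map, Category.assoc,
    subMap_graph_comp]

/-- Injectivity: if `(e, e')` lies in the graph and `e ∈ K₁`, then `e'` represents `φ 0 = 0`, so `e'
∈ K₁'`. Surjectivity: given `e ∈ K₂`, locally choose `e' ∈ K₂'` representing the image of its class
under `φ`. -/
instance : IsIso ((H T F).map (graphFst φ h)) := by
  have h3 := subMap_graph_comp φ h
  have h5 := Hπ_map (graphFst φ h)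
  have : Mono ((H T F).map (graphFst φ h)) := by
    rw [Preadditive.mono_iff_cancel_zero]
    intro V z hz
    obtain ⟨V', π, hπ, l, hl⟩ := surjective_up_to_refinements_of_epi (graph φ h).Hπ z
    have h6 : (l ≫ subMap (graphFst φ h).f (graphFst φ h).K₂) ≫ X.Hπ = 0 := by
      rw [Category.assoc, ← h5, ← reassoc_of% hl, hz, comp_zero]
    have h7 : (l ≫ subMap (graphSnd φ h).f (graphSnd φ h).K₂) ≫ Y.Hπ = 0 := by
      rw [Category.assoc, ← h3, ← Category.assoc, ← Category.assoc, h6, zero_comp]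
    obtain ⟨V₁, π₁, hπ₁, t, ht⟩ := X.exists_of_comp_Hπ _ h6
    obtain ⟨V₂, π₂, hπ₂, t', ht'⟩ := Y.exists_of_comp_Hπ
      (π₁ ≫ l ≫ subMap (graphSnd φ h).f (graphSnd φ h).K₂) (by rw [Category.assoc, h7, comp_zero])
    have h8 : (graph φ h).K₁.Factors ((π₂ ≫ π₁ ≫ l) ≫ (graph φ h).K₂.arrow) := by
      refine (graph_K₁_factors_iff _ _ _).2 ⟨?_, ?_⟩
      · have : ((π₂ ≫ π₁ ≫ l) ≫ (graph φ h).K₂.arrow) ≫ (graphFst φ h).f =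
            (π₂ ≫ t) ≫ X.K₁.arrow := by
          simpa using congr(π₂ ≫ $ht ≫ X.K₂.arrow)
        rw [this]; exact Subobject.factors_comp_arrow _
      · have : ((π₂ ≫ π₁ ≫ l) ≫ (graph φ h).K₂.arrow) ≫ (graphSnd φ h).f = t' ≫ Y.K₁.arrow := by
          simpa using congr($ht' ≫ Y.K₂.arrow)
        rw [this]; exact Subobject.factors_comp_arrow _
    have h9 : π₂ ≫ π₁ ≫ l = (graph φ h).K₁.factorThru _ h8 ≫ Subobject.ofLE _ _ (graph φ h).le := by
      rw [← cancel_mono (graph φ h).K₂.arrow]; simp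
    apply zero_of_epi_comp π
    apply zero_of_epi_comp π₁
    apply zero_of_epi_comp π₂
    have h10 : (π₂ ≫ π₁ ≫ l) ≫ (graph φ h).Hπ = 0 := by
      rw [h9, Category.assoc, ofLE_Hπ, comp_zero]
    rw [hl]
    simpa using h10
  have : Epi ((H T F).map (graphFst φ h)) := by
    rw [epi_iff_surjective_up_to_refinements]
    intro V y
    obtain ⟨V₁, π₁, hπ₁, e, he⟩ := surjective_up_to_refinements_of_epi X.Hπ y
    obtain ⟨V₂, π₂, hπ₂, e', he'⟩ := surjective_up_to_refinements_of_epi Y.Hπ (e ≫ X.Hπ ≫ φ)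
    obtain ⟨m, hm1, hm2⟩ := exists_lift_graph φ h (π₂ ≫ e ≫ X.K₂.arrow) (e' ≫ Y.K₂.arrow)
    have h6 : (graph φ h).K₂.Factors m :=
      (graph_K₂_factors_iff φ h _).2 ⟨π₂ ≫ e, e', by simp [hm1], by simp [hm2], by simpa using he'⟩
    have h7 : (graph φ h).K₂.factorThru _ h6 ≫ subMap (graphFst φ h).f (graphFst φ h).K₂ =
        π₂ ≫ e := by
      rw [← cancel_mono X.K₂.arrow]
      simp [hm1]
    refine ⟨V₂, π₂ ≫ π₁, inferInstance, (graph φ h).K₂.factorThru _ h6 ≫ (graph φ h).Hπ, ?_⟩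
    rw [Category.assoc, Category.assoc, h5, reassoc_of% h7, he]
  exact isIso_of_mono_of_epi _

/-- The map is `(a, b)`; the hypothesis on `H` says exactly that it sends `K₂` into the graph. -/
lemma exists_toGraph {W : FourTuple T F} (a : W ⟶ X) (b : W ⟶ Y)
    (hab : (H T F).map a ≫ φ = (H T F).map b) :
    ∃ m : W ⟶ graph φ h, m ≫ graphFst φ h = a ∧ m ≫ graphSnd φ h = b := by
  obtain ⟨m, hm1, hm2⟩ := exists_lift_graph φ h a.f b.f
  refine ⟨⟨m, ?_, ?_, ?_⟩, ?_, ?_⟩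
  · exact (graph_K₁_factors_iff _ _ _).2 ⟨by simpa [hm1] using a.K₁, by simpa [hm2] using b.K₁⟩
  · refine (graph_K₂_factors_iff φ h _).2 ⟨subMap a.f a.K₂, subMap b.f b.K₂, by simp [hm1],
      by simp [hm2], ?_⟩
    rw [← Category.assoc, ← Hπ_map, Category.assoc, hab, Hπ_map]
  · exact (graph_M_factors_iff _ _ _).2 ⟨by simpa [hm1] using a.M, by simpa [hm2] using b.M⟩
  · ext; exact hm1
  · ext; exact hm2

end graph

lemma hasGraphs (h : IsTorsionPair T F) : HasGraphs (H T F) := fun _ _ φ =>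
  ⟨graph φ h, graphFst φ h, graphSnd φ h, inferInstance, map_graphFst_comp φ h,
    fun _ a b hab => exists_toGraph φ h a b hab⟩

end FourTuple

end

/-! ### Null-homotopic morphisms of complexes in the tilt -/

noncomputable section

namespace TwoTerm

variable {A : Type u} [Category.{v} A] [Abelian A] {X Y Z X' Y' : TwoTerm A}

attribute [local simp] pullback.lift_fst pullback.lift_snd pullback.lift_fst_assoc
  pullback.lift_snd_assoc

open Butterfly

/-- `r` is the component in `Z⁻¹` of the isomorphism from the composite to the strict butterfly,
whose central object is `X⁰ ⊕ Z⁻¹`. -/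
lemma exists_of_comp_eq_ofStrict {P : Butterfly X Y} {Q : Butterfly Y Z} {a : X.neg ⟶ Z.neg}
    {a' : X.zer ⟶ Z.zer} {wa : a ≫ Z.d = X.d ≫ a'}
    (h : ofButterfly P ≫ ofButterfly Q = ofStrict a a' wa) :
    ∃ r : fibre P Q ⟶ Z.neg, diag P Q ≫ r = 0 ∧ pullback.lift P.κ 0 (by simp) ≫ r = -a ∧
      pullback.lift 0 Q.ι (by simp) ≫ r = 𝟙 _ ∧
      pullback.snd _ _ ≫ Q.ρ = pullback.fst _ _ ≫ P.σ ≫ a' + r ≫ Z.d := by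
  rw [ofButterfly_comp, ofButterfly_eq_iff] at h
  obtain ⟨e, h1, h2, h3, h4⟩ := h
  refine ⟨compπ P Q ≫ e.hom ≫ strictSnd a a' wa, ?_, ?_, ?_, ?_⟩
  · rw [← Category.assoc, diag_compπ, zero_comp]
  · rw [← Category.assoc, ← comp_κ, ← Category.assoc, h1, strict_κ_snd]
  · rw [← Category.assoc, ← comp_ι, ← Category.assoc, h2, strict_ι_snd]
  · have h5 := comp_strict_ρ a a' wa (compπ P Q ≫ e.hom)
    simp only [Category.assoc] at h5
    rw [h4, reassoc_of% h3, compπ_ρ, ← Category.assoc (compπ P Q), compπ_σ, Category.assoc] at h5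
    simpa using h5

/-- If the strict morphism of complexes of complexes given by a morphism of butterflies is
null-homotopic, then this morphism sends `ker ρ` to the image of `κ`. -/
theorem exists_factor_of_homotopy {T F : ObjectProperty A} (h : IsTorsionPair T F)
    (P : Butterfly X Y) (P' : Butterfly X' Y') (J : Butterfly Y X') {a : X.neg ⟶ X'.neg}
    {a' : X.zer ⟶ X'.zer} {wa : a ≫ X'.d = X.d ≫ a'} {b : Y.neg ⟶ Y'.neg} {b' : Y.zer ⟶ Y'.zer}
    {wb : b ≫ Y'.d = Y.d ≫ b'} (φ : P.E ⟶ P'.E) (h1 : P.κ ≫ φ = a ≫ P'.κ)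
    (h2 : P.ι ≫ φ = b ≫ P'.ι) (h3 : φ ≫ P'.σ = P.σ ≫ a') (h4 : φ ≫ P'.ρ = P.ρ ≫ b')
    (e₁ : ofButterfly P ≫ ofButterfly J = ofStrict a a' wa)
    (e₂ : ofButterfly J ≫ ofButterfly P' = ofStrict b b' wb)
    (hT : T (cokernel (biprod.desc P.κ P.ι))) (hF : F (kernel (biprod.lift P'.ρ P'.σ))) :
    ∃ t : kernel P.ρ ⟶ X'.neg, kernel.ι P.ρ ≫ φ = t ≫ P'.κ := by
  obtain ⟨r, r1, r2, r3, r4⟩ := exists_of_comp_eq_ofStrict e₁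
  obtain ⟨q, q1, q2, q3, q4⟩ := exists_of_comp_eq_ofStrict e₂
  have hc := pullback.condition (f := P.ρ) (g := J.σ)
  -- the triple fibre product and its projections
  obtain ⟨W, w, e', we, hW, hWepi⟩ : ∃ (W : A) (w : W ⟶ fibre P J) (e' : W ⟶ P'.E)
      (_ : w ≫ pullback.snd _ _ ≫ J.ρ = e' ≫ P'.σ),
      (∀ {V : A} (x : V ⟶ fibre P J) (y : V ⟶ P'.E), x ≫ pullback.snd _ _ ≫ J.ρ = y ≫ P'.σ →
        ∃ z, z ≫ w = x ∧ z ≫ e' = y) ∧ Epi w :=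
    ⟨pullback (pullback.snd P.ρ J.σ ≫ J.ρ) P'.σ, pullback.fst _ _, pullback.snd _ _,
      by simpa using pullback.condition (f := pullback.snd P.ρ J.σ ≫ J.ρ) (g := P'.σ),
      fun x y hxy => ⟨pullback.lift x y (by simpa using hxy), by simp, by simp⟩, inferInstance⟩
  obtain ⟨w₂, hw1, hw2⟩ : ∃ w₂ : W ⟶ fibre J P', w₂ ≫ pullback.fst _ _ = w ≫ pullback.snd _ _ ∧
      w₂ ≫ pullback.snd _ _ = e' := ⟨pullback.lift (w ≫ pullback.snd _ _) e' (by simpa using we),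
        by simp, by simp⟩
  -- On a triple `(e, j, e')`, the trivializations `r` and `q` of the two composites give two
  -- corrections of `e' - φ e`. The combination `D` is killed by both `σ'` and `ρ'`.
  let D : W ⟶ P'.E := e' - w ≫ r ≫ P'.κ - w ≫ pullback.fst _ _ ≫ φ - w₂ ≫ q ≫ P'.ι
  have hD : ∀ {V : A} (x : V ⟶ W), x ≫ D = x ≫ e' - (x ≫ w) ≫ r ≫ P'.κ -
      (x ≫ w) ≫ pullback.fst _ _ ≫ φ - (x ≫ w₂) ≫ q ≫ P'.ι := fun x => by simp [D]
  have hDσ : D ≫ P'.σ = 0 := by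
    simp only [D, Preadditive.sub_comp, Category.assoc, P'.κσ, P'.ισ, h3, comp_zero, ← we, r4,
      Preadditive.comp_add]
    abel
  have hDρ : D ≫ P'.ρ = 0 := by
    have h5 : e' ≫ P'.ρ = w ≫ pullback.fst P.ρ J.σ ≫ P.ρ ≫ b' + w₂ ≫ q ≫ Y'.d := by
      rw [← hw2, Category.assoc, q4, Preadditive.comp_add, reassoc_of% hw1, ← reassoc_of% hc]
    simp only [D, Preadditive.sub_comp, Category.assoc, P'.κρ, P'.ιρ, h4, comp_zero, h5]
    abel
  -- `D` depends only on `e`. If `e = 0`, then locally `j` comes from `t` in `X'⁻¹` and `e' = κ' t +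
  -- ι' m`, and the corrections are exactly `κ' t` and `ι' m`.
  have hDk : kernel.ι (w ≫ pullback.fst P.ρ J.σ) ≫ D = 0 := by
    have hk : kernel.ι (w ≫ pullback.fst P.ρ J.σ) ≫ w ≫ pullback.fst P.ρ J.σ = 0 :=
      kernel.condition _
    generalize kernel.ι (w ≫ pullback.fst P.ρ J.σ) = k at hk
    obtain ⟨V, π, hπ, t, ht⟩ := J.exact.exact.exact_up_to_refinements (k ≫ w ≫ pullback.snd _ _)
      (by dsimp; rw [Category.assoc, Category.assoc, ← hc, reassoc_of% hk, zero_comp])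
    dsimp at t ht
    have hkw : π ≫ k ≫ w = t ≫ pullback.lift 0 J.ι (by simp) := by
      apply pullback.hom_ext
      · simp [hk]
      · simp [ht]
    obtain ⟨V', π', hπ', m, hm⟩ := P'.exact.exact.exact_up_to_refinements (π ≫ k ≫ e' - t ≫ P'.κ)
      (by
        dsimp
        simp only [Preadditive.sub_comp, Category.assoc, ← we, reassoc_of% hkw]
        simp)
    dsimp at m hm
    have he : π' ≫ π ≫ k ≫ e' = π' ≫ t ≫ P'.κ + m ≫ P'.ι := by
      rw [← hm]; simp
    have hkw2 : π' ≫ π ≫ k ≫ w₂ = (π' ≫ t) ≫ diag J P' + m ≫ pullback.lift 0 P'.ι (by simp) := by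
      apply pullback.hom_ext
      · simp [hw1, reassoc_of% hkw]
      · simp [hw2, he]
    apply zero_of_epi_comp π
    apply zero_of_epi_comp π'
    have h5 := hD (π' ≫ π ≫ k)
    simp only [Category.assoc] at h5
    rw [h5, he, reassoc_of% hkw, reassoc_of% hkw, reassoc_of% hkw2]
    simp only [Preadditive.add_comp, Category.assoc, reassoc_of% r3, reassoc_of% q1,
      reassoc_of% q3]
    simp
  -- The induced map on `P.E` kills `κ` and `ι`, so it factors through a torsion quotient into the
  -- torsion-free object `ker (ρ', σ')`.
  have hD0 : D = 0 := by
    have hDbar : (w ≫ pullback.fst P.ρ J.σ) ≫ Abelian.epiDesc _ D hDk = D :=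
      Abelian.comp_epiDesc _ _ _
    generalize Abelian.epiDesc _ D hDk = D' at hDbar
    have : D' = 0 := by
      refine h.eq_zero_of_cokernel_of_kernel _ _ hT hF D' ?_ ?_
      · apply biprod.hom_ext'
        · obtain ⟨z, z1, z2⟩ := hW (pullback.lift P.κ 0 (by simp)) (0 : X.neg ⟶ P'.E) (by simp)
          have h5 : z ≫ D = 0 := by
            have hz : z ≫ w₂ = 0 := by
              apply pullback.hom_ext
              · simp [hw1, reassoc_of% z1]
              · simp [hw2, z2]
            rw [hD, z2, z1, hz, reassoc_of% r2]
            simp [h1]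
          rw [biprod.inl_desc_assoc, comp_zero, ← h5, ← hDbar, Category.assoc, reassoc_of% z1]
          simp
        · obtain ⟨z, z1, z2⟩ := hW (diag P J) (0 : Y.neg ⟶ P'.E) (by simp)
          have h5 : z ≫ D = 0 := by
            have hz : z ≫ w₂ = pullback.lift J.κ 0 (by simp) := by
              apply pullback.hom_ext
              · simp [hw1, reassoc_of% z1]
              · simp [hw2, z2]
            rw [hD, z2, z1, hz, reassoc_of% r1, reassoc_of% q2]
            simp [h2]
          rw [biprod.inr_desc_assoc, comp_zero, ← h5, ← hDbar, Category.assoc, reassoc_of% z1]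
          simp
      · rw [← cancel_epi (w ≫ pullback.fst P.ρ J.σ), ← Category.assoc, hDbar, comp_zero]
        apply biprod.hom_ext
        · simp [hDρ]
        · simp [hDσ]
    rw [← hDbar, this, comp_zero]
  -- For `e ∈ ker ρ` the triple `(e, 0, 0)` is allowed, and the vanishing of `D` there reads `φ e =
  -- -κ' (r (e, 0))`.
  obtain ⟨z, z1, z2⟩ := hW (pullback.lift (kernel.ι P.ρ) 0 (by simp)) (0 : _ ⟶ P'.E) (by simp)
  have hz : z ≫ w₂ = 0 := by
    apply pullback.hom_ext
    · simp [hw1, reassoc_of% z1]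
    · simp [hw2, z2]
  have h5 := hD z
  rw [hD0, z2, z1, hz] at h5
  refine ⟨-(pullback.lift (kernel.ι P.ρ) 0 (by simp) ≫ r), ?_⟩
  rw [comp_zero, pullback.lift_fst_assoc, zero_comp (f := q ≫ P'.ι), sub_zero, zero_sub] at h5
  rw [Preadditive.neg_comp, Category.assoc]
  exact (sub_eq_zero.1 h5.symm).symm

end TwoTerm
end

/-! ### 4-tuples as models of butterflies -/

noncomputable section

namespace FourTuple

variable {A : Type u} [Category.{v} A] [Abelian A] {T F : ObjectProperty A}

open TwoTerm HRSTilt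

lemma factors_of_comp_π {E V : A} {K : Subobject E} {f : V ⟶ E}
    (hf : f ≫ cokernel.π K.arrow = 0) : K.Factors f := by
  have := Subobject.factors_comp_arrow (P := K) (Abelian.monoLift K.arrow f hf)
  rwa [Abelian.monoLift_comp] at this

lemma isIso_cokernel_desc {E Z : A} {K : Subobject E} (g : E ⟶ Z) [Epi g] (w : K.arrow ≫ g = 0)
    (hK : ∀ ⦃V : A⦄ (f : V ⟶ E), f ≫ g = 0 → K.Factors f) : IsIso (cokernel.desc K.arrow g w) := by
  have : Epi (cokernel.desc K.arrow g w) := epi_of_epi_fac (cokernel.π_desc _ _ w)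
  have : Mono (cokernel.desc K.arrow g w) := by
    rw [Preadditive.mono_iff_cancel_zero]
    intro V z hz
    obtain ⟨V', π, hπ, l, hl⟩ := surjective_up_to_refinements_of_epi (cokernel.π K.arrow) z
    have h1 : K.Factors l := hK l (by
      rw [← cokernel.π_desc _ _ w, ← reassoc_of% hl, hz, comp_zero])
    apply zero_of_epi_comp π
    rw [hl, ← Subobject.factorThru_arrow _ _ h1, Category.assoc, cokernel.condition, comp_zero]
  exact isIso_of_mono_of_epi _

/-- A 4-tuple with an isomorphism of its butterfly with a given one. -/
structure Model {X Y : TwoTerm A} (P : Butterfly X Y) (Q : FourTuple T F) where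
  e : Q.E ≅ P.E
  k : (Q.K₁ : A) ≅ X.neg
  m : (Q.M : A) ≅ Y.neg
  c : cokernel Q.M.arrow ≅ X.zer
  c' : cokernel Q.K₂.arrow ≅ Y.zer
  k_κ : k.hom ≫ P.κ = Q.K₁.arrow ≫ e.hom
  m_ι : m.hom ≫ P.ι = Q.M.arrow ≫ e.hom
  π_c : cokernel.π Q.M.arrow ≫ c.hom = e.hom ≫ P.σ
  π_c' : cokernel.π Q.K₂.arrow ≫ c'.hom = e.hom ≫ P.ρ

/-- Take `K₁ = im κ`, `K₂ = ker ρ` and `M = im ι`. Then `K₂ ∩ M` is `ker Y.d` and `E / (K₁ + M)` is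
`coker X.d`, so the two conditions are those for `Y` and `X` to lie in the tilt. -/
lemma exists_model (h : IsTorsionPair T F) {X Y : TwoTerm A} (hX : tiltProperty T F X)
    (hY : tiltProperty T F Y) (P : Butterfly X Y) [Mono P.κ] [Epi P.ρ] :
    ∃ Q : FourTuple T F, Nonempty (Model P Q) := by
  have hle : Subobject.mk P.κ ≤ kernelSubobject P.ρ := le_kernelSubobject _ _ (by
    rw [← Subobject.underlyingIso_hom_comp_eq_mk P.κ, Category.assoc, P.κρ, comp_zero])
  let Q : FourTuple T F :=
    { E := P.E
      K₁ := Subobject.mk P.κ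
      K₂ := kernelSubobject P.ρ
      M := Subobject.mk P.ι
      le := hle
      free := by
        rw [free_iff _ _ h]
        intro V hV f h1 h2
        rw [kernelSubobject_factors_iff] at h1
        obtain ⟨l, rfl⟩ : ∃ l, l ≫ P.ι = f := h2
        have h3 : l ≫ Y.d = 0 := by simpa using h1
        rw [← kernel.lift_ι Y.d l h3, h.hom_eq_zero hV hY.1 (kernel.lift Y.d l h3), zero_comp,
          zero_comp]
      torsion := by
        rw [torsion_iff _ _ h]
        intro V hV f h1 h2
        rw [← Subobject.underlyingIso_hom_comp_eq_mk, Category.assoc] at h1 h2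
        have h1 := zero_of_epi_comp _ h1
        have h2 := zero_of_epi_comp _ h2
        have h3 : P.σ ≫ P.exact.exact.desc f h2 = f := P.exact.exact.g_desc f h2
        have h4 : X.d ≫ P.exact.exact.desc f h2 = 0 := by
          rw [← P.κσ, Category.assoc, h3, h1]
        rw [← h3, ← cokernel.π_desc X.d _ h4,
          h.hom_eq_zero hX.2 hV (cokernel.desc X.d _ h4), comp_zero, comp_zero] }
  have w1 : (Subobject.mk P.ι).arrow ≫ P.σ = 0 := by
    rw [← Subobject.underlyingIso_hom_comp_eq_mk P.ι, Category.assoc, P.ισ, comp_zero]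
  have w2 : (kernelSubobject P.ρ).arrow ≫ P.ρ = 0 := kernelSubobject_arrow_comp _
  have i1 : IsIso (cokernel.desc _ P.σ w1) := isIso_cokernel_desc P.σ w1 fun V f hf =>
    ⟨P.exact.exact.lift f hf, P.exact.exact.lift_f f hf⟩
  have i2 : IsIso (cokernel.desc _ P.ρ w2) := isIso_cokernel_desc P.ρ w2 fun V f hf =>
    kernelSubobject_factors _ _ hf
  exact ⟨Q, ⟨{
    e := Iso.refl _
    k := Subobject.underlyingIso P.κ
    m := Subobject.underlyingIso P.ι
    c := asIso (cokernel.desc _ P.σ w1)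
    c' := asIso (cokernel.desc _ P.ρ w2)
    k_κ := (Subobject.underlyingIso_hom_comp_eq_mk P.κ).trans (Category.comp_id _).symm
    m_ι := (Subobject.underlyingIso_hom_comp_eq_mk P.ι).trans (Category.comp_id _).symm
    π_c := (cokernel.π_desc _ _ w1).trans (Category.id_comp _).symm
    π_c' := (cokernel.π_desc _ _ w2).trans (Category.id_comp _).symm }⟩⟩

namespace Model

variable {X Y : TwoTerm A} {P : Butterfly X Y} {Q : FourTuple T F} (μ : Model P Q)

attribute [local simp] Model.k_κ Model.m_ι Model.π_c Model.π_c'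

lemma src_w : μ.k.hom ≫ X.d = (Q.K₁.arrow ≫ cokernel.π Q.M.arrow) ≫ μ.c.hom := by
  rw [Category.assoc, μ.π_c, ← reassoc_of% μ.k_κ, P.κσ]

lemma tgt_w : μ.m.hom ≫ Y.d = (Q.M.arrow ≫ cokernel.π Q.K₂.arrow) ≫ μ.c'.hom := by
  rw [Category.assoc, μ.π_c', ← reassoc_of% μ.m_ι, P.ιρ]

/-- The morphism of 4-tuples given by a map of central objects. -/
lemma exists_hom {R : FourTuple T F}
    {a : X.neg ⟶ (R.K₁ : A)} {b : Y.neg ⟶ (R.M : A)} {a' : X.zer ⟶ cokernel R.M.arrow}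
    {b' : Y.zer ⟶ cokernel R.K₂.arrow} (φ : P.E ⟶ R.E) (h1 : P.κ ≫ φ = a ≫ R.K₁.arrow)
    (h2 : P.ι ≫ φ = b ≫ R.M.arrow) (h3 : φ ≫ cokernel.π R.M.arrow = P.σ ≫ a')
    (h4 : φ ≫ cokernel.π R.K₂.arrow = P.ρ ≫ b') :
    ∃ f : Q ⟶ R, subMap f.f f.K₁ = μ.k.hom ≫ a ∧ subMap f.f f.M = μ.m.hom ≫ b ∧
      quotMap f.f f.M = μ.c.hom ≫ a' ∧ quotMap f.f f.K₂ = μ.c'.hom ≫ b' := by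
  have e1 : Q.K₁.arrow ≫ μ.e.hom ≫ φ = (μ.k.hom ≫ a) ≫ R.K₁.arrow := by
    rw [← reassoc_of% μ.k_κ, h1, Category.assoc]
  have e2 : Q.M.arrow ≫ μ.e.hom ≫ φ = (μ.m.hom ≫ b) ≫ R.M.arrow := by
    rw [← reassoc_of% μ.m_ι, h2, Category.assoc]
  let f : Q ⟶ R :=
    { f := μ.e.hom ≫ φ
      K₁ := by rw [e1]; exact Subobject.factors_comp_arrow _
      K₂ := factors_of_comp_π (by
        rw [Category.assoc, Category.assoc, h4, ← Category.assoc μ.e.hom, ← μ.π_c', Category.assoc,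
          cokernel.condition_assoc, zero_comp])
      M := by rw [e2]; exact Subobject.factors_comp_arrow _ }
  refine ⟨f, ?_, ?_, ?_, ?_⟩
  · rw [← cancel_mono R.K₁.arrow, ← e1]; simp [f]
  · rw [← cancel_mono R.M.arrow, ← e2]; simp [f]
  · rw [← cancel_epi (cokernel.π Q.M.arrow), reassoc_of% μ.π_c, ← h3]; simp [f]
  · rw [← cancel_epi (cokernel.π Q.K₂.arrow), reassoc_of% μ.π_c', ← h4]; simp [f]

end Model

section

variable (h : IsTorsionPair T F) {X Y : HRSTilt T F} {P : Butterfly X.obj Y.obj}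
  {Q : FourTuple T F} (μ : Model P Q)

/-- The comparison of the source of a 4-tuple with that of the butterfly that it models. -/
def Model.src : (FourTuple.src h).obj Q ⟶ X :=
  ObjectProperty.homMk (ofStrict (X := ⟨_, _, Q.K₁.arrow ≫ cokernel.π Q.M.arrow⟩) μ.k.hom μ.c.hom μ.src_w)

/-- The comparison of the target of a 4-tuple with that of the butterfly that it models. -/
def Model.tgt : (FourTuple.tgt h).obj Q ⟶ Y :=
  ObjectProperty.homMk (ofStrict (X := ⟨_, _, Q.M.arrow ≫ cokernel.π Q.K₂.arrow⟩) μ.m.hom μ.c'.hom μ.tgt_w)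

instance : IsIso (μ.src h) := by
  exact (isIso_homMk_iff _).2 (isIso_ofStrict
    (X := ⟨_, _, Q.K₁.arrow ≫ cokernel.π Q.M.arrow⟩) _ _ μ.src_w)

instance : IsIso (μ.tgt h) := by
  exact (isIso_homMk_iff _).2 (isIso_ofStrict
    (X := ⟨_, _, Q.M.arrow ≫ cokernel.π Q.K₂.arrow⟩) _ _ μ.tgt_w)

lemma Model.comm : μ.src h ≫ ObjectProperty.homMk (ofButterfly P) = toTiltHom h Q ≫ μ.tgt h := by
  apply ObjectProperty.hom_ext
  symm
  refine (square_iff Q.butterfly P _ _ μ.src_w _ _ μ.tgt_w).2 ⟨Q.toE ≫ μ.e.hom, ?_, ?_, ?_, ?_⟩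
  · rw [butterfly_κ]; simp [μ.k_κ]
  · rw [butterfly_ι]; simp [μ.m_ι]
  · rw [butterfly_σ]; simp [μ.π_c]
  · rw [butterfly_ρ]; simp [μ.π_c']

/-- Every morphism of complexes that is strict in each degree comes from 4-tuples. -/
lemma Model.exists_hom_of_square {R : FourTuple T F} {a : X.obj.neg ⟶ (R.K₁ : A)}
    {a' : X.obj.zer ⟶ cokernel R.M.arrow} (wa : a ≫ R.K₁.arrow ≫ cokernel.π R.M.arrow = X.obj.d ≫ a')
    {b : Y.obj.neg ⟶ (R.M : A)} {b' : Y.obj.zer ⟶ cokernel R.K₂.arrow}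
    (wb : b ≫ R.M.arrow ≫ cokernel.π R.K₂.arrow = Y.obj.d ≫ b') {u : X ⟶ (FourTuple.src h).obj R}
    {v : Y ⟶ (FourTuple.tgt h).obj R}
    (hu : u.hom = ofStrict (Y := ⟨_, _, R.K₁.arrow ≫ cokernel.π R.M.arrow⟩) a a' wa)
    (hv : v.hom = ofStrict (Y := ⟨_, _, R.M.arrow ≫ cokernel.π R.K₂.arrow⟩) b b' wb)
    (w : u ≫ toTiltHom h R = ObjectProperty.homMk (ofButterfly P) ≫ v) :
    ∃ f : Q ⟶ R, (FourTuple.src h).map f = μ.src h ≫ u ∧ (FourTuple.tgt h).map f = μ.tgt h ≫ v := by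
  have w' : ofButterfly P ≫ v.hom = u.hom ≫ ofButterfly R.butterfly := congr(($w).hom).symm
  rw [hu, hv] at w'
  -- The commutative square in the tilt yields an actual map of central objects, which is a morphism
  -- of 4-tuples.
  obtain ⟨φ, h1, h2, h3, h4⟩ := (square_iff P R.butterfly _ _ wa _ _ wb).1 w'
  obtain ⟨f, f1, f2, f3, f4⟩ := μ.exists_hom (a := a) (b := b) (φ ≫ R.toE)
    (by rw [reassoc_of% h1, butterfly_κ]; simp) (by rw [reassoc_of% h2, butterfly_ι]; simp)
    (by rw [Category.assoc, ← butterfly_σ, h3]) (by rw [Category.assoc, ← butterfly_ρ, h4])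
  refine ⟨f, ObjectProperty.hom_ext _ ?_, ObjectProperty.hom_ext _ ?_⟩
  · refine Eq.trans ?_ (congrArg (_ ≫ ·) hu.symm)
    refine Eq.trans (ofStrict_congr f1 f3 _) (ofStrict_comp _ _ μ.src_w _ _ wa).symm
  · refine Eq.trans ?_ (congrArg (_ ≫ ·) hv.symm)
    refine Eq.trans (ofStrict_congr f2 f4 _) (ofStrict_comp _ _ μ.tgt_w _ _ wb).symm

end

end FourTuple

end

/-! ### Additivity, faithfulness and essential surjectivity of the inclusion -/

noncomputable section

lemma TwoTerm.isQis_of_isIso {A : Type u} [Category.{v} A] [Abelian A] {X Y : TwoTerm A}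
    (a : X.neg ⟶ Y.neg) (a' : X.zer ⟶ Y.zer) (w : a ≫ Y.d = X.d ≫ a') [IsIso a] [IsIso a'] :
    IsQis a a' w :=
  ⟨(kernel.mapIso X.d Y.d (asIso a) (asIso a') w.symm).isIso_hom,
    (cokernel.mapIso X.d Y.d (asIso a) (asIso a') w.symm).isIso_hom⟩

namespace FourTuple

variable {A : Type u} [Category.{v} A] [Abelian A] {T F : ObjectProperty A}

open TwoTerm HRSTilt

section additive

lemma subMap_add {Q R : FourTuple T F} {U : Subobject Q.E} {V : Subobject R.E} (a b : Q.E ⟶ R.E)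
    (ha : V.Factors (U.arrow ≫ a)) (hb : V.Factors (U.arrow ≫ b))
    (hab : V.Factors (U.arrow ≫ (a + b))) : subMap (a + b) hab = subMap a ha + subMap b hb := by
  rw [← cancel_mono V.arrow]; simp

lemma quotMap_add {Q R : FourTuple T F} {U : Subobject Q.E} {V : Subobject R.E} (a b : Q.E ⟶ R.E)
    (ha : V.Factors (U.arrow ≫ a)) (hb : V.Factors (U.arrow ≫ b))
    (hab : V.Factors (U.arrow ≫ (a + b))) : quotMap (a + b) hab = quotMap a ha + quotMap b hb := by
  rw [← cancel_epi (cokernel.π U.arrow)]; simp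

instance additive_H : (H T F).Additive where
  map_add {Q R a b} := by
    rw [← cancel_epi Q.Hπ, Preadditive.comp_add, Hπ_map, Hπ_map, Hπ_map, ← Preadditive.add_comp]
    congr 1
    exact subMap_add _ _ _ _ _

variable [Preadditive (HRSTilt T F)] (h : IsTorsionPair T F)

lemma additive_src : (src h).Additive where
  map_add {Q R a b} := by
    refine Eq.trans (ObjectProperty.hom_ext _ (ofStrict_congr
      (X := ⟨_, _, Q.K₁.arrow ≫ cokernel.π Q.M.arrow⟩)
      (Y := ⟨_, _, R.K₁.arrow ≫ cokernel.π R.M.arrow⟩)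
      (subMap_add _ _ a.K₁ b.K₁ (a + b).K₁) (quotMap_add _ _ a.M b.M (a + b).M) _))
      (ofStrict_add h (X := (src h).obj Q) (Y := (src h).obj R) _ _ _ _
        (Arrow.Hom.w ((srcArrow T F).map a)) (Arrow.Hom.w ((srcArrow T F).map b)))

lemma additive_tgt : (tgt h).Additive where
  map_add {Q R a b} := by
    refine Eq.trans (ObjectProperty.hom_ext _ (ofStrict_congr
      (X := ⟨_, _, Q.M.arrow ≫ cokernel.π Q.K₂.arrow⟩)
      (Y := ⟨_, _, R.M.arrow ≫ cokernel.π R.K₂.arrow⟩)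
      (subMap_add _ _ a.M b.M (a + b).M) (quotMap_add _ _ a.K₂ b.K₂ (a + b).K₂) _))
      (ofStrict_add h (X := (tgt h).obj Q) (Y := (tgt h).obj R) _ _ _ _
        (Arrow.Hom.w ((tgtArrow T F).map a)) (Arrow.Hom.w ((tgtArrow T F).map b)))

end additive

variable [Abelian (HRSTilt T F)] (h : IsTorsionPair T F)

/-- The complexes given by 4-tuples are objects of the iterated tilt. -/
lemma toArrow_tilt (Q : FourTuple T F) : tiltProperty (tiltTorsion T F) (tiltFree T F)
    ((toArrow h ⋙ strictFunctor (HRSTilt T F)).obj Q) :=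
  (tiltProperty_iff h (X := (src h).obj Q) (Y := (tgt h).obj Q) (P := Q.butterfly)).2
    ⟨inferInstanceAs (Mono Q.butterfly.κ), inferInstanceAs (Epi Q.butterfly.ρ)⟩

variable (hC : ∀ Q, tiltProperty (tiltTorsion T F) (tiltFree T F)
      ((toArrow h ⋙ strictFunctor (HRSTilt T F)).obj Q))

lemma isInvertedBy_inclusion : (quasiIso h).IsInvertedBy (inclusion h hC) := fun _ _ f hf =>
  (isIso_homMk_iff _).2 (IsQis.isIso (w := toTiltHom_naturality h f) hf)

lemma additive_inclusion [Preadditive (IteratedTilt T F)] : (inclusion h hC).Additive where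
  map_add {Q R a b} := by
    have := additive_src h
    have := additive_tgt h
    refine Eq.trans (ObjectProperty.hom_ext _ (ofStrict_congr
      (X := ⟨_, _, toTiltHom h Q⟩) (Y := ⟨_, _, toTiltHom h R⟩)
      ((src h).map_add (f := a) (g := b)) ((tgt h).map_add (f := a) (g := b)) _))
      (ofStrict_add (isTorsionPair h) _ _ _ _ _ _)

/-- Equal images mean that `b - a` is null-homotopic as a morphism of complexes in the tilt. A
butterfly for the homotopy then shows that `b - a` sends `K₂` into `K₁'`, so it vanishes under `H`.
-/
lemma map_eq_of_inclusion_map_eq {Q R : FourTuple T F} (a b : Q ⟶ R)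
    (hab : (inclusion h hC).map a = (inclusion h hC).map b) :
    (H T F).map a = (H T F).map b := by
  have := additive_src h
  have := additive_tgt h
  obtain ⟨t, ht1, ht2⟩ := (ofStrict_eq_iff (X := ⟨_, _, toTiltHom h Q⟩)
    (Y := ⟨_, _, toTiltHom h R⟩) _ _ (toTiltHom_naturality h a) _ _
    (toTiltHom_naturality h b)).1 congr(($hab).hom)
  change toTiltHom h Q ≫ t = (src h).map b - (src h).map a at ht1
  change t ≫ toTiltHom h R = (tgt h).map b - (tgt h).map a at ht2
  rw [← Functor.map_sub] at ht1 ht2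
  obtain ⟨J, hJ⟩ := ofButterfly_surjective t.hom
  have e1 := congr(($ht1).hom)
  have e2 := congr(($ht2).hom)
  change ofButterfly Q.butterfly ≫ t.hom = _ at e1
  change t.hom ≫ ofButterfly R.butterfly = _ at e2
  rw [hJ] at e1 e2
  set f := b - a with hf
  -- This cokernel is `E / (K₁ + M)`, and the kernel in `hF` is `K₂ ∩ M` for `R`: the two defining
  -- conditions of a 4-tuple are what the homotopy argument requires.
  have hT : T (cokernel (biprod.desc Q.butterfly.κ Q.butterfly.ι)) := by
    refine h.T_of_hom_eq_zero fun V hV g => ?_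
    refine (cancel_epi (cokernel.π (biprod.desc Q.butterfly.κ Q.butterfly.ι))).1 ?_
    have h1 : Q.butterfly.κ ≫ cokernel.π (biprod.desc Q.butterfly.κ Q.butterfly.ι) ≫ g = 0 := by
      rw [← biprod.inl_desc_assoc Q.butterfly.κ Q.butterfly.ι, cokernel.condition_assoc, zero_comp,
        comp_zero]
    have h2 : Q.butterfly.ι ≫ cokernel.π (biprod.desc Q.butterfly.κ Q.butterfly.ι) ≫ g = 0 := by
      rw [← biprod.inr_desc_assoc Q.butterfly.κ Q.butterfly.ι, cokernel.condition_assoc, zero_comp,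
        comp_zero]
    rw [comp_zero]
    exact (torsion_iff _ _ h).1 Q.torsion hV _ h1 h2
  have hF : F (kernel (biprod.lift R.butterfly.ρ R.butterfly.σ)) := by
    refine h.F_of_hom_eq_zero fun V hV g => ?_
    refine (cancel_mono (kernel.ι (biprod.lift R.butterfly.ρ R.butterfly.σ))).1 ?_
    have h1 : (g ≫ kernel.ι (biprod.lift R.butterfly.ρ R.butterfly.σ)) ≫ R.butterfly.ρ = 0 := by
      have := congr(g ≫ $(kernel.condition (biprod.lift R.butterfly.ρ R.butterfly.σ)) ≫ biprod.fst)
      simpa only [Category.assoc, biprod.lift_fst, zero_comp, comp_zero] using this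
    have h2 : (g ≫ kernel.ι (biprod.lift R.butterfly.ρ R.butterfly.σ)) ≫ R.butterfly.σ = 0 := by
      have := congr(g ≫ $(kernel.condition (biprod.lift R.butterfly.ρ R.butterfly.σ)) ≫ biprod.snd)
      simpa only [Category.assoc, biprod.lift_snd, zero_comp, comp_zero] using this
    rw [zero_comp]
    exact (free_iff _ _ h).1 R.free hV _ (factors_of_comp_π h1) (factors_of_comp_π h2)
  obtain ⟨s, hs⟩ := exists_factor_of_homotopy h Q.butterfly R.butterfly J (centre f) (κ_centre f)
    (ι_centre f) (centre_σ f) (centre_ρ f) e1 e2 hT hF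
  suffices h0 : (H T F).map f = 0 by
    rw [hf, Functor.map_sub, sub_eq_zero] at h0
    exact h0.symm
  rw [← cancel_epi Q.Hπ, Hπ_map, comp_zero]
  have hk : (Q.K₂.arrow ≫ Q.fromE) ≫ Q.butterfly.ρ = 0 := by simp [butterfly_ρ]
  have h3 : subMap f.f f.K₂ = (kernel.lift _ _ hk ≫ s) ≫ Subobject.ofLE R.K₁ R.K₂ R.le := by
    rw [← cancel_mono R.K₂.arrow]
    have h4 : kernel.lift _ _ hk ≫ (kernel.ι Q.butterfly.ρ ≫ centre f) ≫ R.toE =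
        kernel.lift _ _ hk ≫ (s ≫ R.butterfly.κ) ≫ R.toE := by rw [hs]
    rw [Category.assoc, kernel.lift_ι_assoc, butterfly_κ] at h4
    simpa [centre] using h4
  rw [h3, Category.assoc, ofLE_Hπ, comp_zero]

/-- The differential of `V` is a butterfly with `κ` mono and `ρ` epi, hence has a 4-tuple as a
model, and the comparison is invertible in each degree. -/
lemma inclusion_essSurj (V : IteratedTilt T F) :
    ∃ Q : FourTuple T F, Nonempty ((inclusion h hC).obj Q ≅ V) := by
  obtain ⟨P, hP⟩ := ofButterfly_surjective V.obj.d.hom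
  have hd : V.obj.d = ObjectProperty.homMk (ofButterfly P) := ObjectProperty.hom_ext _ hP
  have hV : tiltProperty (tiltTorsion T F) (tiltFree T F)
      ⟨V.obj.neg, V.obj.zer, ObjectProperty.homMk (ofButterfly P)⟩ := by
    rw [← hd]; exact V.property
  obtain ⟨i1, i2⟩ := (tiltProperty_iff h).1 hV
  obtain ⟨Q, ⟨μ⟩⟩ := exists_model h V.obj.neg.property V.obj.zer.property P
  have w : μ.src h ≫ V.obj.d = toTiltHom h Q ≫ μ.tgt h := by rw [hd, μ.comm]
  have : IsIso (ObjectProperty.homMk (ofStrict (X := ⟨_, _, toTiltHom h Q⟩) (μ.src h) (μ.tgt h) w) :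
      (inclusion h hC).obj Q ⟶ V) :=
    (isIso_homMk_iff _).2 (isIso_ofStrict (X := ⟨_, _, toTiltHom h Q⟩) _ _ w)
  exact ⟨Q, ⟨asIso (ObjectProperty.homMk
    (ofStrict (X := ⟨_, _, toTiltHom h Q⟩) (μ.src h) (μ.tgt h) w))⟩⟩

end FourTuple

end

/-! ### Morphisms of the iterated tilt as fractions, and the conclusion -/

noncomputable section

namespace FourTuple

variable {A : Type u} [Category.{v} A] [Abelian A] {T F : ObjectProperty A}

open TwoTerm HRSTilt

variable [Abelian (HRSTilt T F)] (h : IsTorsionPair T F)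
  (hC : ∀ Q, tiltProperty (tiltTorsion T F) (tiltFree T F)
      ((toArrow h ⋙ strictFunctor (HRSTilt T F)).obj Q))

/-- Every morphism of the iterated tilt between 4-tuples is a fraction. -/
lemma inclusion_exists_fraction {X Y : FourTuple T F}
    (u : (inclusion h hC).obj X ⟶ (inclusion h hC).obj Y) :
    ∃ (Z : FourTuple T F) (s : Z ⟶ X) (t : Z ⟶ Y), quasiIso h s ∧
      (inclusion h hC).map s ≫ u = (inclusion h hC).map t := by
  have := h.isoT
  have := h.isoF
  have hTF := isTorsionPair h
  have := hTF.isoT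
  have := hTF.isoF
  -- Outer strictification: `u` becomes a fraction of morphisms of complexes in the tilt, whose
  -- components are still arbitrary butterflies.
  obtain ⟨Z, p, p', wp, q, q', wq, hp, hpq⟩ := exists_strict_source (X := ⟨_, _, toTiltHom h X⟩)
    (Y := ⟨_, _, toTiltHom h Y⟩) u.hom
  have hZ : tiltProperty (tiltTorsion T F) (tiltFree T F) Z := (hp.tilt _ _).2 (hC X)
  -- Inner strictification: in each degree the components towards `X` and `Y` become strict
  -- simultaneously over a common quasi-isomorphism.
  obtain ⟨N, m, m', wm, r, r', wr, s, s', ws, hm, hr, hs⟩ := exists_strict_source₂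
    (Y := ⟨_, _, X.K₁.arrow ≫ cokernel.π X.M.arrow⟩)
    (Y' := ⟨_, _, Y.K₁.arrow ≫ cokernel.π Y.M.arrow⟩) p.hom q.hom
  obtain ⟨O, n, n', wn, y, y', wy, z, z', wz, hn, hy, hz⟩ := exists_strict_source₂
    (Y := ⟨_, _, X.M.arrow ≫ cokernel.π X.K₂.arrow⟩)
    (Y' := ⟨_, _, Y.M.arrow ≫ cokernel.π Y.K₂.arrow⟩) p'.hom q'.hom
  let N' : HRSTilt T F := ⟨N, (hm.tilt T F).2 Z.neg.property⟩
  let O' : HRSTilt T F := ⟨O, (hn.tilt T F).2 Z.zer.property⟩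
  let α : N' ⟶ Z.neg := ObjectProperty.homMk (ofStrict m m' wm)
  let β : O' ⟶ Z.zer := ObjectProperty.homMk (ofStrict n n' wn)
  have : IsIso α := (isIso_homMk_iff _).2 hm.isIso
  have : IsIso β := (isIso_homMk_iff _).2 hn.isIso
  -- The differential of `Z` is transported to `N' ⟶ O'`; the new complex is isomorphic to `Z`, so
  -- it is still an object of the iterated tilt and has a 4-tuple as a model.
  obtain ⟨P, hP⟩ := ofButterfly_surjective (α ≫ Z.d ≫ inv β).hom
  have hd : (ObjectProperty.homMk (ofButterfly P) : N' ⟶ O') = α ≫ Z.d ≫ inv β :=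
    ObjectProperty.hom_ext _ hP.symm
  have hdβ : (ObjectProperty.homMk (ofButterfly P) : N' ⟶ O') ≫ β = α ≫ Z.d := by simp [hd]
  have hαβ : IsQis (X := ⟨N', O', ObjectProperty.homMk (ofButterfly P)⟩) α β hdβ.symm :=
    isQis_of_isIso _ _ _
  obtain ⟨i1, i2⟩ := (tiltProperty_iff h).1 ((hαβ.tilt _ _).2 hZ)
  obtain ⟨Q, ⟨μ⟩⟩ := exists_model h N'.property O'.property P
  obtain ⟨f, f1, f2⟩ := μ.exists_hom_of_square h (R := X) wr wy (u := α ≫ p) (v := β ≫ p') hr hy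
    (by rw [Category.assoc, reassoc_of% hdβ]; exact congrArg (α ≫ ·) wp)
  obtain ⟨g, g1, g2⟩ := μ.exists_hom_of_square h (R := Y) ws wz (u := α ≫ q) (v := β ≫ q') hs hz
    (by rw [Category.assoc, reassoc_of% hdβ]; exact congrArg (α ≫ ·) wq)
  have w : (μ.src h ≫ α) ≫ Z.d = toTiltHom h Q ≫ μ.tgt h ≫ β := by
    rw [Category.assoc, ← hdβ, ← Category.assoc, μ.comm, Category.assoc]
  have hw : IsQis (X := ⟨_, _, toTiltHom h Q⟩) (μ.src h ≫ α) (μ.tgt h ≫ β) w :=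
    isQis_of_isIso _ _ _
  refine ⟨Q, f, g, ?_, ObjectProperty.hom_ext _ ?_⟩
  -- `f` induces the degreewise isomorphism onto `Z` followed by the quasi-isomorphism `(p, p')`.
  · have key : ∀ {a : (src h).obj Q ⟶ (src h).obj X} {b : (tgt h).obj Q ⟶ (tgt h).obj X}
        (wab : a ≫ toTiltHom h X = toTiltHom h Q ≫ b), a = (μ.src h ≫ α) ≫ p →
        b = (μ.tgt h ≫ β) ≫ p' → IsQis (X := ⟨_, _, toTiltHom h Q⟩)
          (Y := ⟨_, _, toTiltHom h X⟩) a b wab := by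
      rintro a b wab rfl rfl
      exact hw.comp hp
    exact key (toTiltHom_naturality h f) (by rw [f1, Category.assoc]) (by rw [f2, Category.assoc])
  · have e1 : ((inclusion h hC).map f).hom = ofStrict (X := ⟨_, _, toTiltHom h Q⟩) _ _ w ≫
        ofStrict (Y := ⟨_, _, toTiltHom h X⟩) p p' wp :=
      (ofStrict_congr (X := ⟨_, _, toTiltHom h Q⟩) (Y := ⟨_, _, toTiltHom h X⟩)
        (f1.trans (Category.assoc _ _ _).symm) (f2.trans (Category.assoc _ _ _).symm) _).trans
        (ofStrict_comp _ _ w _ _ wp).symm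
    have e2 : ((inclusion h hC).map g).hom = ofStrict (X := ⟨_, _, toTiltHom h Q⟩) _ _ w ≫
        ofStrict (Y := ⟨_, _, toTiltHom h Y⟩) q q' wq :=
      (ofStrict_congr (X := ⟨_, _, toTiltHom h Q⟩) (Y := ⟨_, _, toTiltHom h Y⟩)
        (g1.trans (Category.assoc _ _ _).symm) (g2.trans (Category.assoc _ _ _).symm) _).trans
        (ofStrict_comp _ _ w _ _ wq).symm
    refine (congrArg (· ≫ u.hom) e1).trans (Eq.trans ?_ e2.symm)
    exact (Category.assoc _ _ _).trans (congrArg (_ ≫ ·) hpq)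

lemma lift_inclusion_isEquivalence (hS : (quasiIso h).IsInvertedBy (inclusion h hC)) :
    (Localization.Construction.lift (inclusion h hC) hS).IsEquivalence :=
  HasGraphs.lift_isEquivalence (fun _ _ f => quasiIso_iff h f) (hasGraphs h) _ hS
    (fun _ _ u => inclusion_exists_fraction h hC u) (fun _ _ a b => map_eq_of_inclusion_map_eq h hC a b)
    (inclusion_essSurj h hC)

end FourTuple

end

theorem propositionP {A : Type u} [Category.{v} A] [Abelian A] (T F : ObjectProperty A)
    (hTF : IsTorsionPair T F) :
    -- the tilt `B` is abelian, with torsion pair `(F[1], T)`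
    ∃ _ : Abelian (HRSTilt T F), IsTorsionPair (tiltTorsion T F) (tiltFree T F) ∧
    -- 4-tuples give objects of the iterated tilt `C`, and `C` is abelian
    ∃ (hC : ∀ Q, TwoTerm.tiltProperty (tiltTorsion T F) (tiltFree T F)
        ((FourTuple.toArrow hTF ⋙ TwoTerm.strictFunctor (HRSTilt T F)).obj Q))
      (_ : Abelian (IteratedTilt T F))
      (_ : Abelian (FourTuple.quasiIso hTF).Localization)
      (hS : (FourTuple.quasiIso hTF).IsInvertedBy (FourTuple.inclusion hTF hC)),
      -- the inclusion induces an additive equivalence of abelian categories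
      (FourTuple.quasiIso hTF).Q.Additive ∧
      (FourTuple.inclusion hTF hC).Additive ∧
      (Localization.Construction.lift (FourTuple.inclusion hTF hC) hS).Additive ∧
      (Localization.Construction.lift (FourTuple.inclusion hTF hC) hS).IsEquivalence ∧
      -- `H` factors through `C`
      (∃ H' : IteratedTilt T F ⥤ A,
        Nonempty (FourTuple.inclusion hTF hC ⋙ H' ≅ FourTuple.H T F)) ∧
      -- the quasi-isomorphisms are exactly the morphisms inverted by `H`
      (∀ ⦃Q R : FourTuple T F⦄ (f : Q ⟶ R),
        FourTuple.quasiIso hTF f ↔ IsIso ((FourTuple.H T F).map f)) := by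
  let iB : Abelian (HRSTilt T F) := HRSTilt.abelian hTF
  have hB : IsTorsionPair (tiltTorsion T F) (tiltFree T F) := HRSTilt.isTorsionPair hTF
  let iC : Abelian (IteratedTilt T F) := HRSTilt.abelian hB
  have hC := FourTuple.toArrow_tilt hTF
  have hS := FourTuple.isInvertedBy_inclusion hTF hC
  let i := FourTuple.inclusion hTF hC
  have hi : i.Additive := FourTuple.additive_inclusion hTF hC
  let Λ := Localization.Construction.lift i hS
  have hΛ : Λ.IsEquivalence := FourTuple.lift_inclusion_isEquivalence hTF hC hS
  have hW := fun ⦃Q R : FourTuple T F⦄ (f : Q ⟶ R) => FourTuple.quasiIso_iff hTF f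
  -- The additive structure of the localization is transported along the equivalence, which makes
  -- that equivalence additive by construction; additivity of the localization functor then follows
  -- from that of the inclusion.
  let : Preadditive (FourTuple.quasiIso hTF).Localization :=
    Preadditive.ofFullyFaithful Λ.asEquivalence.fullyFaithfulFunctor
  have hΛa : Λ.Additive := Λ.asEquivalence.fullyFaithfulFunctor.additive_ofFullyFaithful
  have : HasFiniteProducts (FourTuple.quasiIso hTF).Localization :=
    ⟨fun _ => Adjunction.hasLimitsOfShape_of_equivalence Λ⟩
  have hQ : (FourTuple.quasiIso hTF).Q.Additive := ⟨by
    intro X Y a b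
    apply Λ.map_injective
    rw [Λ.map_add]
    exact (HasGraphs.lift_Q_map i hS _).trans (i.map_add.trans (congrArg₂ (· + ·)
      (HasGraphs.lift_Q_map i hS a).symm (HasGraphs.lift_Q_map i hS b).symm))⟩
  -- `H'` is a quasi-inverse of the equivalence followed by the functor that `H` induces on the
  -- localization.
  refine ⟨iB, hB, hC, iC, abelianOfEquivalence Λ, hS, hQ, hi, hΛa, hΛ, ⟨Λ.inv ⋙
    HasGraphs.induced hW, ⟨?_⟩⟩, hW⟩
  exact Functor.isoWhiskerRight (eqToIso (Localization.Construction.fac i hS).symm) _ ≪≫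
    Functor.isoWhiskerLeft (FourTuple.quasiIso hTF).Q
      (Functor.isoWhiskerRight Λ.asEquivalence.unitIso.symm (HasGraphs.induced hW)) ≪≫
    Functor.isoWhiskerLeft (FourTuple.quasiIso hTF).Q (Functor.leftUnitor _) ≪≫
    eqToIso (Localization.Construction.fac _ _)
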